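/- Let $\mathbb T=\mathbb R/2\pi\mathbb Z$ and let $L^2=L^2(\mathbb T)$, $H^2=H^2(\mathbb T)$ be the spaces of real functions, with $\|u\|_{H^2}^2=\sum_{k\in\mathbb Z}(1+k^2)^2|\hat u(k)|^2$. For $\varepsilon>0$ consider the fast-reaction system $$\partial_t u=\Delta u+\tfrac1\varepsilon\big[v^2-u(u+1)\big],\qquad \partial_t v=\Delta v \qquad\text{on }\mathbb T, \tag{1}$$ whose strict solutions on $[0,T]$ are the solutions $(u,v)\in C([0,T];H^2\times H^2)\cap C^1([0,T];L^2\times L^2)$, and its attracting critical manifold $$S_0=\{(h^0(v),v)\},\qquad h^0(v)=-\tfrac12+\sqrt{\tfrac14+v^2}.$$ Given $\lambda_0\in(-1,0)$ and $\zeta>0$, let $k_0\ge 0$ be the integer with $-(k_0+1)^2<\zeta^{-1}\lambda_0\le -k_0^2$, let $Y_S^\zeta$ be the space of real functions in $\operatorname{span}\{e^{ikx}:|k|\le k_0\}$ and $Y_F^\zeta$ the closed span in $L^2$ (real functions) of the modes $|k|>k_0$. The reduced slow system is $$u_\zeta^0=h^0(v_\zeta^0),\qquad v_\zeta^0(t)\in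 Y_S^\zeta,\qquad \partial_t v_\zeta^0=\Delta v_\zeta^0 ,$$ and $S_{0,\zeta}=\{(u,v)\in S_0: v\in Y_S^\zeta,\ \|v\|_{H^2}\le\sigma\}$. For every $\lambda_0\in(-1,0)$ there is $\sigma_0>0$ such that for every $\sigma\in(0,\sigma_0]$ there are $\varepsilon_0,\zeta_0,C>0$ such that for all $\varepsilon\in(0,\varepsilon_0]$ and $\zeta\in(0,\zeta_0]$ with $\varepsilon\zeta^{-1}<1$ there is a $C^1$ map $h=(h_X,h_F):(Y_S^\zeta,\|\cdot\|_{H^2})\to H^2\times(Y_F^\zeta\cap H^2)$ for which the slow manifold $$S_{\varepsilon,\zeta}=\{(h_X(v_0),\,v_0+h_F(v_0)):v_0\in Y_S^\zeta,\ \|v_0\|_{H^2}\le\sigma\}$$ satisfies the following. 1. $S_{\varepsilon,\zeta}$ is locally invariant under (1): trajectories of strict solutions can leave or enter $S_{\varepsilon,\zeta}$ only through its boundary (the points with $\|v_0\|_{H^2}=\sigma$). 2. The Hausdorff distance in $H^2\times H^2$ satisfies $\operatorname{dist}(S_{\varepsilon,\zeta},S_{0,\zeta})\le C(\varepsilon+\zeta^{1/2})$.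 3. For every $v_0\in Y_S^\zeta$ with $\|v_0\|_{H^2}\le\sigma$ and every $T>0$, system (1) has a strict solution $(u^\varepsilon,v^\varepsilon)$ on $[0,T]$ starting at the point $(h_X(v_0),v_0+h_F(v_0))$ of $S_{\varepsilon,\zeta}$, the reduced slow system has a strict solution $(u_\zeta^0,v_\zeta^0)$ on $[0,T]$ with $v_\zeta^0(0)=v_0$, and all such solutions satisfy $$\sup_{0\le t\le T}\big(\|u^\varepsilon(t)-u_\zeta^0(t)\|_{H^2}+\|v^\varepsilon(t)-v_\zeta^0(t)\|_{H^2}\big)\le C(\varepsilon+\zeta^{1/2}).$$ -/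

import Mathlib

open MeasureTheory Set

namespace FastReaction

noncomputable section

instance fact_zero_lt_two_pi : Fact ((0 : ℝ) < 2 * Real.pi) := ⟨Real.two_pi_pos⟩

/-- The one-dimensional torus `ℝ / 2πℤ`. -/
abbrev Torus : Type := AddCircle (2 * Real.pi)

/-- The real space `L²(𝕋)` (with respect to the normalized Lebesgue measure on the torus). -/
abbrev L2 : Type := Lp ℝ 2 (AddCircle.haarAddCircle (T := 2 * Real.pi))

/-- The `k`-th Fourier coefficient `(1/2π) ∫ f(x) e^{-ikx} dx` of a real function on the torus. -/
def coeff (f : Torus → ℝ) (k : ℤ) : ℂ := fourierCoeff (fun x => ((f x : ℝ) : ℂ)) k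

lemma integrable_ofReal (f : C(Torus, ℝ)) :
    Integrable (fun x => ((f x : ℝ) : ℂ)) (AddCircle.haarAddCircle (T := 2 * Real.pi)) :=
  (Complex.continuous_ofReal.comp f.continuous).integrable_of_hasCompactSupport
    (HasCompactSupport.of_compactSpace _)

lemma coeff_add (f g : C(Torus, ℝ)) (k : ℤ) : coeff (f + g) k = coeff f k + coeff g k := by
  have h := fourierCoeff.add (integrable_ofReal f) (integrable_ofReal g)
  have h' := congrFun h k
  simp only [Pi.add_apply] at h'
  rw [coeff, coeff, coeff, ← h']
  congr 1
  funext x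
  simp

lemma coeff_smul (c : ℝ) (f : C(Torus, ℝ)) (k : ℤ) : coeff (c • f) k = (c : ℂ) * coeff f k := by
  have h := fourierCoeff.const_mul (fun x => ((f x : ℝ) : ℂ)) (c : ℂ) k
  rw [coeff, coeff, ← h]
  congr 1
  funext x
  simp

lemma coeff_zero (k : ℤ) : coeff (0 : C(Torus, ℝ)) k = 0 := by
  have h := coeff_smul 0 0 k
  simpa using h

/-- The sequence `((1 + k²) û(k))_k` attached to a function `u` on the torus. -/
def weighted (f : Torus → ℝ) (k : ℤ) : ℂ := ((1 + (k : ℝ) ^ 2 : ℝ) : ℂ) * coeff f k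

lemma weighted_add (f g : C(Torus, ℝ)) :
    weighted (f + g) = weighted f + weighted g := by
  funext k
  simp only [weighted, Pi.add_apply]
  rw [coeff_add, mul_add]

lemma weighted_smul (c : ℝ) (f : C(Torus, ℝ)) :
    weighted (c • f) = c • weighted f := by
  funext k
  simp only [weighted, Pi.smul_apply, Complex.real_smul]
  rw [coeff_smul]
  ring

/-- The real functions on the torus whose weighted Fourier coefficients `(1 + k²) û(k)` are square
summable. In dimension one every class of `H²(𝕋)` has exactly one continuous representative, and
the elements of `H²(𝕋)` are these representatives. -/
def h2Submodule : Submodule ℝ C(Torus, ℝ) where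
  carrier := {f | Memℓp (weighted f) 2}
  add_mem' := by
    intro f g hf hg
    simp only [mem_ofPred_eq] at *
    have h := weighted_add f g
    rw [ContinuousMap.coe_add, h]
    exact hf.add hg
  zero_mem' := by
    have h : weighted (0 : C(Torus, ℝ)) = 0 := by
      funext k
      simp only [weighted, Pi.zero_apply]
      rw [coeff_zero, mul_zero]
    simp only [mem_ofPred_eq]
    rw [h]
    exact zero_memℓp
  smul_mem' := by
    intro c f hf
    simp only [mem_ofPred_eq] at *
    have h := weighted_smul c f
    rw [ContinuousMap.coe_smul, h]
    exact hf.const_smul c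

/-- The Sobolev space `H²(𝕋)` of real functions on the torus. -/
def H2 : Type := h2Submodule

instance : AddCommGroup H2 := inferInstanceAs (AddCommGroup h2Submodule)

instance : Module ℝ H2 := inferInstanceAs (Module ℝ h2Submodule)

/-- The continuous function underlying an element of `H²(𝕋)`. -/
def toCont : H2 →ₗ[ℝ] C(Torus, ℝ) := h2Submodule.subtype

lemma toCont_mem (u : H2) : Memℓp (weighted (toCont u)) 2 := Subtype.property u

lemma toCont_injective : Function.Injective toCont := Subtype.val_injective

/-- The map `u ↦ ((1 + k²) û(k))_k` from `H²(𝕋)` to `ℓ²(ℤ)`. -/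
def weightedCoeff : H2 →ₗ[ℝ] lp (fun _ : ℤ => ℂ) 2 where
  toFun u := ⟨weighted (toCont u), toCont_mem u⟩
  map_add' := by
    intro u v
    apply Subtype.ext
    change weighted (toCont (u + v)) = weighted (toCont u) + weighted (toCont v)
    rw [map_add]
    exact weighted_add (toCont u) (toCont v)
  map_smul' := by
    intro c u
    apply Subtype.ext
    change weighted (toCont (c • u)) = c • weighted (toCont u)
    rw [map_smul]
    exact weighted_smul c (toCont u)

lemma weightedCoeff_injective : Function.Injective weightedCoeff := by
  rw [← LinearMap.ker_eq_bot, LinearMap.ker_eq_bot']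
  intro u hu
  have hc : ∀ k, coeff (toCont u) k = 0 := by
    intro k
    have h1 : weighted (toCont u) k = 0 := congrFun (congrArg Subtype.val hu) k
    have h2 : ((1 + (k : ℝ) ^ 2 : ℝ) : ℂ) ≠ 0 := by
      have : (1 + (k : ℝ) ^ 2 : ℝ) ≠ 0 := by positivity
      exact_mod_cast this
    exact (mul_eq_zero.mp h1).resolve_left h2
  apply toCont_injective
  rw [map_zero]
  let F : C(Torus, ℂ) := ⟨fun x => ((toCont u x : ℝ) : ℂ),
    Complex.continuous_ofReal.comp (toCont u).continuous⟩
  have hF : fourierCoeff F = 0 := by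
    funext k
    exact hc k
  have hs : Summable (fourierCoeff F) := by
    rw [hF]
    exact summable_zero
  ext x
  have h3 := has_pointwise_sum_fourier_series_of_summable hs x
  rw [hF] at h3
  have h4 : F x = 0 := by
    refine h3.unique ?_
    simp
  have h5 : ((toCont u x : ℝ) : ℂ) = 0 := h4
  simpa using h5

/-- The norm of `H²(𝕋)`: `‖u‖² = ∑ (1 + k²)² |û(k)|²`. -/
instance : NormedAddCommGroup H2 :=
  NormedAddCommGroup.induced H2 (lp (fun _ : ℤ => ℂ) 2) weightedCoeff weightedCoeff_injective

instance : NormedSpace ℝ H2 := NormedSpace.induced ℝ H2 (lp (fun _ : ℤ => ℂ) 2) weightedCoeff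

lemma norm_sq_eq (u : H2) :
    ‖u‖ ^ 2 = ∑' k : ℤ, (1 + (k : ℝ) ^ 2) ^ 2 * ‖coeff (toCont u) k‖ ^ 2 := by
  have h := lp.norm_rpow_eq_tsum (p := 2) (by norm_num) (weightedCoeff u)
  have h0 : ‖u‖ = ‖weightedCoeff u‖ := rfl
  simp only [ENNReal.toReal_ofNat, Real.rpow_ofNat] at h
  rw [h0, h]
  refine tsum_congr fun k => ?_
  have h1 : (weightedCoeff u : ℤ → ℂ) k = ((1 + (k : ℝ) ^ 2 : ℝ) : ℂ) * coeff (toCont u) k := rfl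
  rw [h1, norm_mul, mul_pow, Complex.norm_real, Real.norm_of_nonneg (by positivity)]

/-- The class in `L²(𝕋)` of a continuous function. -/
def toL2 (f : C(Torus, ℝ)) : L2 :=
  ContinuousMap.toLp 2 (AddCircle.haarAddCircle (T := 2 * Real.pi)) ℝ f

/-- `w = Δu` in `L²(𝕋)`: the Fourier coefficients of `w` are `-k² û(k)`. -/
def IsLaplacian (u : H2) (w : L2) : Prop :=
  ∀ k : ℤ, coeff w k = -(k : ℂ) ^ 2 * coeff (toCont u) k

/-- `(u, v)` is a strict solution on `[0, T]`, i.e. of class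
`C([0,T]; H² × H²) ∩ C¹([0,T]; L² × L²)`, of the fast-reaction system
`∂ₜu = Δu + ε⁻¹ (v² - u(u+1))`, `∂ₜv = Δv`. The time derivatives are taken in `L²`; they are
continuous because the right-hand sides are. -/
structure IsSolution (ε T : ℝ) (u v : ℝ → H2) : Prop where
  continuousOn_u : ContinuousOn u (Icc 0 T)
  continuousOn_v : ContinuousOn v (Icc 0 T)
  eq_u : ∀ t ∈ Icc 0 T, ∃ w : L2, IsLaplacian (u t) w ∧
    HasDerivWithinAt (fun s => toL2 (toCont (u s)))
      (w + ε⁻¹ • toL2 (toCont (v t) ^ 2 - toCont (u t) * (toCont (u t) + 1))) (Icc 0 T) t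
  eq_v : ∀ t ∈ Icc 0 T, ∃ w : L2, IsLaplacian (v t) w ∧
    HasDerivWithinAt (fun s => toL2 (toCont (v s))) w (Icc 0 T) t

/-- The (attracting branch of the) critical manifold, `u = h⁰(v) = -1/2 + √(1/4 + v²)`. -/
def criticalManifold : Set (H2 × H2) :=
  {p | ∀ x, toCont p.1 x = -(1 / 2) + Real.sqrt (1 / 4 + (toCont p.2 x) ^ 2)}

/-- The slow modes: the real functions in the span of `e^{ikx}`, `|k| ≤ k₀`. -/
def slowSpace (k₀ : ℕ) : Submodule ℝ H2 where
  carrier := {v | ∀ k : ℤ, (k₀ : ℤ) < |k| → weightedCoeff v k = 0}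
  add_mem' := by
    intro u v hu hv k hk
    rw [map_add, lp.coeFn_add, Pi.add_apply, hu k hk, hv k hk, add_zero]
  zero_mem' := by
    intro k _
    rw [map_zero]
    rfl
  smul_mem' := by
    intro c u hu k hk
    rw [map_smul, lp.coeFn_smul, Pi.smul_apply, hu k hk, smul_zero]

/-- The fast modes in `H²`: the closed span of `e^{ikx}`, `|k| > k₀`. -/
def fastSpace (k₀ : ℕ) : Submodule ℝ H2 where
  carrier := {v | ∀ k : ℤ, |k| ≤ (k₀ : ℤ) → weightedCoeff v k = 0}
  add_mem' := by
    intro u v hu hv k hk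
    rw [map_add, lp.coeFn_add, Pi.add_apply, hu k hk, hv k hk, add_zero]
  zero_mem' := by
    intro k _
    rw [map_zero]
    rfl
  smul_mem' := by
    intro c u hu k hk
    rw [map_smul, lp.coeFn_smul, Pi.smul_apply, hu k hk, smul_zero]

lemma weightedCoeff_eq_zero_iff (u : H2) (k : ℤ) :
    weightedCoeff u k = 0 ↔ coeff (toCont u) k = 0 := by
  have h1 : weightedCoeff u k = ((1 + (k : ℝ) ^ 2 : ℝ) : ℂ) * coeff (toCont u) k := rfl
  have h2 : ((1 + (k : ℝ) ^ 2 : ℝ) : ℂ) ≠ 0 := by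
    have : (1 + (k : ℝ) ^ 2 : ℝ) ≠ 0 := by positivity
    exact_mod_cast this
  rw [h1, mul_eq_zero, or_iff_right h2]

/-- `(u, v)` is a strict solution on `[0, T]` of the reduced slow system
`u = h⁰(v)`, `pr_F v = 0`, `∂ₜv = Δv` (the slow equation has no reaction term). -/
structure IsReducedSolution (k₀ : ℕ) (T : ℝ) (u v : ℝ → H2) : Prop where
  continuousOn_v : ContinuousOn v (Icc 0 T)
  mem_critical : ∀ t ∈ Icc 0 T, (u t, v t) ∈ criticalManifold
  mem_slow : ∀ t ∈ Icc 0 T, v t ∈ slowSpace k₀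
  eq_v : ∀ t ∈ Icc 0 T, ∃ w : L2, IsLaplacian (v t) w ∧
    HasDerivWithinAt (fun s => toL2 (toCont (v s))) w (Icc 0 T) t

/-- The part `S_{0,ζ}` of the critical manifold over the closed ball of radius `σ` of the slow
space, in the `H²` norm. -/
def reducedCritical (k₀ : ℕ) (σ : ℝ) : Set (H2 × H2) :=
  {p | p ∈ criticalManifold ∧ p.2 ∈ slowSpace k₀ ∧ ‖p.2‖ ≤ σ}

/-- The point `(h_X(v₀), v₀ + h_F(v₀))` of phase space over `v₀`. -/
def graphPoint {k₀ : ℕ} (h : slowSpace k₀ → H2 × fastSpace k₀) (v₀ : slowSpace k₀) : H2 × H2 :=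
  ((h v₀).1, (v₀ : H2) + ((h v₀).2 : H2))

/-- The graph of `h` over the closed ball of radius `σ` of the slow space. -/
def graphManifold {k₀ : ℕ} (h : slowSpace k₀ → H2 × fastSpace k₀) (σ : ℝ) : Set (H2 × H2) :=
  graphPoint h '' Metric.closedBall 0 σ

/-- The boundary of the manifold `graphManifold h σ`. -/
def graphBoundary {k₀ : ℕ} (h : slowSpace k₀ → H2 × fastSpace k₀) (σ : ℝ) : Set (H2 × H2) :=
  graphPoint h '' Metric.sphere 0 σ

/-- A manifold `S` with boundary `∂S` is locally invariant under the fast-reaction system if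
trajectories leave and enter `S` only through `∂S`. -/
def IsLocallyInvariant (ε : ℝ) (S bdS : Set (H2 × H2)) : Prop :=
  ∀ (T : ℝ) (u v : ℝ → H2), IsSolution ε T u v →
    ∀ s t, 0 ≤ s → s < t → t ≤ T →
      ((u s, v s) ∈ S → (u t, v t) ∉ S → ∃ r ∈ Ico s t, (u r, v r) ∈ bdS) ∧
      ((u s, v s) ∉ S → (u t, v t) ∈ S → ∃ r ∈ Ioc s t, (u r, v r) ∈ bdS)

end

end FastReaction

open FastReaction

/-! The equation for `v` is a heat equation that does not see `u`. Hence the slow modes are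
invariant, `h_F = 0` is admissible, and on the finite-dimensional slow space the heat flow is a
group that grows backward in time at most like `exp (k₀² s)`. It remains to find a map `U` from the
slow space to `H²` such that `u = U(v)` solves the fast equation along every slow trajectory in the
ball of radius `σ`.

Near zero the critical manifold is the graph of a `C¹` map `φ` with `φ² + φ = v²`
(`exists_criticalMap`). Put `U = φ + W`. Since `Δφ(v) = φ'(v)Δv + φ''(v)v_x²` (`lap_criticalMap`),
invariance of the graph reads `∂ₜW = ΔW - ε⁻¹W + φ''(v)v_x² - ε⁻¹(2φW + W²)` along `∂ₜv = Δv`. By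
the method of Lyapunov and Perron, `W` is a fixed point of a Duhamel integral over the whole past
with kernel `exp (-s/ε) exp (sΔ)`, once `φ` and the forcing have been cut off outside a ball
(`exists_invariant_graph`, `exists_isSlowGraph`). Differentiation in `v` meets the backward growth
`exp (k₀² s)`. The resulting factor `ε⁻¹/(ε⁻¹ - k₀²) = 1/(1 - εk₀²)` is at most `1/(1 + λ₀)`,
because `εk₀² < ζk₀² ≤ -λ₀` when `k₀ > 0`; this is the spectral gap. The forcing `φ''(v)v_x²` has
`H²` norm `O(k₀σ²)`: by a product estimate in which only one factor carries the full `H²` norm, a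
single power of `k₀` is lost (`norm_mul_slowDeriv_le`). So `W = O(εk₀) = O(ζ^{1/2})`, which is the
distance in assertions 2 and 3.

For a given `v` the fast equation has forward uniqueness by an energy estimate and backward
uniqueness by monotonicity of a corrected Dirichlet quotient (`IsPerturbedFlow.forward`,
`IsPerturbedFlow.backward`). Since the norm of a slow trajectory does not increase, a solution on
the manifold never leaves it, and one that enters was on it already or crosses the boundary. By
forward uniqueness the solution issuing from the manifold is `(U(v), v)`, and its `v` is that of the
reduced solution, so the error bound is uniform in time. -/

namespace FastReaction

/-! ### Fourier coefficients of real square integrable functions -/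

noncomputable section

/-- The Hilbert space `ℓ²(ℤ; ℂ)` of Fourier coefficients. -/
abbrev Ell : Type := lp (fun _ : ℤ => ℂ) 2

/-- The normalized Haar measure on the torus. -/
abbrev haar : Measure Torus := AddCircle.haarAddCircle (T := 2 * Real.pi)

/-- The inclusion of real into complex square integrable functions. -/
def complexify : L2 →L[ℝ] Lp ℂ 2 haar := Complex.ofRealCLM.compLpL 2 haar

lemma complexify_ae (f : L2) : complexify f =ᵐ[haar] fun x => ((f x : ℝ) : ℂ) :=
  ContinuousLinearMap.coeFn_compLpL _ _

lemma norm_complexify (f : L2) : ‖complexify f‖ = ‖f‖ := by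
  rw [Lp.norm_def, Lp.norm_def]
  congr 1
  refine eLpNorm_congr_norm_ae ?_
  filter_upwards [complexify_ae f] with x hx
  rw [hx]
  simp

lemma coeff_eq_fourierCoeff_complexify (f : L2) (k : ℤ) :
    coeff f k = fourierCoeff (complexify f) k := by
  rw [fourierCoeff_congr_ae (complexify_ae f)]
  rfl

/-- The isometry taking a real square integrable function to its Fourier coefficients. -/
def coeffL2 : L2 →ₗᵢ[ℝ] Ell where
  toFun f := fourierBasis.repr (complexify f)
  map_add' f g := by rw [map_add, map_add]
  map_smul' c f := by
    rw [map_smul, RingHom.id_apply]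
    have h : c • complexify f = (c : ℂ) • complexify f := (Complex.coe_smul c _).symm
    rw [h, map_smul]
    exact Complex.coe_smul c _
  norm_map' f := by
    change ‖fourierBasis.repr (complexify f)‖ = ‖f‖
    rw [LinearIsometryEquiv.norm_map, norm_complexify]

lemma coeffL2_apply (f : L2) (k : ℤ) : coeffL2 f k = coeff f k := by
  rw [coeff_eq_fourierCoeff_complexify, ← fourierBasis_repr]
  rfl

/-- The sequences of Fourier coefficients of real functions. -/
def hermitian : Set Ell := {a | ∀ k : ℤ, a (-k) = star (a k)}

lemma coeff_neg (f : Torus → ℝ) (k : ℤ) : coeff f (-k) = star (coeff f k) := by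
  simp only [coeff, fourierCoeff, RCLike.star_def]
  rw [← integral_conj]
  refine integral_congr_ae (Filter.Eventually.of_forall fun x => ?_)
  simp only [smul_eq_mul, map_mul, Complex.conj_ofReal]
  rw [fourier_neg, fourier_neg]

/-- Taking real parts acts on coefficients as projection onto the Hermitian sequences. Hence a
Hermitian sequence is realized by the real part of its complex Fourier series. -/
lemma fourierCoeff_re (f : Torus → ℂ) (hf : Integrable f haar) (k : ℤ) :
    coeff (fun x => (f x).re) k = (fourierCoeff f k + star (fourierCoeff f (-k))) / 2 := by
  have h2 : star (fourierCoeff f (-k)) = fourierCoeff (fun x => star (f x)) k := by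
    simp only [fourierCoeff, RCLike.star_def]
    rw [← integral_conj]
    refine integral_congr_ae (Filter.Eventually.of_forall fun x => ?_)
    simp only [smul_eq_mul, map_mul]
    rw [neg_neg, fourier_neg]
  have hf' : Integrable (fun x => star (f x)) haar := by
    have := (Complex.conjCLE.toContinuousLinearMap).integrable_comp hf
    exact this
  have h3 := congrFun (fourierCoeff.add hf hf') k
  rw [Pi.add_apply] at h3
  rw [h2, ← h3, coeff, div_eq_inv_mul, ← fourierCoeff.const_mul]
  congr 1
  funext x
  simp only [Pi.add_apply, RCLike.star_def, Complex.add_conj]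
  push_cast
  ring

lemma exists_coeffL2_eq {a : Ell} (ha : a ∈ hermitian) : ∃ f : L2, coeffL2 f = a := by
  set F : Lp ℂ 2 haar := fourierBasis.repr.symm a with hF
  refine ⟨Complex.reCLM.compLpL 2 haar F, ?_⟩
  ext k
  rw [coeffL2_apply]
  have h1 : coeff (Complex.reCLM.compLpL 2 haar F) k = coeff (fun x => (F x).re) k := by
    refine congrFun (fourierCoeff_congr_ae ?_) k
    filter_upwards [ContinuousLinearMap.coeFn_compLpL (𝕜' := ℝ) Complex.reCLM F] with x hx
    rw [hx]
    rfl
  have hint : Integrable F haar := (Lp.memLp F).integrable (by norm_num)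
  rw [h1, fourierCoeff_re _ hint, ← fourierBasis_repr, ← fourierBasis_repr, hF,
    LinearIsometryEquiv.apply_symm_apply, ha k, star_star]
  ring

/-! ### The Sobolev space -/

lemma weightedCoeff_apply (u : H2) (k : ℤ) :
    weightedCoeff u k = ((1 + (k : ℝ) ^ 2 : ℝ) : ℂ) * coeff (toCont u) k := rfl

lemma weight_pos (k : ℤ) : (0 : ℝ) < 1 + (k : ℝ) ^ 2 := by positivity

lemma weight_ne (k : ℤ) : (((1 + (k : ℝ) ^ 2 : ℝ)) : ℂ) ≠ 0 := by
  exact_mod_cast (weight_pos k).ne'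

lemma coeff_eq_weightedCoeff (u : H2) (k : ℤ) :
    coeff (toCont u) k = ((1 + (k : ℝ) ^ 2 : ℝ) : ℂ)⁻¹ * weightedCoeff u k := by
  rw [weightedCoeff_apply, inv_mul_cancel_left₀ (weight_ne k)]

lemma norm_weightedCoeff (u : H2) : ‖weightedCoeff u‖ = ‖u‖ := rfl

/-- `weightedCoeff` as a linear isometry. -/
def weightedIso : H2 →ₗᵢ[ℝ] Ell := ⟨weightedCoeff, norm_weightedCoeff⟩

lemma weightedIso_apply (u : H2) : weightedIso u = weightedCoeff u := rfl

lemma weightedCoeff_mem_hermitian (u : H2) : weightedCoeff u ∈ hermitian := by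
  intro k
  rw [weightedCoeff_apply, weightedCoeff_apply, coeff_neg, star_mul', RCLike.star_def,
    Complex.conj_ofReal]
  push_cast
  ring

lemma summable_inv_weight_sq : Summable fun k : ℤ => ((1 + (k : ℝ) ^ 2)⁻¹) ^ 2 := by
  have h : Summable fun k : ℤ => 1 / (k : ℝ) ^ 2 := by
    exact Real.summable_one_div_int_pow.mpr (by norm_num)
  refine Summable.of_norm_bounded_eventually h ?_
  have : ({0} : Set ℤ)ᶜ ∈ Filter.cofinite := (Set.finite_singleton 0).compl_mem_cofinite
  filter_upwards [this] with k hk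
  have hk' : (k : ℝ) ≠ 0 := by simpa using hk
  have hk2 : 0 < (k : ℝ) ^ 2 := by positivity
  rw [Real.norm_of_nonneg (by positivity), inv_pow, one_div]
  apply inv_anti₀ hk2
  nlinarith

lemma summable_norm_sq (a : Ell) : Summable fun k : ℤ => ‖a k‖ ^ 2 := by
  have := lp.hasSum_norm (p := 2) (by norm_num) a
  simpa using this.summable

lemma norm_sq_eq_tsum (a : Ell) : ‖a‖ ^ 2 = ∑' k : ℤ, ‖a k‖ ^ 2 := by
  have := lp.norm_rpow_eq_tsum (p := 2) (by norm_num) a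
  simpa using this

/-- The constant of the embedding of `H²` into the Wiener algebra. -/
def embConst : ℝ := Real.sqrt (∑' k : ℤ, ((1 + (k : ℝ) ^ 2)⁻¹) ^ 2)

lemma embConst_nonneg : 0 ≤ embConst := Real.sqrt_nonneg _

lemma norm_coeff_eq (u : H2) (k : ℤ) :
    ‖coeff (toCont u) k‖ = (1 + (k : ℝ) ^ 2)⁻¹ * ‖weightedCoeff u k‖ := by
  rw [coeff_eq_weightedCoeff, norm_mul, norm_inv, Complex.norm_real,
    Real.norm_of_nonneg (weight_pos k).le]

lemma summable_weighted (a : Ell) :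
    Summable (fun k : ℤ => (1 + (k : ℝ) ^ 2)⁻¹ * ‖a k‖) := by
  refine Summable.of_nonneg_of_le (fun k => by positivity) (fun k => ?_)
    ((summable_inv_weight_sq.add (summable_norm_sq a)))
  nlinarith [sq_nonneg ((1 + (k : ℝ) ^ 2)⁻¹ - ‖a k‖), sq_nonneg ((1 + (k : ℝ) ^ 2)⁻¹ + ‖a k‖)]

/-- The Wiener norm `∑ |û(k)|`. -/
def wiener (u : H2) : ℝ := ∑' k : ℤ, ‖coeff (toCont u) k‖

lemma summable_coeff (u : H2) : Summable fun k : ℤ => ‖coeff (toCont u) k‖ := by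
  simp_rw [norm_coeff_eq]
  exact summable_weighted _

/-- Cauchy–Schwarz, with the square summable weights `(1 + k²)⁻¹`. -/
lemma wiener_le (u : H2) : wiener u ≤ embConst * ‖u‖ := by
  have h := Real.inner_le_Lp_mul_Lq_tsum_of_nonneg (p := 2) (q := 2)
    Real.HolderConjugate.two_two
    (f := fun k : ℤ => (1 + (k : ℝ) ^ 2)⁻¹) (g := fun k => ‖weightedCoeff u k‖)
    (fun k => (inv_pos.mpr (weight_pos k)).le) (fun k => norm_nonneg _)
    (by simpa using summable_inv_weight_sq) (by simpa using summable_norm_sq (weightedCoeff u))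
  have e : (∑' k : ℤ, ‖weightedCoeff u k‖ ^ (2 : ℝ)) ^ (1 / (2 : ℝ)) = ‖u‖ := by
    simp_rw [Real.rpow_two]
    rw [← norm_sq_eq_tsum, ← Real.sqrt_eq_rpow, Real.sqrt_sq (norm_nonneg _), norm_weightedCoeff]
  rw [e] at h
  simp_rw [Real.rpow_two, ← Real.sqrt_eq_rpow] at h
  refine le_trans (le_of_eq ?_) h
  exact tsum_congr fun k => norm_coeff_eq u k

/-- The complex version of a continuous real function. -/
def toComplex (f : C(Torus, ℝ)) : C(Torus, ℂ) :=
  ⟨fun x => ((f x : ℝ) : ℂ), Complex.continuous_ofReal.comp f.continuous⟩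

lemma fourierCoeff_toComplex (f : C(Torus, ℝ)) (k : ℤ) :
    fourierCoeff (toComplex f) k = coeff f k := rfl

lemma hasSum_fourier (u : H2) :
    HasSum (fun k => coeff (toCont u) k • fourier k) (toComplex (toCont u)) :=
  hasSum_fourier_series_of_summable (f := toComplex (toCont u)) (summable_coeff u).of_norm

lemma abs_toCont_le (u : H2) (x : Torus) : |toCont u x| ≤ wiener u := by
  have h := hasSum_fourier u
  have h1 : ‖toComplex (toCont u)‖ ≤ wiener u := by
    rw [← h.tsum_eq]
    refine tsum_of_norm_bounded (summable_coeff u).hasSum fun k => ?_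
    rw [norm_smul, fourier_norm, mul_one]
  have h2 := (toComplex (toCont u)).norm_coe_le_norm x
  refine le_trans (le_of_eq ?_) (h2.trans h1)
  change _ = ‖((toCont u x : ℝ) : ℂ)‖
  simp

lemma norm_toCont_le (u : H2) : ‖toCont u‖ ≤ embConst * ‖u‖ := by
  refine (ContinuousMap.norm_le _ (by have := embConst_nonneg; positivity)).mpr fun x => ?_
  exact (abs_toCont_le u x).trans (wiener_le u)

/-- `toCont` as a continuous linear map. -/
def toContL : H2 →L[ℝ] C(Torus, ℝ) := toCont.mkContinuous embConst norm_toCont_le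

lemma coeff_toL2 (f : C(Torus, ℝ)) (k : ℤ) : coeff (toL2 f) k = coeff f k := by
  refine congrFun (fourierCoeff_congr_ae ?_) k
  filter_upwards [ContinuousMap.coeFn_toLp (𝕜 := ℝ) (p := 2) haar f] with x hx
  rw [toL2, hx]

/-- The class in `L²` of a continuous function, as a continuous linear map. -/
def toL2L : C(Torus, ℝ) →L[ℝ] L2 := ContinuousMap.toLp 2 haar ℝ

lemma toL2L_apply (f : C(Torus, ℝ)) : toL2L f = toL2 f := rfl

/-- The embedding of `H²` into `L²`. -/
def embL2 : H2 →L[ℝ] L2 := toL2L.comp toContL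

lemma embL2_apply (u : H2) : embL2 u = toL2 (toCont u) := rfl

lemma coeffL2_embL2 (u : H2) (k : ℤ) : coeffL2 (embL2 u) k = coeff (toCont u) k := by
  rw [coeffL2_apply, embL2_apply, coeff_toL2]

lemma coeff_injective {u v : H2} (h : ∀ k, coeff (toCont u) k = coeff (toCont v) k) : u = v := by
  apply weightedCoeff_injective
  ext k
  rw [weightedCoeff_apply, weightedCoeff_apply, h k]

lemma embL2_injective : Function.Injective embL2 := by
  intro u v h
  refine coeff_injective fun k => ?_
  rw [← coeffL2_embL2, ← coeffL2_embL2, h]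

/-- After division by the weights the sequence is absolutely summable, so its Fourier series
converges uniformly to a continuous function, whose real part has the required coefficients. Thus
`H2` is isometric to the closed set `hermitian`, which gives its completeness. -/
lemma exists_weightedCoeff_eq {a : Ell} (ha : a ∈ hermitian) : ∃ u : H2, weightedCoeff u = a := by
  set c : ℤ → ℂ := fun k => ((1 + (k : ℝ) ^ 2 : ℝ) : ℂ)⁻¹ * a k with hc
  have hcn : ∀ k, ‖c k‖ = (1 + (k : ℝ) ^ 2)⁻¹ * ‖a k‖ := by
    intro k
    rw [hc]
    simp only [norm_mul, norm_inv]
    rw [Complex.norm_real, Real.norm_of_nonneg (weight_pos k).le]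
  have hsum : Summable fun k => ‖c k‖ := by
    simp_rw [hcn]
    exact summable_weighted a
  have hsum' : Summable fun k => (c k • fourier k : C(Torus, ℂ)) := by
    refine Summable.of_norm ?_
    simpa [norm_smul, fourier_norm] using hsum
  set F : C(Torus, ℂ) := ∑' k, c k • fourier k with hF
  have hFc : ∀ k, fourierCoeff F k = c k := by
    intro k
    -- The coefficients are read off termwise after passing to `L²`, where each of them is a
    -- continuous functional.
    have h1 : HasSum (fun j => (c j • fourierLp 2 j : Lp ℂ 2 haar))
        (ContinuousMap.toLp (E := ℂ) 2 haar ℂ F) := by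
      have := (ContinuousMap.toLp (E := ℂ) 2 haar ℂ).hasSum hsum'.hasSum
      simpa using this
    have h2 := ((fourierBasis (T := 2 * Real.pi)).repr.toContinuousLinearEquiv :
      Lp ℂ 2 haar →L[ℂ] Ell).hasSum h1
    have h3 : HasSum (fun j => (fourierBasis.repr (c j • fourierLp 2 j : Lp ℂ 2 haar) : Ell) k)
        ((fourierBasis.repr (ContinuousMap.toLp (E := ℂ) 2 haar ℂ F) : Ell) k) :=
      (lp.evalCLM ℂ (fun _ : ℤ => ℂ) 2 k).hasSum h2
    rw [fourierBasis_repr, fourierCoeff_toLp] at h3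
    refine h3.unique ?_
    have h4 : ∀ j, (fourierBasis.repr (c j • fourierLp 2 j : Lp ℂ 2 haar) : Ell) k
        = if j = k then c k else 0 := by
      intro j
      rw [map_smul, lp.coeFn_smul, Pi.smul_apply, fourierBasis_repr,
        fourierCoeff_congr_ae (coeFn_fourierLp 2 j), fourierCoeff_fourier]
      by_cases hjk : j = k
      · subst hjk
        simp
      · simp [hjk, Ne.symm hjk]
    simp_rw [h4]
    exact hasSum_ite_eq k (c k)
  let f : C(Torus, ℝ) := ⟨fun x => (F x).re, Complex.continuous_re.comp F.continuous⟩
  have hint : Integrable F haar :=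
    F.continuous.integrable_of_hasCompactSupport (HasCompactSupport.of_compactSpace _)
  have hw : weighted f = a := by
    funext k
    have h1 : coeff f k = c k := by
      change coeff (fun x => (F x).re) k = c k
      rw [fourierCoeff_re F hint, hFc, hFc]
      have : star (c (-k)) = c k := by
        rw [hc]
        simp only [star_mul', ha k, star_star]
        rw [RCLike.star_def, map_inv₀, Complex.conj_ofReal]
        push_cast
        ring
      rw [this]
      ring
    rw [weighted, h1, hc]
    exact mul_inv_cancel_left₀ (weight_ne k) _
  have hmem : f ∈ h2Submodule := by
    change Memℓp (weighted f) 2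
    rw [hw]
    exact a.2
  exact ⟨⟨f, hmem⟩, Subtype.ext hw⟩

lemma continuous_evalEll (k : ℤ) : Continuous fun a : Ell => a k :=
  (lp.evalCLM ℂ (fun _ : ℤ => ℂ) 2 k).continuous

lemma isClosed_hermitian : IsClosed hermitian := by
  have : hermitian = ⋂ k : ℤ, {a : Ell | a (-k) = star (a k)} := by
    ext a
    simp [hermitian]
  rw [this]
  exact isClosed_iInter fun k => isClosed_eq (continuous_evalEll _)
    (continuous_star.comp (continuous_evalEll k))

instance : CompleteSpace H2 := by
  have h : range weightedIso = hermitian := by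
    ext a
    constructor
    · rintro ⟨u, rfl⟩
      exact weightedCoeff_mem_hermitian u
    · exact fun ha => exists_weightedCoeff_eq ha
  have h1 : IsComplete (range weightedIso) := by
    rw [h]
    exact isClosed_hermitian.isComplete
  have h2 : IsComplete (univ : Set H2) := by
    rw [← image_univ] at h1
    exact weightedIso.isometry.isUniformInducing.isComplete_iff.mp h1
  exact completeSpace_of_isComplete_univ h2

end

end FastReaction

namespace FastReaction

noncomputable section

/-! ### Products -/

lemma Ell.norm_le_of_forall {a b : Ell} (h : ∀ k, ‖a k‖ ≤ ‖b k‖) : ‖a‖ ≤ ‖b‖ := by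
  rw [← sq_le_sq₀ (norm_nonneg _) (norm_nonneg _), norm_sq_eq_tsum, norm_sq_eq_tsum]
  exact (summable_norm_sq a).tsum_le_tsum
    (fun k => pow_le_pow_left₀ (norm_nonneg _) (h k) 2) (summable_norm_sq b)

lemma memℓp_of_summable_sq {f : ℤ → ℂ} (h : Summable fun k => ‖f k‖ ^ 2) : Memℓp f 2 := by
  rw [memℓp_gen_iff (by norm_num)]
  simpa using h

lemma memℓp_of_norm_le {f : ℤ → ℂ} (b : Ell) (h : ∀ k, ‖f k‖ ≤ ‖b k‖) : Memℓp f 2 :=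
  memℓp_of_summable_sq <| Summable.of_nonneg_of_le (fun _ => by positivity)
    (fun k => pow_le_pow_left₀ (norm_nonneg _) (h k) 2) (summable_norm_sq b)

/-- The sequence `k ↦ |b (k - j)|`. -/
def absShift (b : Ell) (j : ℤ) : Ell :=
  ⟨fun k => ((‖b (k - j)‖ : ℝ) : ℂ), memℓp_of_summable_sq (by
    simpa [Function.comp_def] using (summable_norm_sq b).comp_injective (sub_left_injective (b := j)))⟩

lemma absShift_apply (b : Ell) (j k : ℤ) : absShift b j k = ((‖b (k - j)‖ : ℝ) : ℂ) := rfl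

lemma norm_absShift (b : Ell) (j : ℤ) : ‖absShift b j‖ = ‖b‖ := by
  rw [← sq_eq_sq₀ (norm_nonneg _) (norm_nonneg _), norm_sq_eq_tsum, norm_sq_eq_tsum]
  simp_rw [absShift_apply, Complex.norm_real, norm_norm]
  exact (Equiv.subRight j).tsum_eq fun k => ‖b k‖ ^ 2

/-- Young's inequality `ℓ¹ * ℓ² ⊆ ℓ²`. -/
lemma exists_convolution {α : ℤ → ℝ} (hα : ∀ j, 0 ≤ α j) (hs : Summable α) (b : Ell) :
    ∃ A : Ell, ‖A‖ ≤ (∑' j, α j) * ‖b‖ ∧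
      ∀ k, HasSum (fun j => α j * ‖b (k - j)‖) (A k).re := by
  have hn : ∀ j, ‖α j • absShift b j‖ = α j * ‖b‖ := by
    intro j
    rw [norm_smul, norm_absShift, Real.norm_of_nonneg (hα j)]
  have hsum : Summable fun j => α j • absShift b j := by
    refine Summable.of_norm ?_
    simp_rw [hn]
    exact hs.mul_right _
  refine ⟨∑' j, α j • absShift b j, ?_, fun k => ?_⟩
  · refine tsum_of_norm_bounded (hs.hasSum.mul_right _) fun j => (hn j).le
  · have h := (lp.evalCLM ℂ (fun _ : ℤ => ℂ) 2 k).hasSum hsum.hasSum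
    have h' := Complex.reCLM.hasSum h
    convert h' using 1
    swap
    · rfl
    funext j
    symm
    change (α j • (absShift b j k)).re = _
    rw [absShift_apply, Complex.real_smul, ← Complex.ofReal_mul, Complex.ofReal_re]

/-- The Fourier coefficient as a functional on continuous functions. -/
def fourierCoeffL (k : ℤ) : C(Torus, ℂ) →L[ℂ] ℂ :=
  (lp.evalCLM ℂ (fun _ : ℤ => ℂ) 2 k).comp
    (((fourierBasis (T := 2 * Real.pi)).repr.toContinuousLinearEquiv :
      Lp ℂ 2 haar →L[ℂ] Ell).comp (ContinuousMap.toLp 2 haar ℂ))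

lemma fourierCoeffL_apply (k : ℤ) (f : C(Torus, ℂ)) : fourierCoeffL k f = fourierCoeff f k := by
  rw [← fourierCoeff_toLp, ← fourierBasis_repr]
  rfl

lemma hasSum_coeff_mul (u v : H2) (k : ℤ) :
    HasSum (fun j => coeff (toCont u) j * coeff (toCont v) (k - j))
      (coeff (toCont u * toCont v) k) := by
  have h1 := (hasSum_fourier u).mul_right (toComplex (toCont v))
  have h2 := (fourierCoeffL k).hasSum h1
  have h3 : toComplex (toCont u) * toComplex (toCont v) = toComplex (toCont u * toCont v) := by
    ext x
    change ((toCont u x : ℝ) : ℂ) * ((toCont v x : ℝ) : ℂ) = ((toCont u x * toCont v x : ℝ) : ℂ)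
    push_cast
    rfl
  rw [h3, fourierCoeffL_apply, fourierCoeff_toComplex] at h2
  convert h2 using 1
  swap
  · rfl
  funext j
  symm
  rw [smul_mul_assoc, map_smul, smul_eq_mul, fourierCoeffL_apply, ← fourierCoeff_toComplex]
  congr 1
  simp only [fourierCoeff]
  refine integral_congr_ae (Filter.Eventually.of_forall fun x => ?_)
  change fourier (-k) x * (fourier j x * _) = fourier (-(k - j)) x * _
  rw [neg_sub, sub_eq_add_neg, fourier_add, ← mul_assoc, mul_comm (fourier (-k) x)]
  rfl

lemma weight_le (j k : ℤ) :
    1 + (k : ℝ) ^ 2 ≤ 2 * ((1 + (j : ℝ) ^ 2) + (1 + ((k - j : ℤ) : ℝ) ^ 2)) := by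
  push_cast
  nlinarith [sq_nonneg ((k : ℝ) - 2 * j)]

/-- By `weight_le` the weight at `k` splits between the two factors of the convolution, and each
half is controlled by Young's inequality. In every term one factor enters only through its Wiener
norm; this form, finer than the algebra inequality, is what the estimate of `v_x²` needs. -/
lemma exists_weighted_mul_le (u v : H2) :
    ∃ G : Ell, (∀ k, ‖weighted (toCont u * toCont v) k‖ ≤ ‖G k‖) ∧
      ‖G‖ ≤ 2 * (wiener u * ‖v‖ + wiener v * ‖u‖) := by
  obtain ⟨A, hA, hA'⟩ := exists_convolution (fun j => norm_nonneg _) (summable_coeff u)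
    (weightedCoeff v)
  obtain ⟨B, hB, hB'⟩ := exists_convolution (fun j => norm_nonneg _) (summable_coeff v)
    (weightedCoeff u)
  refine ⟨(2 : ℝ) • (A + B), fun k => ?_, ?_⟩
  · have h1 := hA' k
    -- The reflection `j ↦ k - j` puts the second convolution in the order of summation of the
    -- first.
    have h2 := (Equiv.subLeft k).hasSum_iff.mpr (hB' k)
    have h3 := (h1.add h2).mul_left 2
    have h4 := (hasSum_coeff_mul u v k).mul_left ((1 + (k : ℝ) ^ 2 : ℝ) : ℂ)
    have h5 : ‖weighted (toCont u * toCont v) k‖ ≤ 2 * ((A k).re + (B k).re) := by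
      have e : weighted (toCont u * toCont v) k =
          ((1 + (k : ℝ) ^ 2 : ℝ) : ℂ) * coeff (toCont u * toCont v) k := rfl
      rw [e, ← h4.tsum_eq]
      refine tsum_of_norm_bounded h3 fun j => ?_
      simp only [Function.comp, Equiv.subLeft_apply, sub_sub_cancel]
      rw [norm_mul, norm_mul, Complex.norm_real, Real.norm_of_nonneg (weight_pos k).le,
        weightedCoeff_apply, weightedCoeff_apply, norm_mul, norm_mul, Complex.norm_real,
        Complex.norm_real, Real.norm_of_nonneg (weight_pos _).le,
        Real.norm_of_nonneg (weight_pos _).le]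
      have hw := weight_le j k
      have hp : 0 ≤ ‖coeff (toCont u) j‖ * ‖coeff (toCont v) (k - j)‖ := by positivity
      nlinarith [mul_le_mul_of_nonneg_right hw hp]
    refine h5.trans ?_
    have e : ((2 : ℝ) • (A + B) : Ell) k = (2 : ℝ) • (A k + B k) := rfl
    refine le_trans (le_of_eq ?_) (Complex.re_le_norm _)
    rw [e, Complex.smul_re, Complex.add_re, smul_eq_mul]
  · rw [norm_smul, Real.norm_two]
    have h := norm_add_le A B
    rw [norm_weightedCoeff] at hA hB
    have hu : (∑' j, ‖coeff (toCont u) j‖) = wiener u := rfl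
    have hv : (∑' j, ‖coeff (toCont v) j‖) = wiener v := rfl
    rw [hu] at hA
    rw [hv] at hB
    linarith

lemma mul_mem_h2 (u v : H2) : toCont u * toCont v ∈ h2Submodule := by
  obtain ⟨G, hG, -⟩ := exists_weighted_mul_le u v
  exact memℓp_of_norm_le G hG

/-- The pointwise product of elements of `H²`, as a bilinear map. -/
def mulₗ : H2 →ₗ[ℝ] H2 →ₗ[ℝ] H2 :=
  LinearMap.mk₂ ℝ (fun u v => (⟨toCont u * toCont v, mul_mem_h2 u v⟩ : h2Submodule))
    (fun a b c => toCont_injective (by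
      change toCont (a + b) * toCont c = toCont a * toCont c + toCont b * toCont c
      rw [map_add, add_mul]))
    (fun c a b => toCont_injective (by
      change toCont (c • a) * toCont b = c • (toCont a * toCont b)
      rw [map_smul, smul_mul_assoc]))
    (fun a b c => toCont_injective (by
      change toCont a * toCont (b + c) = toCont a * toCont b + toCont a * toCont c
      rw [map_add, mul_add]))
    (fun c a b => toCont_injective (by
      change toCont a * toCont (c • b) = c • (toCont a * toCont b)
      rw [map_smul, mul_smul_comm]))

lemma norm_mulₗ_le (u v : H2) : ‖mulₗ u v‖ ≤ 2 * (wiener u * ‖v‖ + wiener v * ‖u‖) := by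
  obtain ⟨G, hG, hG'⟩ := exists_weighted_mul_le u v
  refine le_trans ?_ hG'
  rw [← norm_weightedCoeff]
  exact Ell.norm_le_of_forall hG

/-- The constant of the Banach algebra inequality. -/
def algConst : ℝ := 4 * embConst

lemma algConst_nonneg : 0 ≤ algConst := mul_nonneg (by norm_num) embConst_nonneg

lemma norm_mulₗ_le_algConst (u v : H2) : ‖mulₗ u v‖ ≤ algConst * ‖u‖ * ‖v‖ := by
  refine (norm_mulₗ_le u v).trans ?_
  have h1 := mul_le_mul_of_nonneg_right (wiener_le u) (norm_nonneg v)
  have h2 := mul_le_mul_of_nonneg_right (wiener_le v) (norm_nonneg u)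
  rw [algConst]
  nlinarith

/-- The pointwise product of elements of `H²`, as a continuous bilinear map. -/
def mul : H2 →L[ℝ] H2 →L[ℝ] H2 := LinearMap.mkContinuous₂ mulₗ algConst norm_mulₗ_le_algConst

lemma toCont_mul (u v : H2) : toCont (mul u v) = toCont u * toCont v := rfl

lemma norm_mul_le' (u v : H2) : ‖mul u v‖ ≤ 2 * (wiener u * ‖v‖ + wiener v * ‖u‖) :=
  norm_mulₗ_le u v

lemma norm_mul_apply_le (u v : H2) : ‖mul u v‖ ≤ algConst * ‖u‖ * ‖v‖ :=
  norm_mulₗ_le_algConst u v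

lemma mul_comm' (u v : H2) : mul u v = mul v u :=
  toCont_injective (mul_comm (toCont u) (toCont v))

/-! ### Fourier multipliers -/

/-- A multiplier: a bounded symbol that preserves real functions. -/
structure IsMultiplier (m : ℤ → ℂ) (M : ℝ) : Prop where
  neg : ∀ k, m (-k) = star (m k)
  bound : ∀ k, ‖m k‖ ≤ M

lemma exists_multiplier {m : ℤ → ℂ} {M : ℝ} (h : IsMultiplier m M) :
    ∃ T : H2 →L[ℝ] H2, (∀ u k, coeff (toCont (T u)) k = m k * coeff (toCont u) k) ∧
      ‖T‖ ≤ M := by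
  have hM : 0 ≤ M := (norm_nonneg _).trans (h.bound 0)
  have h0 : ∀ u : H2, Memℓp (fun k => m k * weightedCoeff u k) 2 := by
    intro u
    refine memℓp_of_norm_le ((M : ℂ) • weightedCoeff u) fun k => ?_
    rw [lp.coeFn_smul, Pi.smul_apply, norm_smul, norm_mul, Complex.norm_real,
      Real.norm_of_nonneg hM]
    exact mul_le_mul_of_nonneg_right (h.bound k) (norm_nonneg _)
  have h1 : ∀ u : H2, ∃ v : H2, ∀ k, weightedCoeff v k = m k * weightedCoeff u k := by
    intro u
    obtain ⟨v, hv⟩ := exists_weightedCoeff_eq (a := ⟨_, h0 u⟩) (fun k => by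
      change m (-k) * weightedCoeff u (-k) = star (m k * weightedCoeff u k)
      rw [h.neg, weightedCoeff_mem_hermitian u k, star_mul'])
    exact ⟨v, fun k => by rw [hv]⟩
  choose f hf using h1
  have hfc : ∀ u k, coeff (toCont (f u)) k = m k * coeff (toCont u) k := by
    intro u k
    rw [coeff_eq_weightedCoeff, hf, coeff_eq_weightedCoeff]
    ring
  have hadd : ∀ u v, f (u + v) = f u + f v := by
    intro u v
    apply weightedCoeff_injective
    ext k
    rw [hf, map_add, map_add, lp.coeFn_add, lp.coeFn_add, Pi.add_apply, Pi.add_apply, hf, hf,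
      mul_add]
  have hsmul : ∀ (c : ℝ) u, f (c • u) = c • f u := by
    intro c u
    apply weightedCoeff_injective
    ext k
    rw [hf, map_smul, map_smul, lp.coeFn_smul, lp.coeFn_smul, Pi.smul_apply, Pi.smul_apply, hf,
      mul_smul_comm]
  have hnorm : ∀ u, ‖f u‖ ≤ M * ‖u‖ := by
    intro u
    have e : ‖(M : ℂ) • weightedCoeff u‖ = M * ‖u‖ := by
      rw [norm_smul, Complex.norm_real, Real.norm_of_nonneg hM, norm_weightedCoeff]
    rw [← e, ← norm_weightedCoeff]
    refine Ell.norm_le_of_forall fun k => ?_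
    rw [hf, lp.coeFn_smul, Pi.smul_apply, norm_smul, norm_mul, Complex.norm_real,
      Real.norm_of_nonneg hM]
    exact mul_le_mul_of_nonneg_right (h.bound k) (norm_nonneg _)
  exact ⟨LinearMap.mkContinuous ⟨⟨f, hadd⟩, hsmul⟩ M hnorm, hfc,
    LinearMap.mkContinuous_norm_le _ hM _⟩

end

end FastReaction

namespace FastReaction

noncomputable section

lemma norm_le_mul_of_coeff_le {u v : H2} {M : ℝ} (hM : 0 ≤ M)
    (h : ∀ k, ‖coeff (toCont u) k‖ ≤ M * ‖coeff (toCont v) k‖) : ‖u‖ ≤ M * ‖v‖ := by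
  have e : ‖(M : ℂ) • weightedCoeff v‖ = M * ‖v‖ := by
    rw [norm_smul, Complex.norm_real, Real.norm_of_nonneg hM, norm_weightedCoeff]
  rw [← e, ← norm_weightedCoeff]
  refine Ell.norm_le_of_forall fun k => ?_
  rw [lp.coeFn_smul, Pi.smul_apply, norm_smul, weightedCoeff_apply, weightedCoeff_apply, norm_mul,
    norm_mul, Complex.norm_real, Complex.norm_real, Real.norm_of_nonneg hM]
  have := mul_le_mul_of_nonneg_left (h k) (norm_nonneg (1 + (k : ℝ) ^ 2))
  linarith

/-! ### Differentiability and continuity mode by mode -/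

/-- Dominated convergence for the series of `‖a t k - a t₀ k‖²`, with dominating series `4 ‖b k‖²`.
-/
lemma continuousAt_ell {a : ℝ → Ell} {b : Ell} {t₀ : ℝ}
    (hb : ∀ᶠ t in nhds t₀, ∀ k, ‖a t k‖ ≤ ‖b k‖)
    (hc : ∀ k, ContinuousAt (fun t => a t k) t₀) : ContinuousAt a t₀ := by
  have h0 : ∀ k, ‖a t₀ k‖ ≤ ‖b k‖ := hb.self_of_nhds
  have h1 : Filter.Tendsto (fun t => ∑' k, ‖(a t - a t₀) k‖ ^ 2) (nhds t₀)
      (nhds (∑' _ : ℤ, (0 : ℝ))) := by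
    refine tendsto_tsum_of_dominated_convergence (bound := fun k => 4 * ‖b k‖ ^ 2)
      ((summable_norm_sq b).mul_left 4) (fun k => ?_) ?_
    · have h2 : Filter.Tendsto (fun t => a t k - a t₀ k) (nhds t₀) (nhds 0) := by
        have := (hc k).tendsto.sub_const (a t₀ k)
        rwa [sub_self] at this
      have := (h2.norm).pow 2
      simpa using this
    · filter_upwards [hb] with t ht k
      rw [Real.norm_of_nonneg (by positivity), lp.coeFn_sub, Pi.sub_apply]
      have h3 : ‖a t k - a t₀ k‖ ≤ 2 * ‖b k‖ := by
        have := norm_sub_le (a t k) (a t₀ k)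
        linarith [ht k, h0 k]
      calc ‖a t k - a t₀ k‖ ^ 2 ≤ (2 * ‖b k‖) ^ 2 := pow_le_pow_left₀ (norm_nonneg _) h3 2
        _ = 4 * ‖b k‖ ^ 2 := by ring
  rw [tsum_zero] at h1
  rw [ContinuousAt, tendsto_iff_norm_sub_tendsto_zero]
  have h2 := (Real.continuous_sqrt.tendsto 0).comp h1
  rw [Real.sqrt_zero] at h2
  refine h2.congr fun t => ?_
  rw [Function.comp, ← norm_sq_eq_tsum, Real.sqrt_sq (norm_nonneg _)]

/-- Continuity of `g` in `ℓ²` replaces any uniformity in `k`: mode by mode, `z` equals `z 0` plus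
the integral of `g`, so the fundamental theorem of calculus in `ℓ²` applies. -/
lemma hasDerivAt_ell {z g : ℝ → Ell} (hg : Continuous g)
    (h : ∀ k t, HasDerivAt (fun s => z s k) (g t k) t) (t : ℝ) : HasDerivAt z (g t) t := by
  have h1 : z = fun t => z 0 + ∫ s in (0 : ℝ)..t, g s := by
    funext t
    ext k
    have e : (∫ s in (0 : ℝ)..t, g s : Ell) k = ∫ s in (0 : ℝ)..t, g s k := by
      have := (lp.evalCLM ℝ (fun _ : ℤ => ℂ) 2 k).intervalIntegral_comp_comm
        (hg.intervalIntegrable (μ := volume) 0 t)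
      exact this.symm
    rw [lp.coeFn_add, Pi.add_apply, e, intervalIntegral.integral_eq_sub_of_hasDerivAt
      (fun s _ => h k s) (((continuous_evalEll k).comp hg).intervalIntegrable _ _)]
    ring
  rw [h1]
  exact (intervalIntegral.integral_hasDerivAt_right (hg.intervalIntegrable _ _)
    hg.stronglyMeasurable.stronglyMeasurableAtFilter hg.continuousAt).const_add _

lemma hasDerivAt_of_isometry {E F : Type*} [NormedAddCommGroup E] [NormedSpace ℝ E]
    [NormedAddCommGroup F] [NormedSpace ℝ F] (J : E →ₗᵢ[ℝ] F) {f : ℝ → E} {f' : E} {t : ℝ}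
    (h : HasDerivAt (fun s => J (f s)) (J f') t) : HasDerivAt f f' t := by
  rw [hasDerivAt_iff_isLittleO] at h ⊢
  refine (Asymptotics.isLittleO_norm_left.mp ?_)
  refine (Asymptotics.isLittleO_norm_left.mpr h).congr_left fun s => ?_
  rw [← map_sub, ← map_smul, ← map_sub, J.norm_map]

/-! ### The Laplacian -/

/-- The function `u - Δu`. -/
def oneSubLapFun (u : H2) : L2 := (exists_coeffL2_eq (weightedCoeff_mem_hermitian u)).choose

lemma coeffL2_oneSubLapFun (u : H2) : coeffL2 (oneSubLapFun u) = weightedCoeff u :=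
  (exists_coeffL2_eq (weightedCoeff_mem_hermitian u)).choose_spec

/-- The isometry `1 - Δ` from `H²` to `L²`. -/
def oneSubLap : H2 →ₗᵢ[ℝ] L2 where
  toFun := oneSubLapFun
  map_add' u v := coeffL2.injective (by
    rw [map_add, coeffL2_oneSubLapFun, coeffL2_oneSubLapFun, coeffL2_oneSubLapFun, map_add])
  map_smul' c u := coeffL2.injective (by
    rw [RingHom.id_apply, map_smul, coeffL2_oneSubLapFun, coeffL2_oneSubLapFun, map_smul])
  norm_map' u := by
    change ‖oneSubLapFun u‖ = ‖u‖
    rw [← coeffL2.norm_map, coeffL2_oneSubLapFun, norm_weightedCoeff]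

lemma coeffL2_oneSubLap (u : H2) : coeffL2 (oneSubLap u) = weightedCoeff u :=
  coeffL2_oneSubLapFun u

/-- The Laplacian from `H²` to `L²`. -/
def lap : H2 →L[ℝ] L2 := embL2 - oneSubLap.toContinuousLinearMap

lemma coeffL2_lap (u : H2) (k : ℤ) :
    coeffL2 (lap u) k = -(k : ℂ) ^ 2 * coeff (toCont u) k := by
  have e : lap u = embL2 u - oneSubLap u := rfl
  rw [e, map_sub, lp.coeFn_sub, Pi.sub_apply, coeffL2_embL2, coeffL2_oneSubLap,
    weightedCoeff_apply]
  push_cast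
  ring

lemma isLaplacian_iff {u : H2} {w : L2} : IsLaplacian u w ↔ w = lap u := by
  constructor
  · intro h
    apply coeffL2.injective
    ext k
    rw [coeffL2_lap, coeffL2_apply, h k]
  · rintro rfl k
    rw [← coeffL2_apply, coeffL2_lap]

/-! ### The heat semigroup -/

lemma isMultiplier_heat (s : ℝ) :
    IsMultiplier (fun k => ((Real.exp (-(k : ℝ) ^ 2 * max s 0) : ℝ) : ℂ)) 1 where
  neg k := by
    rw [RCLike.star_def, Complex.conj_ofReal]
    push_cast
    rw [neg_sq]
  bound k := by
    rw [Complex.norm_real, Real.norm_of_nonneg (Real.exp_pos _).le]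
    exact Real.exp_le_one_iff.mpr (by nlinarith [sq_nonneg (k : ℝ), le_max_right s 0])

/-- The heat semigroup on `H²` at time `max s 0`. -/
def heat (s : ℝ) : H2 →L[ℝ] H2 := (exists_multiplier (isMultiplier_heat s)).choose

lemma coeff_heat (s : ℝ) (u : H2) (k : ℤ) : coeff (toCont (heat s u)) k =
    ((Real.exp (-(k : ℝ) ^ 2 * max s 0) : ℝ) : ℂ) * coeff (toCont u) k :=
  (exists_multiplier (isMultiplier_heat s)).choose_spec.1 u k

lemma norm_heat_le (s : ℝ) : ‖heat s‖ ≤ 1 :=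
  (exists_multiplier (isMultiplier_heat s)).choose_spec.2

lemma continuous_of_weightedCoeff {X : Type*} [TopologicalSpace X] {f : X → H2}
    (h : Continuous fun t => weightedIso (f t)) : Continuous f :=
  weightedIso.isometry.isUniformInducing.isInducing.continuous_iff.mpr h

lemma continuous_heat_apply (u : H2) : Continuous fun s => heat s u := by
  refine continuous_of_weightedCoeff (continuous_iff_continuousAt.mpr fun t₀ => ?_)
  have e : ∀ s k, weightedIso (heat s u) k =
      ((Real.exp (-(k : ℝ) ^ 2 * max s 0) : ℝ) : ℂ) * weightedCoeff u k := by
    intro s k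
    rw [weightedIso_apply, weightedCoeff_apply, coeff_heat, weightedCoeff_apply]
    ring
  refine continuousAt_ell (b := weightedCoeff u) (Filter.Eventually.of_forall fun s k => ?_)
    fun k => ?_
  · rw [e, norm_mul]
    exact mul_le_of_le_one_left (norm_nonneg _) ((isMultiplier_heat s).bound k)
  · simp_rw [e]
    fun_prop

lemma continuous_heat : Continuous fun p : ℝ × H2 => heat p.1 p.2 := by
  refine continuous_iff_continuousAt.mpr fun ⟨s₀, u₀⟩ => ?_
  rw [ContinuousAt, tendsto_iff_norm_sub_tendsto_zero]
  have h1 : Filter.Tendsto (fun p : ℝ × H2 => ‖p.2 - u₀‖ + ‖heat p.1 u₀ - heat s₀ u₀‖)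
      (nhds (s₀, u₀)) (nhds 0) := by
    have c : Continuous fun p : ℝ × H2 => ‖p.2 - u₀‖ + ‖heat p.1 u₀ - heat s₀ u₀‖ :=
      (continuous_snd.sub continuous_const).norm.add
        (((continuous_heat_apply u₀).comp continuous_fst).sub continuous_const).norm
    simpa using c.tendsto (s₀, u₀)
  refine squeeze_zero (fun _ => norm_nonneg _) (fun p => ?_) h1
  have e : heat p.1 p.2 - heat s₀ u₀ = heat p.1 (p.2 - u₀) + (heat p.1 u₀ - heat s₀ u₀) := by
    rw [map_sub]
    abel
  change ‖heat p.1 p.2 - heat s₀ u₀‖ ≤ _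
  rw [e]
  refine (norm_add_le _ _).trans (add_le_add ?_ le_rfl)
  exact ((heat p.1).le_opNorm _).trans (mul_le_of_le_one_left (norm_nonneg _) (norm_heat_le _))

/-! ### The slow modes -/

variable {k₀ : ℕ}

lemma coeff_eq_zero_of_slow (v : slowSpace k₀) {k : ℤ} (hk : (k₀ : ℤ) < |k|) :
    coeff (toCont (v : H2)) k = 0 :=
  (weightedCoeff_eq_zero_iff _ _).mp (v.2 k hk)

lemma mem_slowSpace_of_coeff {v : H2} (h : ∀ k : ℤ, (k₀ : ℤ) < |k| → coeff (toCont v) k = 0) :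
    v ∈ slowSpace k₀ := fun k hk => (weightedCoeff_eq_zero_iff _ _).mpr (h k hk)

instance : FiniteDimensional ℝ (slowSpace k₀) := by
  let f : slowSpace k₀ →ₗ[ℝ] (Finset.Icc (-(k₀ : ℤ)) k₀ → ℂ) :=
    { toFun := fun v k => weightedCoeff (v : H2) k
      map_add' := fun u v => by
        funext k
        simp
      map_smul' := fun c v => by
        funext k
        simp }
  refine Module.Finite.of_injective f fun u v h => ?_
  apply Subtype.ext
  apply weightedCoeff_injective
  ext k
  by_cases hk : (k₀ : ℤ) < |k|
  · rw [u.2 k hk, v.2 k hk]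
  · exact congrFun h ⟨k, Finset.mem_Icc.mpr (abs_le.mp (not_lt.mp hk))⟩

/-- Truncating the symbol to `|k| ≤ k₀` changes nothing on slow functions. This admits symbols
unbounded on `ℤ`, such as those of the backward heat flow and of derivatives. -/
lemma exists_slow_multiplier {m : ℤ → ℂ} {M : ℝ} (hneg : ∀ k, m (-k) = star (m k))
    (hM : 0 ≤ M) (hb : ∀ k : ℤ, |k| ≤ (k₀ : ℤ) → ‖m k‖ ≤ M) :
    ∃ T : slowSpace k₀ →L[ℝ] slowSpace k₀,
      (∀ v k, coeff (toCont (T v : H2)) k = m k * coeff (toCont (v : H2)) k) ∧ ‖T‖ ≤ M := by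
  have hm : IsMultiplier (fun k : ℤ => if |k| ≤ (k₀ : ℤ) then m k else 0) M :=
    { neg := fun k => by
        rw [abs_neg]
        split_ifs
        · exact hneg k
        · simp
      bound := fun k => by
        split_ifs with h
        · exact hb k h
        · simpa using hM }
  obtain ⟨T, hT, hT'⟩ := exists_multiplier hm
  have hc : ∀ (v : slowSpace k₀) k,
      coeff (toCont (T (v : H2))) k = m k * coeff (toCont (v : H2)) k := by
    intro v k
    rw [hT]
    split_ifs with h
    · rfl
    · rw [coeff_eq_zero_of_slow v (not_le.mp h), mul_zero, mul_zero]
  have hmem : ∀ v : slowSpace k₀, (T.comp (slowSpace k₀).subtypeL) v ∈ slowSpace k₀ := by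
    intro v
    refine mem_slowSpace_of_coeff fun k hk => ?_
    change coeff (toCont (T (v : H2))) k = 0
    rw [hc, coeff_eq_zero_of_slow v hk, mul_zero]
  refine ⟨(T.comp (slowSpace k₀).subtypeL).codRestrict _ hmem, hc, ?_⟩
  refine ContinuousLinearMap.opNorm_le_bound _ hM fun v => ?_
  exact (T.le_opNorm (v : H2)).trans (mul_le_mul_of_nonneg_right hT' (norm_nonneg _))

lemma slow_ext {u v : slowSpace k₀}
    (h : ∀ k, coeff (toCont (u : H2)) k = coeff (toCont (v : H2)) k) : u = v :=
  Subtype.ext (coeff_injective h)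

lemma sq_le_sq_of_abs_le {k : ℤ} (hk : |k| ≤ (k₀ : ℤ)) : (k : ℝ) ^ 2 ≤ (k₀ : ℝ) ^ 2 := by
  have h1 : |(k : ℝ)| ≤ k₀ := by exact_mod_cast hk
  rw [← sq_abs (k : ℝ)]
  exact pow_le_pow_left₀ (abs_nonneg _) h1 2

variable (k₀) in
lemma exists_flow (t : ℝ) : ∃ T : slowSpace k₀ →L[ℝ] slowSpace k₀,
    (∀ v k, coeff (toCont (T v : H2)) k =
      ((Real.exp (-(k : ℝ) ^ 2 * t) : ℝ) : ℂ) * coeff (toCont (v : H2)) k) ∧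
    ‖T‖ ≤ Real.exp ((k₀ : ℝ) ^ 2 * |t|) := by
  refine exists_slow_multiplier (fun k => ?_) (Real.exp_pos _).le fun k hk => ?_
  · rw [RCLike.star_def, Complex.conj_ofReal]
    push_cast
    rw [neg_sq]
  · rw [Complex.norm_real, Real.norm_of_nonneg (Real.exp_pos _).le]
    refine Real.exp_le_exp.mpr ?_
    have h1 := mul_le_mul_of_nonneg_right (sq_le_sq_of_abs_le hk) (abs_nonneg t)
    have h2 := mul_le_mul_of_nonneg_left (neg_le_abs t) (sq_nonneg (k : ℝ))
    linarith

variable (k₀) in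
/-- The heat flow on the slow modes, at positive and negative times. -/
def flow (t : ℝ) : slowSpace k₀ →L[ℝ] slowSpace k₀ := (exists_flow k₀ t).choose

lemma coeff_flow (t : ℝ) (v : slowSpace k₀) (k : ℤ) : coeff (toCont (flow k₀ t v : H2)) k =
    ((Real.exp (-(k : ℝ) ^ 2 * t) : ℝ) : ℂ) * coeff (toCont (v : H2)) k :=
  (exists_flow k₀ t).choose_spec.1 v k

lemma norm_flow_le (t : ℝ) : ‖flow k₀ t‖ ≤ Real.exp ((k₀ : ℝ) ^ 2 * |t|) :=
  (exists_flow k₀ t).choose_spec.2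

lemma norm_flow_apply_le {t : ℝ} (ht : 0 ≤ t) (v : slowSpace k₀) : ‖flow k₀ t v‖ ≤ ‖v‖ := by
  have h : ‖(flow k₀ t v : H2)‖ ≤ 1 * ‖(v : H2)‖ := by
    refine norm_le_mul_of_coeff_le zero_le_one fun k => ?_
    rw [coeff_flow, norm_mul, Complex.norm_real, Real.norm_of_nonneg (Real.exp_pos _).le]
    refine mul_le_mul_of_nonneg_right (Real.exp_le_one_iff.mpr ?_) (norm_nonneg _)
    nlinarith [sq_nonneg (k : ℝ)]
  rwa [one_mul] at h

lemma flow_zero (v : slowSpace k₀) : flow k₀ 0 v = v :=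
  slow_ext fun k => by rw [coeff_flow]; simp

lemma flow_add (s t : ℝ) (v : slowSpace k₀) : flow k₀ (s + t) v = flow k₀ s (flow k₀ t v) :=
  slow_ext fun k => by
    rw [coeff_flow, coeff_flow, coeff_flow, mul_add, Real.exp_add]
    push_cast
    ring

variable (k₀) in
lemma exists_slowLap : ∃ T : slowSpace k₀ →L[ℝ] slowSpace k₀,
    (∀ v k, coeff (toCont (T v : H2)) k = (-(k : ℂ) ^ 2) * coeff (toCont (v : H2)) k) ∧
    ‖T‖ ≤ (k₀ : ℝ) ^ 2 := by
  refine exists_slow_multiplier (fun k => ?_) (by positivity) fun k hk => ?_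
  · simp
  · rw [norm_neg, norm_pow, Complex.norm_intCast, sq_abs]
    exact sq_le_sq_of_abs_le hk

variable (k₀) in
/-- The Laplacian on the slow modes. -/
def slowLap : slowSpace k₀ →L[ℝ] slowSpace k₀ := (exists_slowLap k₀).choose

lemma coeff_slowLap (v : slowSpace k₀) (k : ℤ) :
    coeff (toCont (slowLap k₀ v : H2)) k = (-(k : ℂ) ^ 2) * coeff (toCont (v : H2)) k :=
  (exists_slowLap k₀).choose_spec.1 v k

lemma embL2_slowLap (v : slowSpace k₀) : embL2 (slowLap k₀ v : H2) = lap (v : H2) := by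
  apply coeffL2.injective
  ext k
  rw [coeffL2_embL2, coeffL2_lap, coeff_slowLap]

variable (k₀) in
lemma exists_slowDeriv : ∃ T : slowSpace k₀ →L[ℝ] slowSpace k₀,
    (∀ v k, coeff (toCont (T v : H2)) k = (Complex.I * k) * coeff (toCont (v : H2)) k) ∧
    ‖T‖ ≤ (k₀ : ℝ) := by
  refine exists_slow_multiplier (fun k => ?_) (by positivity) fun k hk => ?_
  · simp
  · rw [norm_mul, Complex.norm_I, one_mul, Complex.norm_intCast]
    exact_mod_cast hk

variable (k₀) in
/-- The derivative `∂ₓ` on the slow modes. -/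
def slowDeriv : slowSpace k₀ →L[ℝ] slowSpace k₀ := (exists_slowDeriv k₀).choose

lemma coeff_slowDeriv (v : slowSpace k₀) (k : ℤ) :
    coeff (toCont (slowDeriv k₀ v : H2)) k = (Complex.I * k) * coeff (toCont (v : H2)) k :=
  (exists_slowDeriv k₀).choose_spec.1 v k

lemma norm_slowDeriv_le : ‖slowDeriv k₀‖ ≤ (k₀ : ℝ) := (exists_slowDeriv k₀).choose_spec.2

/-- The constant in the bound of `v_x` in the Wiener norm by `v` in `H²`. -/
def derivConst : ℝ := (∑' k : ℤ, (|(k : ℝ)| * (1 + (k : ℝ) ^ 2)⁻¹) ^ 2) ^ (1 / (2 : ℝ))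

lemma derivConst_nonneg : 0 ≤ derivConst :=
  Real.rpow_nonneg (tsum_nonneg fun _ => by positivity) _

lemma summable_abs_mul_inv_weight_sq :
    Summable fun k : ℤ => (|(k : ℝ)| * (1 + (k : ℝ) ^ 2)⁻¹) ^ 2 := by
  have h : Summable fun k : ℤ => 1 / (k : ℝ) ^ 2 :=
    Real.summable_one_div_int_pow.mpr (by norm_num)
  refine Summable.of_nonneg_of_le (fun _ => by positivity) (fun k => ?_) h
  rw [mul_pow, sq_abs, inv_pow]
  by_cases hk : k = 0
  · simp [hk]
  have hk' : (k : ℝ) ≠ 0 := by exact_mod_cast hk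
  have hk2 : 0 < (k : ℝ) ^ 2 := by positivity
  rw [← div_eq_mul_inv, div_le_div_iff₀ (by positivity) hk2]
  nlinarith

lemma wiener_slowDeriv_le (v : slowSpace k₀) :
    wiener (slowDeriv k₀ v : H2) ≤ derivConst * ‖v‖ := by
  have h := Real.inner_le_Lp_mul_Lq_tsum_of_nonneg (p := 2) (q := 2)
    Real.HolderConjugate.two_two
    (f := fun k : ℤ => |(k : ℝ)| * (1 + (k : ℝ) ^ 2)⁻¹)
    (g := fun k => ‖weightedCoeff (v : H2) k‖)
    (fun k => by positivity) (fun k => norm_nonneg _)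
    (by simpa using summable_abs_mul_inv_weight_sq)
    (by simpa using summable_norm_sq (weightedCoeff (v : H2)))
  have e : (∑' k : ℤ, ‖weightedCoeff (v : H2) k‖ ^ (2 : ℝ)) ^ (1 / (2 : ℝ)) = ‖v‖ := by
    simp_rw [Real.rpow_two]
    rw [← norm_sq_eq_tsum, ← Real.sqrt_eq_rpow, Real.sqrt_sq (norm_nonneg _), norm_weightedCoeff]
    rfl
  rw [e] at h
  simp_rw [Real.rpow_two] at h
  refine le_trans (le_of_eq ?_) h
  refine tsum_congr fun k => ?_
  rw [coeff_slowDeriv, norm_mul, norm_mul, Complex.norm_I, one_mul, Complex.norm_intCast,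
    norm_coeff_eq]
  ring

/-- In each term of the product estimate one factor `v_x` is measured in the Wiener norm, which
`‖v‖` bounds uniformly in `k₀`, and the other in `H²`, which costs one `k₀`. A bound with `k₀²`
would only give a distance of order `εk₀²`, which need not tend to zero with `ζ`. -/
lemma norm_mul_slowDeriv_le (v : slowSpace k₀) :
    ‖mul (slowDeriv k₀ v : H2) (slowDeriv k₀ v : H2)‖ ≤ 4 * derivConst * k₀ * ‖v‖ ^ 2 := by
  refine (norm_mul_le' _ _).trans ?_
  have h1 : ‖(slowDeriv k₀ v : H2)‖ ≤ k₀ * ‖v‖ :=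
    ((slowDeriv k₀).le_opNorm v).trans (mul_le_mul_of_nonneg_right norm_slowDeriv_le (norm_nonneg _))
  have h2 := wiener_slowDeriv_le v
  have h3 := mul_le_mul h2 h1 (norm_nonneg _) (mul_nonneg derivConst_nonneg (norm_nonneg _))
  nlinarith

/-! ### Differentiability of the slow flow -/

lemma continuous_flow_apply (v : slowSpace k₀) : Continuous fun t => flow k₀ t v := by
  refine Continuous.subtype_mk (f := fun t => ((flow k₀ t v : slowSpace k₀) : H2))
    (continuous_of_weightedCoeff (continuous_iff_continuousAt.mpr fun t₀ => ?_)) _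
  have e : ∀ t k, weightedIso (flow k₀ t v : H2) k =
      ((Real.exp (-(k : ℝ) ^ 2 * t) : ℝ) : ℂ) * weightedCoeff (v : H2) k := by
    intro s k
    rw [weightedIso_apply, weightedCoeff_apply, coeff_flow, weightedCoeff_apply]
    ring
  refine continuousAt_ell
    (b := (Real.exp ((k₀ : ℝ) ^ 2 * (|t₀| + 1)) : ℂ) • weightedCoeff (v : H2)) ?_ fun k => ?_
  · filter_upwards [Metric.ball_mem_nhds t₀ one_pos] with t ht k
    rw [e, norm_mul, lp.coeFn_smul, Pi.smul_apply, norm_smul]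
    by_cases hk : (k₀ : ℤ) < |k|
    · rw [v.2 k hk]
      simp
    refine mul_le_mul_of_nonneg_right ?_ (norm_nonneg _)
    rw [Complex.norm_real, Complex.norm_real,
      Real.norm_of_nonneg (Real.exp_pos _).le, Real.norm_of_nonneg (Real.exp_pos _).le]
    refine Real.exp_le_exp.mpr ?_
    have ht' : |t| ≤ |t₀| + 1 := by
      have h1 : |t - t₀| < 1 := by simpa [Real.dist_eq] using ht
      have h2 := abs_sub_abs_le_abs_sub t t₀
      linarith
    have h1 := mul_le_mul (sq_le_sq_of_abs_le (not_lt.mp hk)) ht' (abs_nonneg t) (sq_nonneg _)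
    have h2 := mul_le_mul_of_nonneg_left (neg_le_abs t) (sq_nonneg (k : ℝ))
    linarith
  · simp_rw [e]
    fun_prop

lemma hasDerivAt_exp_mode (c : ℝ) (t : ℝ) :
    HasDerivAt (fun s : ℝ => ((Real.exp (c * s) : ℝ) : ℂ)) (c * ((Real.exp (c * t) : ℝ) : ℂ)) t := by
  have h1 : HasDerivAt (fun s : ℝ => Real.exp (c * s)) (Real.exp (c * t) * c) t := by
    have := ((hasDerivAt_id t).const_mul c).exp
    simpa using this
  have h2 := h1.ofReal_comp
  convert h2 using 1
  push_cast
  ring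

lemma hasDerivAt_flow_coe (v : slowSpace k₀) (t : ℝ) :
    HasDerivAt (fun s => (flow k₀ s v : H2)) (slowLap k₀ (flow k₀ t v) : H2) t := by
  refine hasDerivAt_of_isometry weightedIso (hasDerivAt_ell (g := fun t =>
    weightedIso (slowLap k₀ (flow k₀ t v) : H2)) ?_ (fun k t => ?_) t)
  · exact weightedIso.continuous.comp
      (continuous_subtype_val.comp ((slowLap k₀).continuous.comp (continuous_flow_apply v)))
  · have h1 := (hasDerivAt_exp_mode (-(k : ℝ) ^ 2) t).mul_const (weightedCoeff (v : H2) k)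
    have e : (fun s => (weightedIso (flow k₀ s v : H2) : ℤ → ℂ) k) =
        fun s : ℝ => ((Real.exp (-(k : ℝ) ^ 2 * s) : ℝ) : ℂ) * weightedCoeff (v : H2) k := by
      funext s
      rw [weightedIso_apply, weightedCoeff_apply, coeff_flow, weightedCoeff_apply]
      ring
    rw [e]
    have e' : (weightedIso (slowLap k₀ (flow k₀ t v) : H2) : ℤ → ℂ) k =
        ((-(k : ℝ) ^ 2 : ℝ) : ℂ) * ((Real.exp (-(k : ℝ) ^ 2 * t) : ℝ) : ℂ) *
          weightedCoeff (v : H2) k := by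
      rw [weightedIso_apply, weightedCoeff_apply, weightedCoeff_apply, coeff_slowLap, coeff_flow]
      push_cast
      ring
    rw [e']
    exact h1

end

end FastReaction

namespace FastReaction

noncomputable section

/-! ### The critical manifold as a graph near zero -/

/-- `φ` solves `φ(v)² + φ(v) = v²` near zero, and `T(v)` is the inverse of multiplication by
`1 + 2 φ(v)`. -/
structure IsCriticalMap (φ : H2 → H2) (T : H2 → H2 →L[ℝ] H2) (ρ δ : ℝ) : Prop where
  contDiffAt : ∀ v, ‖v‖ < ρ → ContDiffAt ℝ 1 φ v
  contDiffAt_inv : ∀ v, ‖v‖ < ρ → ContDiffAt ℝ 1 T v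
  eq : ∀ v, ‖v‖ < ρ → mul (φ v) (φ v) + φ v = mul v v
  norm_le : ∀ v, ‖v‖ < ρ → ‖φ v‖ ≤ δ
  norm_inv_le : ∀ v, ‖v‖ < ρ → ‖T v‖ ≤ 2
  right_inv : ∀ v, ‖v‖ < ρ → ∀ w, T v w + (2 : ℝ) • mul (φ v) (T v w) = w
  left_inv : ∀ v, ‖v‖ < ρ → ∀ w, T v (w + (2 : ℝ) • mul (φ v) w) = w
  abs_toCont_lt : ∀ v, ‖v‖ < ρ → ∀ x, |toCont (φ v) x| < 1 / 2

/-- The map `u ↦ u² + u` has derivative the identity at zero, so it has a `C¹` local inverse `ψ`;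
then `φ(v) = ψ(v²)`. The operator `1 + 2φ(v)` is close to the identity, and inversion is smooth on
units of the Banach algebra of operators. All required properties hold near zero, hence on a common
ball. -/
lemma exists_criticalMap {δ : ℝ} (hδ : 0 < δ) :
    ∃ φ T ρ, 0 < ρ ∧ IsCriticalMap φ T ρ δ := by
  set g : H2 → H2 := fun u => mul u u + u with hg
  have hgc : ContDiff ℝ 1 g := by
    rw [hg]
    exact (mul.contDiff.clm_apply contDiff_id).add contDiff_id
  have hg' : HasFDerivAt g ((ContinuousLinearEquiv.refl ℝ H2 : H2 ≃L[ℝ] H2) : H2 →L[ℝ] H2) 0 := by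
    have h1 : HasFDerivAt (fun u : H2 => mul u u) (0 : H2 →L[ℝ] H2) 0 := by
      have := (mul.hasFDerivAt (x := (0 : H2))).clm_apply (hasFDerivAt_id (0 : H2))
      refine this.congr_fderiv ?_
      ext w
      simp
    have h2 := h1.add (hasFDerivAt_id (0 : H2))
    refine h2.congr_fderiv ?_
    ext w
    simp
  have hg0 : g 0 = 0 := by simp [hg]
  set ψ : H2 → H2 := hgc.contDiffAt.localInverse hg' one_ne_zero with hψ
  have hψc : ContDiffAt ℝ 1 ψ 0 := by
    have := hgc.contDiffAt.to_localInverse hg' one_ne_zero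
    rwa [hg0] at this
  have hψ0 : ψ 0 = 0 := by
    have := hgc.contDiffAt.localInverse_apply_image hg' one_ne_zero
    rwa [hg0] at this
  have hψr : ∀ᶠ p in nhds (0 : H2), g (ψ p) = p := by
    have := (hgc.contDiffAt.hasStrictFDerivAt' hg' one_ne_zero).eventually_right_inverse
    rwa [hg0] at this
  have hsq : ContDiff ℝ 1 (fun v : H2 => mul v v) := mul.contDiff.clm_apply contDiff_id
  have hsq0 : mul (0 : H2) 0 = 0 := by simp
  set φ : H2 → H2 := fun v => ψ (mul v v) with hφ
  have hφc : ContDiffAt ℝ 1 φ 0 := by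
    refine ContDiffAt.comp (0 : H2) (g := ψ) ?_ hsq.contDiffAt
    rwa [hsq0]
  have hφ0 : φ 0 = 0 := by
    have : φ 0 = ψ (mul 0 0) := rfl
    rw [this, hsq0, hψ0]
  set S : H2 → H2 →L[ℝ] H2 := fun v => 1 + (2 : ℝ) • mul (φ v) with hS
  have hSc : ContDiffAt ℝ 1 S 0 :=
    contDiffAt_const.add ((mul.contDiff.contDiffAt.comp (0 : H2) hφc).const_smul (2 : ℝ))
  have hS0 : S 0 = 1 := by simp [hS, hφ0]
  set T : H2 → H2 →L[ℝ] H2 := fun v => Ring.inverse (S v) with hT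
  have hTc : ContDiffAt ℝ 1 T 0 := by
    refine ContDiffAt.comp (0 : H2) (g := Ring.inverse) ?_ hSc
    rw [hS0]
    exact contDiffAt_ringInverse ℝ (1 : (H2 →L[ℝ] H2)ˣ)
  have hT0 : T 0 = 1 := by
    rw [hT]
    simp only [hS0, Ring.inverse_one]
  have e1 := hφc.eventually (by simp)
  have e2 := hTc.eventually (by simp)
  have e3 : ∀ᶠ v in nhds (0 : H2), g (φ v) = mul v v := by
    have := hsq.continuous.tendsto 0
    rw [hsq0] at this
    exact this.eventually hψr
  have e4 : ∀ᶠ v in nhds (0 : H2), ‖φ v‖ < δ := by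
    have := hφc.continuousAt.norm.tendsto
    rw [hφ0, norm_zero] at this
    exact this.eventually_lt_const hδ
  have e5 : ∀ᶠ v in nhds (0 : H2), ‖T v‖ < 2 := by
    have := hTc.continuousAt.norm.tendsto
    rw [hT0] at this
    refine this.eventually_lt_const (lt_of_le_of_lt ContinuousLinearMap.norm_id_le one_lt_two)
  have e6 : ∀ᶠ v in nhds (0 : H2), IsUnit (S v) := by
    refine hSc.continuousAt.eventually ?_
    rw [hS0]
    exact Units.nhds (1 : (H2 →L[ℝ] H2)ˣ)
  -- The bound `|φ| < 1/2` gives `1 + 2φ > 0`, which selects the attracting root of the quadratic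
  -- equation.
  have e7 : ∀ᶠ v in nhds (0 : H2), ‖toContL (φ v)‖ < 1 / 2 := by
    have := (toContL.continuous.continuousAt.comp hφc.continuousAt).norm.tendsto
    rw [Function.comp, hφ0, map_zero, norm_zero] at this
    exact this.eventually_lt_const (by norm_num)
  obtain ⟨ρ, hρ, hball⟩ := Metric.eventually_nhds_iff_ball.mp
    (e1.and (e2.and (e3.and (e4.and (e5.and (e6.and e7))))))
  have hb : ∀ v : H2, ‖v‖ < ρ → v ∈ Metric.ball (0 : H2) ρ := fun v hv => by simpa using hv
  exact ⟨φ, T, ρ, hρ,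
    { contDiffAt := fun v hv => (hball v (hb v hv)).1
      contDiffAt_inv := fun v hv => (hball v (hb v hv)).2.1
      eq := fun v hv => (hball v (hb v hv)).2.2.1
      norm_le := fun v hv => (hball v (hb v hv)).2.2.2.1.le
      norm_inv_le := fun v hv => (hball v (hb v hv)).2.2.2.2.1.le
      right_inv := fun v hv w => by
        have h := Ring.mul_inverse_cancel _ (hball v (hb v hv)).2.2.2.2.2.1
        exact congrArg (fun L : H2 →L[ℝ] H2 => L w) h
      left_inv := fun v hv w => by
        have h := Ring.inverse_mul_cancel _ (hball v (hb v hv)).2.2.2.2.2.1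
        exact congrArg (fun L : H2 →L[ℝ] H2 => L w) h
      abs_toCont_lt := fun v hv x =>
        lt_of_le_of_lt ((toCont (φ v)).norm_coe_le_norm x) (hball v (hb v hv)).2.2.2.2.2.2 }⟩

namespace IsCriticalMap

variable {φ : H2 → H2} {T : H2 → H2 →L[ℝ] H2} {ρ δ : ℝ}

lemma one_add_two_mul_eq (h : IsCriticalMap φ T ρ δ) {v : H2} (hv : ‖v‖ < ρ) (x : Torus) :
    1 + 2 * toCont (φ v) x = 2 * Real.sqrt (1 / 4 + (toCont v x) ^ 2) := by
  have h1 := congrArg (fun u => toCont u x) (h.eq v hv)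
  have h2 : toCont (φ v) x * toCont (φ v) x + toCont (φ v) x = toCont v x * toCont v x := h1
  have h3 := (abs_lt.mp (h.abs_toCont_lt v hv x)).1
  have h4 : Real.sqrt (1 / 4 + (toCont v x) ^ 2) = 1 / 2 + toCont (φ v) x := by
    rw [Real.sqrt_eq_iff_mul_self_eq (by positivity) (by linarith)]
    linarith
  rw [h4]
  ring

lemma mem_criticalManifold (h : IsCriticalMap φ T ρ δ) {v : H2} (hv : ‖v‖ < ρ) :
    (φ v, v) ∈ criticalManifold := fun x => by
  have := h.one_add_two_mul_eq hv x
  change toCont (φ v) x = -(1 / 2) + Real.sqrt (1 / 4 + (toCont v x) ^ 2)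
  linarith

lemma eq_of_mem_criticalManifold (h : IsCriticalMap φ T ρ δ) {u v : H2} (hv : ‖v‖ < ρ)
    (hu : (u, v) ∈ criticalManifold) : u = φ v := by
  apply toCont_injective
  ext x
  rw [h.mem_criticalManifold hv x]
  exact hu x

lemma inv_apply (h : IsCriticalMap φ T ρ δ) {v : H2} (hv : ‖v‖ < ρ) (w : H2) (x : Torus) :
    toCont (T v w) x = toCont w x / (2 * Real.sqrt (1 / 4 + (toCont v x) ^ 2)) := by
  have h1 := congrArg (fun u => toCont u x) (h.right_inv v hv w)
  have h2 : toCont (T v w) x + 2 * (toCont (φ v) x * toCont (T v w) x) = toCont w x := h1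
  have h3 := h.one_add_two_mul_eq hv x
  have h4 : (0 : ℝ) < Real.sqrt (1 / 4 + (toCont v x) ^ 2) := Real.sqrt_pos.mpr (by positivity)
  rw [eq_div_iff (by positivity), ← h3]
  linarith

/-- Implicit differentiation of `φ² + φ = v²` gives `(1 + 2φ)φ'ξ = 2vξ`, and `T v` inverts the
factor on the left. -/
lemma hasFDerivAt (h : IsCriticalMap φ T ρ δ) {v : H2} (hv : ‖v‖ < ρ) :
    HasFDerivAt φ ((2 : ℝ) • (T v).comp (mul v)) v := by
  have h1 := ((h.contDiffAt v hv).differentiableAt one_ne_zero).hasFDerivAt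
  refine h1.congr_fderiv ?_
  have h2 : HasFDerivAt (fun u => mul (φ u) (φ u) + φ u) _ v :=
    ((mul.hasFDerivAt.comp v h1).clm_apply h1).add h1
  have h3 : HasFDerivAt (fun u : H2 => mul u u) _ v :=
    (mul.hasFDerivAt (x := v)).clm_apply (hasFDerivAt_id v)
  have h4 : (fun u => mul (φ u) (φ u) + φ u) =ᶠ[nhds v] fun u => mul u u := by
    have : Metric.ball (0 : H2) ρ ∈ nhds v := Metric.isOpen_ball.mem_nhds (by simpa using hv)
    filter_upwards [this] with u hu
    exact h.eq u (by simpa using hu)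
  have h5 := h2.unique (h3.congr_of_eventuallyEq h4)
  ext1 ξ
  have h6 := congrArg (fun L : H2 →L[ℝ] H2 => L ξ) h5
  have h7 : mul (φ v) (fderiv ℝ φ v ξ) + mul (fderiv ℝ φ v ξ) (φ v) + fderiv ℝ φ v ξ =
      mul v ξ + mul ξ v := by
    simpa using h6
  rw [mul_comm' _ (φ v), mul_comm' ξ v] at h7
  have h8 := h.left_inv v hv (fderiv ℝ φ v ξ)
  have h9 : fderiv ℝ φ v ξ + (2 : ℝ) • mul (φ v) (fderiv ℝ φ v ξ) = (2 : ℝ) • mul v ξ := by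
    rw [two_smul, two_smul, ← h7]
    abel
  rw [h9, map_smul] at h8
  exact h8.symm

end IsCriticalMap

/-! ### Pointwise derivatives -/

variable {k₀ : ℕ}

lemma hasDerivAt_fourier_torus (k : ℤ) (x : ℝ) :
    HasDerivAt (fun y : ℝ => fourier k (y : Torus)) (Complex.I * k * fourier k (x : Torus)) x := by
  have h := hasDerivAt_fourier (2 * Real.pi) k x
  convert h using 1
  have : (Real.pi : ℂ) ≠ 0 := by exact_mod_cast Real.pi_ne_zero
  push_cast
  field_simp

lemma toCont_slow_eq_sum (v : slowSpace k₀) (x : Torus) :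
    ((toCont (v : H2) x : ℝ) : ℂ) =
      ∑ k ∈ Finset.Icc (-(k₀ : ℤ)) k₀, coeff (toCont (v : H2)) k * fourier k x := by
  have h1 := (ContinuousMap.evalCLM ℂ x).hasSum (hasSum_fourier (v : H2))
  refine h1.unique ?_
  refine hasSum_sum_of_ne_finset_zero (f := fun k => coeff (toCont (v : H2)) k * fourier k x)
    fun k hk => ?_
  rw [coeff_eq_zero_of_slow v, zero_mul]
  by_contra hlt
  exact hk (Finset.mem_Icc.mpr (abs_le.mp (not_lt.mp hlt)))

lemma hasDerivAt_toCont_slow (v : slowSpace k₀) (x : ℝ) :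
    HasDerivAt (fun y : ℝ => toCont (v : H2) (y : Torus))
      (toCont (slowDeriv k₀ v : H2) (x : Torus)) x := by
  have h1 : HasDerivAt (fun y : ℝ => ((toCont (v : H2) (y : Torus) : ℝ) : ℂ))
      ((toCont (slowDeriv k₀ v : H2) (x : Torus) : ℝ) : ℂ) x := by
    simp_rw [toCont_slow_eq_sum]
    refine HasDerivAt.fun_sum fun k _ => ?_
    have := (hasDerivAt_fourier_torus k x).const_mul (coeff (toCont (v : H2)) k)
    refine this.congr_deriv ?_
    rw [coeff_slowDeriv]
    ring
  have h2 := Complex.reCLM.hasFDerivAt.comp_hasDerivAt x h1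
  exact h2

lemma slowDeriv_slowDeriv (v : slowSpace k₀) : slowDeriv k₀ (slowDeriv k₀ v) = slowLap k₀ v :=
  slow_ext fun k => by
    rw [coeff_slowDeriv, coeff_slowDeriv, coeff_slowLap, ← mul_assoc]
    congr 1
    linear_combination (k : ℂ) ^ 2 * Complex.I_mul_I

/-- Integration by parts over one period; the boundary terms cancel by periodicity. -/
lemma coeff_of_hasDerivAt {f f' : C(Torus, ℝ)}
    (h : ∀ x : ℝ, HasDerivAt (fun y : ℝ => f (y : Torus)) (f' (x : Torus)) x) (k : ℤ) :
    coeff f' k = Complex.I * k * coeff f k := by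
  have hc : Continuous fun x : ℝ => (x : Torus) := AddCircle.continuous_mk' _
  have h1 : ∀ x : ℝ, HasDerivAt (fun y : ℝ => ((f (y : Torus) : ℝ) : ℂ))
      ((f' (x : Torus) : ℝ) : ℂ) x := fun x => (h x).ofReal_comp
  have h2 := intervalIntegral.integral_mul_deriv_eq_deriv_mul (a := 0) (b := 0 + 2 * Real.pi)
    (fun x _ => hasDerivAt_fourier_torus (-k) x) (fun x _ => h1 x)
    ((continuous_const.mul ((fourier (-k)).continuous.comp hc)).intervalIntegrable _ _)
    ((Complex.continuous_ofReal.comp (f'.continuous.comp hc)).intervalIntegrable _ _)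
  have h3 : ((0 + 2 * Real.pi : ℝ) : Torus) = ((0 : ℝ) : Torus) := by
    rw [zero_add]
    exact (AddCircle.coe_period _).trans (QuotientAddGroup.mk_zero _).symm
  rw [h3, sub_self, zero_sub] at h2
  have h4 : coeff f' k = (1 / (2 * Real.pi)) •
      ∫ x in (0 : ℝ)..0 + 2 * Real.pi, fourier (-k) (x : Torus) * ((f' (x : Torus) : ℝ) : ℂ) :=
    fourierCoeff_eq_intervalIntegral _ k 0
  have h5 : coeff f k = (1 / (2 * Real.pi)) •
      ∫ x in (0 : ℝ)..0 + 2 * Real.pi, fourier (-k) (x : Torus) * ((f (x : Torus) : ℝ) : ℂ) :=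
    fourierCoeff_eq_intervalIntegral _ k 0
  rw [h4, h2, h5, mul_smul_comm, ← intervalIntegral.integral_const_mul,
    ← intervalIntegral.integral_neg]
  congr 1
  refine intervalIntegral.integral_congr fun x _ => ?_
  push_cast
  ring

/-- The remainder `φ''(v) v_x²` on the slow modes. -/
def remainder (T : H2 → H2 →L[ℝ] H2) (v : slowSpace k₀) : H2 :=
  (2 : ℝ) • T v (T v (T v (mul (slowDeriv k₀ v : H2) (slowDeriv k₀ v : H2))))

/-- The chain rule `Δφ(v) = φ'(v)Δv + φ''(v)v_x²`. With `q = √(1/4 + v²)` one has `φ = -1/2 + q`,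
`φ' = v/q` and `φ'' = 1/(4q³)`, while `T v` is division by `2q`, so that `φ''` is `2T³`. Slow
functions are trigonometric polynomials, so two classical derivatives are available and their
coefficients give the Laplacian. -/
lemma lap_criticalMap {φ : H2 → H2} {T : H2 → H2 →L[ℝ] H2} {ρ δ : ℝ}
    (h : IsCriticalMap φ T ρ δ) (v : slowSpace k₀) (hv : ‖v‖ < ρ) :
    lap (φ v) = embL2 (((2 : ℝ) • (T v).comp (mul v)) (slowLap k₀ v : H2) + remainder T v) := by
  have hv' : ‖(v : H2)‖ < ρ := hv
  set V : ℝ → ℝ := fun x => toCont (v : H2) (x : Torus) with hV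
  set V1 : ℝ → ℝ := fun x => toCont (slowDeriv k₀ v : H2) (x : Torus) with hV1
  set V2 : ℝ → ℝ := fun x => toCont (slowLap k₀ v : H2) (x : Torus) with hV2
  have d1 : ∀ x, HasDerivAt V (V1 x) x := fun x => hasDerivAt_toCont_slow v x
  have d2 : ∀ x, HasDerivAt V1 (V2 x) x := fun x => by
    have := hasDerivAt_toCont_slow (slowDeriv k₀ v) x
    rwa [slowDeriv_slowDeriv] at this
  set q : ℝ → ℝ := fun x => Real.sqrt (1 / 4 + V x ^ 2) with hq
  have hq0 : ∀ x, 0 < q x := fun x => Real.sqrt_pos.mpr (by positivity)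
  have hqq : ∀ x, q x ^ 2 = 1 / 4 + V x ^ 2 := fun x => Real.sq_sqrt (by positivity)
  have dq : ∀ x, HasDerivAt q (V x * V1 x / q x) x := fun x => by
    have h1 := (((d1 x).pow 2).const_add (1 / 4)).sqrt
      (show (0 : ℝ) < 1 / 4 + V x ^ 2 by positivity).ne'
    refine h1.congr_deriv ?_
    have := hq0 x
    simp only [Pi.pow_apply]
    change _ / (2 * q x) = _
    field_simp
    ring
  set f1 : H2 := (2 : ℝ) • T v (mul v (slowDeriv k₀ v : H2)) with hf1
  set f2 : H2 := ((2 : ℝ) • (T v).comp (mul v)) (slowLap k₀ v : H2) + remainder T v with hf2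
  have p0 : ∀ x : ℝ, toCont (φ v) (x : Torus) = -(1 / 2) + q x := fun x =>
    h.mem_criticalManifold hv' x
  have p1 : ∀ x : ℝ, toCont f1 (x : Torus) = V x * V1 x / q x := fun x => by
    have e : toCont f1 (x : Torus) = 2 * toCont (T v (mul v (slowDeriv k₀ v : H2))) (x : Torus) :=
      rfl
    rw [e, h.inv_apply hv', toCont_mul]
    change 2 * (V x * V1 x / (2 * q x)) = _
    have := hq0 x
    field_simp
  have p2 : ∀ x : ℝ, toCont f2 (x : Torus) = V x * V2 x / q x + V1 x ^ 2 / (4 * q x ^ 3) :=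
    fun x => by
    have e : toCont f2 (x : Torus) = 2 * toCont (T v (mul v (slowLap k₀ v : H2))) (x : Torus) +
      2 * toCont (T v (T v (T v (mul (slowDeriv k₀ v : H2) (slowDeriv k₀ v : H2))))) (x : Torus) :=
      rfl
    rw [e, h.inv_apply hv', h.inv_apply hv', h.inv_apply hv', h.inv_apply hv', toCont_mul,
      toCont_mul]
    change 2 * (V x * V2 x / (2 * q x)) +
      2 * (V1 x * V1 x / (2 * q x) / (2 * q x) / (2 * q x)) = _
    have := hq0 x
    field_simp
    ring
  have D1 : ∀ x : ℝ, HasDerivAt (fun y : ℝ => toCont (φ v) (y : Torus))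
      (toCont f1 (x : Torus)) x := fun x => by
    simp_rw [p0, p1]
    exact (dq x).const_add _
  have D2 : ∀ x : ℝ, HasDerivAt (fun y : ℝ => toCont f1 (y : Torus))
      (toCont f2 (x : Torus)) x := fun x => by
    simp_rw [p1]
    have h1 := ((d1 x).mul (d2 x)).div (dq x) (hq0 x).ne'
    refine h1.congr_deriv ?_
    rw [p2]
    have h0 := hq0 x
    have h2 := hqq x
    simp only [Pi.mul_apply]
    field_simp
    -- Eliminating `V²` leaves only the constant `1/4` in the numerator of `φ''`.
    rw [show V x ^ 2 = q x ^ 2 - 1 / 4 by linarith]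
    ring
  apply coeffL2.injective
  ext k
  rw [coeffL2_lap, coeffL2_embL2, coeff_of_hasDerivAt D2, coeff_of_hasDerivAt D1]
  linear_combination (-(k : ℂ) ^ 2 * coeff (toCont (φ v)) k) * Complex.I_mul_I

/-- The constant is `64 = 2 · 2³ · 4`: the scalar in `remainder`, three factors `‖T v‖ ≤ 2`, and the
constant of `norm_mul_slowDeriv_le`. -/
lemma norm_remainder_le {φ : H2 → H2} {T : H2 → H2 →L[ℝ] H2} {ρ δ : ℝ}
    (h : IsCriticalMap φ T ρ δ) (v : slowSpace k₀) (hv : ‖v‖ < ρ) :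
    ‖remainder T v‖ ≤ 64 * derivConst * k₀ * ‖v‖ ^ 2 := by
  have hT : ∀ w, ‖T v w‖ ≤ 2 * ‖w‖ := fun w =>
    ((T v).le_opNorm w).trans (mul_le_mul_of_nonneg_right (h.norm_inv_le v hv) (norm_nonneg _))
  rw [remainder, norm_smul, Real.norm_two]
  have h1 := norm_mul_slowDeriv_le v
  have h2 := hT (mul (slowDeriv k₀ v : H2) (slowDeriv k₀ v : H2))
  have h3 := hT (T v (mul (slowDeriv k₀ v : H2) (slowDeriv k₀ v : H2)))
  have h4 := hT (T v (T v (mul (slowDeriv k₀ v : H2) (slowDeriv k₀ v : H2))))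
  linarith

lemma contDiffAt_remainder {φ : H2 → H2} {T : H2 → H2 →L[ℝ] H2} {ρ δ : ℝ}
    (h : IsCriticalMap φ T ρ δ) (v : slowSpace k₀) (hv : ‖v‖ < ρ) :
    ContDiffAt ℝ 1 (remainder T : slowSpace k₀ → H2) v := by
  have h1 : ContDiffAt ℝ 1 (fun v : slowSpace k₀ => T (v : H2)) v :=
    (h.contDiffAt_inv v hv).comp v (slowSpace k₀).subtypeL.contDiff.contDiffAt
  have h2 : ContDiffAt ℝ 1 (fun v : slowSpace k₀ => (slowDeriv k₀ v : H2)) v :=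
    ((slowSpace k₀).subtypeL.comp (slowDeriv k₀)).contDiff.contDiffAt
  have h3 := (mul.contDiff.contDiffAt.comp v h2).clm_apply h2
  exact (h1.clm_apply (h1.clm_apply (h1.clm_apply h3))).const_smul (2 : ℝ)

end

end FastReaction

namespace FastReaction

noncomputable section

open scoped BoundedContinuousFunction

/-! ### The Duhamel integral over the past and its derivative -/

section Abstract

variable {X Y : Type*} [NormedAddCommGroup X] [NormedSpace ℝ X]
  [NormedAddCommGroup Y] [NormedSpace ℝ Y]

/-- A contraction semigroup `K` on `X` and a backward flow `E` on `Y` of exponential growth rate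
at most `ℓ`. -/
structure IsFlowPair (K : ℝ → X →L[ℝ] X) (E : ℝ → Y →L[ℝ] Y) (ℓ : ℝ) : Prop where
  continuous_left : Continuous fun p : ℝ × X => K p.1 p.2
  norm_left_le : ∀ s, ‖K s‖ ≤ 1
  continuous_right : ∀ y, Continuous fun s => E s y
  norm_right_le : ∀ s, 0 ≤ s → ‖E s‖ ≤ Real.exp (ℓ * s)

variable {K : ℝ → X →L[ℝ] X} {E : ℝ → Y →L[ℝ] Y} {ℓ b : ℝ}

/-- The integrand of the Duhamel integral. -/
def duhamelIntegrand (K : ℝ → X →L[ℝ] X) (E : ℝ → Y →L[ℝ] Y) (b : ℝ) (G : Y → X) (v : Y) (s : ℝ) :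
    X := Real.exp (-b * s) • K s (G (E s v))

/-- The Duhamel integral over the whole past. -/
def duhamel (K : ℝ → X →L[ℝ] X) (E : ℝ → Y →L[ℝ] Y) (b : ℝ) (G : Y → X) (v : Y) : X :=
  ∫ s in Ioi (0 : ℝ), duhamelIntegrand K E b G v s

/-- The integrand of the derivative of the Duhamel integral. -/
def duhamelIntegrand' (K : ℝ → X →L[ℝ] X) (E : ℝ → Y →L[ℝ] Y) (b : ℝ) (G' : Y → Y →L[ℝ] X)
    (v : Y) (s : ℝ) : Y →L[ℝ] X :=
  Real.exp (-b * s) • (K s).comp ((G' (E s v)).comp (E s))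

/-- The derivative of the Duhamel integral. -/
def duhamel' (K : ℝ → X →L[ℝ] X) (E : ℝ → Y →L[ℝ] Y) (b : ℝ) (G' : Y → Y →L[ℝ] X) (v : Y) :
    Y →L[ℝ] X :=
  ∫ s in Ioi (0 : ℝ), duhamelIntegrand' K E b G' v s

namespace IsFlowPair

lemma norm_apply_le (h : IsFlowPair K E ℓ) (s : ℝ) (x : X) : ‖K s x‖ ≤ ‖x‖ :=
  ((K s).le_opNorm x).trans (mul_le_of_le_one_left (norm_nonneg _) (h.norm_left_le s))

lemma continuous_integrand (h : IsFlowPair K E ℓ) {G : Y → X} (hG : Continuous G) (v : Y) :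
    Continuous (duhamelIntegrand K E b G v) := by
  have h1 : Continuous fun s => K s (G (E s v)) :=
    h.continuous_left.comp (continuous_id.prodMk (hG.comp (h.continuous_right v)))
  exact (show Continuous fun s => Real.exp (-b * s) by fun_prop).smul h1

lemma norm_integrand_le (h : IsFlowPair K E ℓ) {G : Y → X} {M : ℝ} (hM : ∀ y, ‖G y‖ ≤ M) (v : Y)
    (s : ℝ) : ‖duhamelIntegrand K E b G v s‖ ≤ M * Real.exp (-b * s) := by
  rw [duhamelIntegrand, norm_smul, Real.norm_of_nonneg (Real.exp_pos _).le, mul_comm]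
  exact mul_le_mul_of_nonneg_right ((h.norm_apply_le s _).trans (hM _)) (Real.exp_pos _).le

lemma integrableOn_exp (hb : 0 < b) (M : ℝ) :
    IntegrableOn (fun s => M * Real.exp (-b * s)) (Ioi 0) :=
  (exp_neg_integrableOn_Ioi 0 hb).const_mul M

lemma integral_exp (hb : 0 < b) (M : ℝ) :
    ∫ s in Ioi (0 : ℝ), M * Real.exp (-b * s) = M * b⁻¹ := by
  rw [integral_const_mul, integral_exp_mul_Ioi (by linarith) 0]
  congr 1
  rw [mul_zero, Real.exp_zero]
  field_simp

lemma integrable (h : IsFlowPair K E ℓ) (hb : 0 < b) {G : Y → X} (hG : Continuous G) {M : ℝ}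
    (hM : ∀ y, ‖G y‖ ≤ M) (v : Y) :
    IntegrableOn (duhamelIntegrand K E b G v) (Ioi 0) :=
  Integrable.mono' (integrableOn_exp hb M) (h.continuous_integrand hG v).aestronglyMeasurable
    (Filter.Eventually.of_forall fun s => h.norm_integrand_le hM v s)

lemma norm_duhamel_le (h : IsFlowPair K E ℓ) (hb : 0 < b) {G : Y → X} {M : ℝ}
    (hM : ∀ y, ‖G y‖ ≤ M) (v : Y) : ‖duhamel K E b G v‖ ≤ M * b⁻¹ := by
  rw [← integral_exp hb M]
  exact norm_integral_le_of_norm_le (integrableOn_exp hb M)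
    (Filter.Eventually.of_forall fun s => h.norm_integrand_le hM v s)

lemma duhamel_sub (h : IsFlowPair K E ℓ) (hb : 0 < b) {G₁ G₂ : Y → X} (hG₁ : Continuous G₁)
    (hG₂ : Continuous G₂) {M₁ M₂ : ℝ} (hM₁ : ∀ y, ‖G₁ y‖ ≤ M₁) (hM₂ : ∀ y, ‖G₂ y‖ ≤ M₂) (v : Y) :
    duhamel K E b G₁ v - duhamel K E b G₂ v = duhamel K E b (fun y => G₁ y - G₂ y) v := by
  rw [duhamel, duhamel, ← integral_sub (h.integrable hb hG₁ hM₁ v) (h.integrable hb hG₂ hM₂ v)]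
  refine integral_congr_ae (Filter.Eventually.of_forall fun s => ?_)
  simp only [duhamelIntegrand]
  rw [map_sub, smul_sub]

/-- The chain rule through the backward flow produces a factor `E s`, of size at most `exp (ℓ s)`.
The decay rate therefore drops from `b` to `b - ℓ`, and a derivative requires the gap `ℓ < b`. -/
lemma norm_integrand'_le (h : IsFlowPair K E ℓ) {G' : Y → Y →L[ℝ] X} {M : ℝ}
    (hM : ∀ y, ‖G' y‖ ≤ M) (v : Y) {s : ℝ} (hs : 0 ≤ s) :
    ‖duhamelIntegrand' K E b G' v s‖ ≤ M * Real.exp (-(b - ℓ) * s) := by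
  have hM0 : 0 ≤ M := (norm_nonneg _).trans (hM 0)
  have h1 : ‖(K s).comp ((G' (E s v)).comp (E s))‖ ≤ 1 * (M * Real.exp (ℓ * s)) :=
    (ContinuousLinearMap.opNorm_comp_le _ _).trans (mul_le_mul (h.norm_left_le s)
      ((ContinuousLinearMap.opNorm_comp_le _ _).trans (mul_le_mul (hM _) (h.norm_right_le s hs)
        (norm_nonneg _) hM0)) (norm_nonneg _) zero_le_one)
  rw [duhamelIntegrand', norm_smul, Real.norm_of_nonneg (Real.exp_pos _).le]
  refine (mul_le_mul_of_nonneg_left h1 (Real.exp_pos _).le).trans (le_of_eq ?_)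
  rw [show -(b - ℓ) * s = -b * s + ℓ * s by ring, Real.exp_add]
  ring

lemma norm_integrand'_ae (h : IsFlowPair K E ℓ) {G' : Y → Y →L[ℝ] X} {M : ℝ}
    (hM : ∀ y, ‖G' y‖ ≤ M) (v : Y) : ∀ᵐ s ∂(volume.restrict (Ioi (0 : ℝ))),
      ‖duhamelIntegrand' K E b G' v s‖ ≤ M * Real.exp (-(b - ℓ) * s) :=
  (ae_restrict_iff' measurableSet_Ioi).mpr
    (Filter.Eventually.of_forall fun _ hs => h.norm_integrand'_le hM v (le_of_lt hs))

lemma norm_duhamel'_le (h : IsFlowPair K E ℓ) (hb : ℓ < b) {G' : Y → Y →L[ℝ] X} {M : ℝ}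
    (hM : ∀ y, ‖G' y‖ ≤ M) (v : Y) : ‖duhamel' K E b G' v‖ ≤ M * (b - ℓ)⁻¹ := by
  rw [← integral_exp (sub_pos.mpr hb) M]
  exact norm_integral_le_of_norm_le (integrableOn_exp (sub_pos.mpr hb) M) (h.norm_integrand'_ae hM v)

variable [FiniteDimensional ℝ Y]

/-- `K` and `E` are only strongly continuous. Finite dimension of `Y` turns pointwise continuity
into continuity in operator norm. -/
lemma continuous_integrand' (h : IsFlowPair K E ℓ) {G' : Y → Y →L[ℝ] X} (hG : Continuous G')
    (v : Y) : Continuous (duhamelIntegrand' K E b G' v) := by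
  have h1 : Continuous fun s => (K s).comp ((G' (E s v)).comp (E s)) := by
    refine continuous_clm_apply.mpr fun y => ?_
    refine h.continuous_left.comp (continuous_id.prodMk ?_)
    exact (hG.comp (h.continuous_right v)).clm_apply (h.continuous_right y)
  exact (show Continuous fun s => Real.exp (-b * s) by fun_prop).smul h1

lemma integrable' (h : IsFlowPair K E ℓ) (hb : ℓ < b) {G' : Y → Y →L[ℝ] X} (hG : Continuous G')
    {M : ℝ} (hM : ∀ y, ‖G' y‖ ≤ M) (v : Y) :
    IntegrableOn (duhamelIntegrand' K E b G' v) (Ioi 0) :=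
  Integrable.mono' (integrableOn_exp (sub_pos.mpr hb) M)
    (h.continuous_integrand' hG v).aestronglyMeasurable (h.norm_integrand'_ae hM v)

lemma duhamel'_sub (h : IsFlowPair K E ℓ) (hb : ℓ < b) {G₁ G₂ : Y → Y →L[ℝ] X}
    (hG₁ : Continuous G₁) (hG₂ : Continuous G₂) {M₁ M₂ : ℝ} (hM₁ : ∀ y, ‖G₁ y‖ ≤ M₁)
    (hM₂ : ∀ y, ‖G₂ y‖ ≤ M₂) (v : Y) :
    duhamel' K E b G₁ v - duhamel' K E b G₂ v = duhamel' K E b (fun y => G₁ y - G₂ y) v := by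
  rw [duhamel', duhamel', ← integral_sub (h.integrable' hb hG₁ hM₁ v) (h.integrable' hb hG₂ hM₂ v)]
  refine integral_congr_ae (Filter.Eventually.of_forall fun s => ?_)
  simp only [duhamelIntegrand']
  rw [ContinuousLinearMap.sub_comp, ContinuousLinearMap.comp_sub, smul_sub]

lemma continuous_duhamel' (h : IsFlowPair K E ℓ) (hb : ℓ < b) {G' : Y → Y →L[ℝ] X}
    (hG : Continuous G') {M : ℝ} (hM : ∀ y, ‖G' y‖ ≤ M) : Continuous (duhamel' K E b G') := by
  refine continuous_of_dominated (bound := fun s => M * Real.exp (-(b - ℓ) * s))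
    (fun v => (h.continuous_integrand' hG v).aestronglyMeasurable)
    (fun v => h.norm_integrand'_ae hM v) (integrableOn_exp (sub_pos.mpr hb) M) ?_
  refine Filter.Eventually.of_forall fun s => ?_
  have h1 : Continuous fun v => (G' (E s v)).comp (E s) :=
    (hG.comp (E s).continuous).clm_comp continuous_const
  exact ((continuous_const (y := K s)).clm_comp h1).const_smul (Real.exp (-b * s))

lemma hasFDerivAt_duhamel (h : IsFlowPair K E ℓ) (hb0 : 0 < b) (hb : ℓ < b) {G : Y → X}
    {G' : Y → Y →L[ℝ] X} {M M' : ℝ} (hG : ∀ y, HasFDerivAt G (G' y) y) (hG' : Continuous G')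
    (hM : ∀ y, ‖G y‖ ≤ M) (hM' : ∀ y, ‖G' y‖ ≤ M') (v : Y) :
    HasFDerivAt (duhamel K E b G) (duhamel' K E b G' v) v := by
  have hc : Continuous G := continuous_iff_continuousAt.mpr fun y => (hG y).continuousAt
  refine hasFDerivAt_integral_of_dominated_of_fderiv_le
    (F := duhamelIntegrand K E b G) (F' := duhamelIntegrand' K E b G')
    (bound := fun s => M' * Real.exp (-(b - ℓ) * s)) (s := univ)
    Filter.univ_mem
    (Filter.Eventually.of_forall fun y => (h.continuous_integrand hc y).aestronglyMeasurable)
    (h.integrable hb0 hc hM v) (h.continuous_integrand' hG' v).aestronglyMeasurable ?_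
    (integrableOn_exp (sub_pos.mpr hb) M') ?_
  · exact (ae_restrict_iff' measurableSet_Ioi).mpr
      (Filter.Eventually.of_forall fun s hs y _ => h.norm_integrand'_le hM' y (le_of_lt hs))
  · refine Filter.Eventually.of_forall fun s y _ => ?_
    have h1 := (K s).hasFDerivAt.comp y ((hG (E s y)).comp y (E s).hasFDerivAt)
    exact h1.const_smul (Real.exp (-b * s))

end IsFlowPair

end Abstract

end

end FastReaction

namespace FastReaction

noncomputable section

open scoped BoundedContinuousFunction

/-! ### The invariant graph as a fixed point in `C¹` -/

section FixedPoint

variable {X Y : Type*} [NormedAddCommGroup X] [NormedSpace ℝ X]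
  [NormedAddCommGroup Y] [NormedSpace ℝ Y]

/-- The nonlinearity `F - b (2 B W + W²)`. -/
def nonlin (m : X →L[ℝ] X →L[ℝ] X) (F B : Y → X) (b : ℝ) (W : Y → X) (y : Y) : X :=
  F y - b • ((2 : ℝ) • m (B y) (W y) + m (W y) (W y))

/-- The derivative of the nonlinearity, when `P` is the derivative of `W`. -/
def nonlin' (m : X →L[ℝ] X →L[ℝ] X) (F B : Y → X) (b : ℝ) (W : Y → X) (P : Y → Y →L[ℝ] X)
    (y : Y) : Y →L[ℝ] X :=
  fderiv ℝ F y - b • ((2 : ℝ) • ((m (B y)).comp (P y) + (m.flip (W y)).comp (fderiv ℝ B y)) +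
    ((m (W y)).comp (P y) + (m.flip (W y)).comp (P y)))

variable {m : X →L[ℝ] X →L[ℝ] X} {F B : Y → X} {b c f f' β β' r L : ℝ}

lemma hasFDerivAt_nonlin (hF : ContDiff ℝ 1 F) (hB : ContDiff ℝ 1 B) {W : Y → X}
    {P : Y → Y →L[ℝ] X} {y : Y} (hW : HasFDerivAt W (P y) y) :
    HasFDerivAt (nonlin m F B b W) (nonlin' m F B b W P y) y := by
  have hF' := (hF.differentiable one_ne_zero y).hasFDerivAt
  have hB' := (hB.differentiable one_ne_zero y).hasFDerivAt
  have h1 := (m.hasFDerivAt.comp y hB').clm_apply hW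
  have h2 := (m.hasFDerivAt.comp y hW).clm_apply hW
  have h3 := hF'.sub (((h1.const_smul (2 : ℝ)).add h2).const_smul b)
  refine h3.congr_fderiv ?_
  ext w
  simp [nonlin']

lemma norm_comp_le (hc : ∀ x y, ‖m x y‖ ≤ c * ‖x‖ * ‖y‖) (hc0 : 0 ≤ c) (x : X) (P : Y →L[ℝ] X) :
    ‖(m x).comp P‖ ≤ c * ‖x‖ * ‖P‖ :=
  (ContinuousLinearMap.opNorm_comp_le _ _).trans (mul_le_mul_of_nonneg_right
    (ContinuousLinearMap.opNorm_le_bound _ (by positivity) (hc x)) (norm_nonneg _))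

lemma norm_flip_apply_le (hc : ∀ x y, ‖m x y‖ ≤ c * ‖x‖ * ‖y‖) (x y : X) :
    ‖m.flip x y‖ ≤ c * ‖x‖ * ‖y‖ := by
  rw [ContinuousLinearMap.flip_apply]
  refine (hc y x).trans (le_of_eq ?_)
  ring

lemma norm_nonlin_le {Z : Type*} {F B : Z → X}
    (hc : ∀ x y, ‖m x y‖ ≤ c * ‖x‖ * ‖y‖) (hc0 : 0 ≤ c) (hb : 0 ≤ b)
    {W : Z → X} {y : Z} (hF : ‖F y‖ ≤ f) (hB : ‖B y‖ ≤ β) (hW : ‖W y‖ ≤ r) :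
    ‖nonlin m F B b W y‖ ≤ f + b * (c * (2 * β + r) * r) := by
  have hr : 0 ≤ r := (norm_nonneg _).trans hW
  have hβ : 0 ≤ β := (norm_nonneg _).trans hB
  have h1 : ‖m (B y) (W y)‖ ≤ c * β * r :=
    (hc _ _).trans (by gcongr)
  have h2 : ‖m (W y) (W y)‖ ≤ c * r * r := (hc _ _).trans (by gcongr)
  rw [nonlin]
  refine (norm_sub_le _ _).trans (add_le_add hF ?_)
  rw [norm_smul, Real.norm_of_nonneg hb]
  refine mul_le_mul_of_nonneg_left ((norm_add_le _ _).trans ?_) hb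
  rw [norm_smul, Real.norm_two]
  linarith

lemma norm_nonlin_sub_le {Z : Type*} {F B : Z → X}
    (hc : ∀ x y, ‖m x y‖ ≤ c * ‖x‖ * ‖y‖) (hc0 : 0 ≤ c) (hb : 0 ≤ b)
    {W₁ W₂ : Z → X} {y : Z} {d : ℝ} (hB : ‖B y‖ ≤ β) (hW₁ : ‖W₁ y‖ ≤ r) (hW₂ : ‖W₂ y‖ ≤ r)
    (hd : ‖W₁ y - W₂ y‖ ≤ d) :
    ‖nonlin m F B b W₁ y - nonlin m F B b W₂ y‖ ≤ b * (c * (2 * β + 2 * r) * d) := by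
  have hr : 0 ≤ r := (norm_nonneg _).trans hW₁
  have hd0 : 0 ≤ d := (norm_nonneg _).trans hd
  have hβ : 0 ≤ β := (norm_nonneg _).trans hB
  have e : nonlin m F B b W₁ y - nonlin m F B b W₂ y =
      -(b • ((2 : ℝ) • m (B y) (W₁ y - W₂ y) +
        (m (W₁ y) (W₁ y - W₂ y) + m (W₁ y - W₂ y) (W₂ y)))) := by
    simp only [nonlin, map_sub, sub_apply]
    module
  have h1 : ‖m (B y) (W₁ y - W₂ y)‖ ≤ c * β * d := (hc _ _).trans (by gcongr)
  have h2 : ‖m (W₁ y) (W₁ y - W₂ y)‖ ≤ c * r * d := (hc _ _).trans (by gcongr)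
  have h3 : ‖m (W₁ y - W₂ y) (W₂ y)‖ ≤ c * d * r := (hc _ _).trans (by gcongr)
  rw [e, norm_neg, norm_smul, Real.norm_of_nonneg hb]
  refine mul_le_mul_of_nonneg_left ((norm_add_le _ _).trans ?_) hb
  have h4 := norm_add_le (m (W₁ y) (W₁ y - W₂ y)) (m (W₁ y - W₂ y) (W₂ y))
  rw [norm_smul, Real.norm_two]
  linarith

lemma norm_nonlin'_le (hc : ∀ x y, ‖m x y‖ ≤ c * ‖x‖ * ‖y‖) (hc0 : 0 ≤ c) (hb : 0 ≤ b)
    {W : Y → X} {P : Y → Y →L[ℝ] X} {y : Y} (hF : ‖fderiv ℝ F y‖ ≤ f') (hB : ‖B y‖ ≤ β)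
    (hB' : ‖fderiv ℝ B y‖ ≤ β') (hW : ‖W y‖ ≤ r) (hP : ‖P y‖ ≤ L) :
    ‖nonlin' m F B b W P y‖ ≤ f' + b * (c * (2 * β + 2 * r) * L + 2 * c * r * β') := by
  have hr : 0 ≤ r := (norm_nonneg _).trans hW
  have hβ : 0 ≤ β := (norm_nonneg _).trans hB
  have h1 : ‖(m (B y)).comp (P y)‖ ≤ c * β * L := (norm_comp_le hc hc0 _ _).trans (by gcongr)
  have h2 : ‖(m.flip (W y)).comp (fderiv ℝ B y)‖ ≤ c * r * β' :=
    (norm_comp_le (norm_flip_apply_le hc) hc0 _ _).trans (by gcongr)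
  have h3 : ‖(m (W y)).comp (P y)‖ ≤ c * r * L := (norm_comp_le hc hc0 _ _).trans (by gcongr)
  have h4 : ‖(m.flip (W y)).comp (P y)‖ ≤ c * r * L :=
    (norm_comp_le (norm_flip_apply_le hc) hc0 _ _).trans (by gcongr)
  rw [nonlin']
  refine (norm_sub_le _ _).trans (add_le_add hF ?_)
  rw [norm_smul, Real.norm_of_nonneg hb]
  refine mul_le_mul_of_nonneg_left ((norm_add_le _ _).trans ?_) hb
  have h5 := norm_add_le ((m (B y)).comp (P y)) ((m.flip (W y)).comp (fderiv ℝ B y))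
  have h6 := norm_add_le ((m (W y)).comp (P y)) ((m.flip (W y)).comp (P y))
  rw [norm_smul, Real.norm_two]
  linarith

lemma norm_nonlin'_sub_le (hc : ∀ x y, ‖m x y‖ ≤ c * ‖x‖ * ‖y‖) (hc0 : 0 ≤ c) (hb : 0 ≤ b)
    {W₁ W₂ : Y → X} {P₁ P₂ : Y → Y →L[ℝ] X} {y : Y} {d e : ℝ} (hB : ‖B y‖ ≤ β)
    (hB' : ‖fderiv ℝ B y‖ ≤ β') (hW₁ : ‖W₁ y‖ ≤ r) (hP₂ : ‖P₂ y‖ ≤ L)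
    (hd : ‖W₁ y - W₂ y‖ ≤ d) (he : ‖P₁ y - P₂ y‖ ≤ e) :
    ‖nonlin' m F B b W₁ P₁ y - nonlin' m F B b W₂ P₂ y‖ ≤
      b * (c * (2 * β + 2 * r) * e + (2 * c * β' + 2 * c * L) * d) := by
  have hr : 0 ≤ r := (norm_nonneg _).trans hW₁
  have hd0 : 0 ≤ d := (norm_nonneg _).trans hd
  have hβ : 0 ≤ β := (norm_nonneg _).trans hB
  have eq : nonlin' m F B b W₁ P₁ y - nonlin' m F B b W₂ P₂ y =
      -- Telescoping of each bilinear term: first the derivatives differ and then the functions, so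
      -- that every summand contains exactly one difference.
      -(b • ((2 : ℝ) • ((m (B y)).comp (P₁ y - P₂ y) +
          (m.flip (W₁ y - W₂ y)).comp (fderiv ℝ B y)) +
        (((m (W₁ y)).comp (P₁ y - P₂ y) + (m (W₁ y - W₂ y)).comp (P₂ y)) +
        ((m.flip (W₁ y)).comp (P₁ y - P₂ y) + (m.flip (W₁ y - W₂ y)).comp (P₂ y))))) := by
    simp only [nonlin', map_sub, ContinuousLinearMap.sub_comp, ContinuousLinearMap.comp_sub]
    module
  have hf := norm_flip_apply_le hc
  have h1 : ‖(m (B y)).comp (P₁ y - P₂ y)‖ ≤ c * β * e :=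
    (norm_comp_le hc hc0 _ _).trans (by gcongr)
  have h2 : ‖(m.flip (W₁ y - W₂ y)).comp (fderiv ℝ B y)‖ ≤ c * d * β' :=
    (norm_comp_le hf hc0 _ _).trans (by gcongr)
  have h3 : ‖(m (W₁ y)).comp (P₁ y - P₂ y)‖ ≤ c * r * e :=
    (norm_comp_le hc hc0 _ _).trans (by gcongr)
  have h4 : ‖(m (W₁ y - W₂ y)).comp (P₂ y)‖ ≤ c * d * L :=
    (norm_comp_le hc hc0 _ _).trans (by gcongr)
  have h5 : ‖(m.flip (W₁ y)).comp (P₁ y - P₂ y)‖ ≤ c * r * e :=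
    (norm_comp_le hf hc0 _ _).trans (by gcongr)
  have h6 : ‖(m.flip (W₁ y - W₂ y)).comp (P₂ y)‖ ≤ c * d * L :=
    (norm_comp_le hf hc0 _ _).trans (by gcongr)
  rw [eq, norm_neg, norm_smul, Real.norm_of_nonneg hb]
  refine mul_le_mul_of_nonneg_left ((norm_add_le _ _).trans ?_) hb
  rw [norm_smul, Real.norm_two]
  have a1 := norm_add_le ((m (B y)).comp (P₁ y - P₂ y)) ((m.flip (W₁ y - W₂ y)).comp (fderiv ℝ B y))
  have a2 := norm_add_le ((m (W₁ y)).comp (P₁ y - P₂ y) + (m (W₁ y - W₂ y)).comp (P₂ y))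
    ((m.flip (W₁ y)).comp (P₁ y - P₂ y) + (m.flip (W₁ y - W₂ y)).comp (P₂ y))
  have a3 := norm_add_le ((m (W₁ y)).comp (P₁ y - P₂ y)) ((m (W₁ y - W₂ y)).comp (P₂ y))
  have a4 := norm_add_le ((m.flip (W₁ y)).comp (P₁ y - P₂ y))
    ((m.flip (W₁ y - W₂ y)).comp (P₂ y))
  linarith

lemma continuous_nonlin (hF : ContDiff ℝ 1 F) (hB : ContDiff ℝ 1 B) {W : Y → X}
    (hW : Continuous W) : Continuous (nonlin m F B b W) := by
  have h1 : Continuous fun y => m (B y) (W y) :=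
    (m.continuous.comp hB.continuous).clm_apply hW
  have h2 : Continuous fun y => m (W y) (W y) := (m.continuous.comp hW).clm_apply hW
  exact hF.continuous.sub (((h1.const_smul (2 : ℝ)).add h2).const_smul b)

lemma continuous_nonlin' (hF : ContDiff ℝ 1 F) (hB : ContDiff ℝ 1 B) {W : Y → X}
    {P : Y → Y →L[ℝ] X} (hW : Continuous W) (hP : Continuous P) :
    Continuous (nonlin' m F B b W P) := by
  have hF' := hF.continuous_fderiv one_ne_zero
  have hB' := hB.continuous_fderiv one_ne_zero
  have h1 : Continuous fun y => (m (B y)).comp (P y) :=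
    (m.continuous.comp hB.continuous).clm_comp hP
  have h2 : Continuous fun y => (m.flip (W y)).comp (fderiv ℝ B y) :=
    (m.flip.continuous.comp hW).clm_comp hB'
  have h3 : Continuous fun y => (m (W y)).comp (P y) := (m.continuous.comp hW).clm_comp hP
  have h4 : Continuous fun y => (m.flip (W y)).comp (P y) :=
    (m.flip.continuous.comp hW).clm_comp hP
  exact hF'.sub ((((h1.add h2).const_smul (2 : ℝ)).add (h3.add h4)).const_smul b)

/-- Pairs of a bounded function `W` and `κ` times its derivative. -/
def c1Pairs (X Y : Type*) [NormedAddCommGroup X] [NormedSpace ℝ X] [NormedAddCommGroup Y]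
    [NormedSpace ℝ Y] (r L κ : ℝ) : Set ((Y →ᵇ X) × (Y →ᵇ (Y →L[ℝ] X))) :=
  {z | (∀ y, ‖z.1 y‖ ≤ r) ∧ (∀ y, ‖z.2 y‖ ≤ κ * L) ∧ ∀ y, HasFDerivAt z.1 (κ⁻¹ • z.2 y) y}

set_option synthInstance.maxHeartbeats 200000 in
-- A uniform limit of functions whose derivatives converge uniformly is differentiable, with the
-- limit as derivative.
lemma isClosed_c1Pairs (r L κ : ℝ) : IsClosed (c1Pairs X Y r L κ) := by
  refine isSeqClosed_iff_isClosed.mp fun z z₀ hz hlim => ?_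
  have h1 : TendstoUniformly (fun n y => (z n).1 y) z₀.1 Filter.atTop :=
    BoundedContinuousFunction.tendsto_iff_tendstoUniformly.mp
      ((continuous_fst.tendsto z₀).comp hlim)
  have h2 : TendstoUniformly (fun n y => κ⁻¹ • (z n).2 y) (fun y => κ⁻¹ • z₀.2 y) Filter.atTop := by
    have : Filter.Tendsto (fun n => κ⁻¹ • (z n).2) Filter.atTop (nhds (κ⁻¹ • z₀.2)) :=
      ((continuous_snd.tendsto z₀).comp hlim).const_smul κ⁻¹
    exact BoundedContinuousFunction.tendsto_iff_tendstoUniformly.mp this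
  have h3 : TendstoUniformly (fun n y => (z n).2 y) z₀.2 Filter.atTop :=
    BoundedContinuousFunction.tendsto_iff_tendstoUniformly.mp
      ((continuous_snd.tendsto z₀).comp hlim)
  refine ⟨fun y => ?_, fun y => ?_, fun y => ?_⟩
  · exact le_of_tendsto (h1.tendsto_at y).norm (Filter.Eventually.of_forall fun n => (hz n).1 y)
  · exact le_of_tendsto (h3.tendsto_at y).norm (Filter.Eventually.of_forall fun n => (hz n).2.1 y)
  · exact hasFDerivAt_of_tendstoUniformlyOn isOpen_univ h2.tendstoUniformlyOn
      (fun n x _ => (hz n).2.2 x) (fun x _ => h1.tendsto_at x) (mem_univ y)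

variable [CompleteSpace X] [FiniteDimensional ℝ Y]
  {K : ℝ → X →L[ℝ] X} {E : ℝ → Y →L[ℝ] Y} {ℓ : ℝ}

/-- The Duhamel map is a contraction on pairs (function, `κ` times its derivative) in the supremum
norm; iterating the derivative along with the function makes the fixed point `C¹` at once. Smallness
is asked only of `β` and `r`. The derivative bounds `f'` and `β'` may be arbitrarily large: they
enter `L` and `κ`, not the hypotheses. -/
theorem exists_invariant_graph (h : IsFlowPair K E ℓ) (hℓ : 0 ≤ ℓ) (hb : ℓ < b)
    (hc : ∀ x y, ‖m x y‖ ≤ c * ‖x‖ * ‖y‖) (hc0 : 0 ≤ c)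
    (hF : ContDiff ℝ 1 F) (hB : ContDiff ℝ 1 B) (hf : ∀ y, ‖F y‖ ≤ f) (hβ : ∀ y, ‖B y‖ ≤ β)
    (hf' : ∀ y, ‖fderiv ℝ F y‖ ≤ f') (hβ' : ∀ y, ‖fderiv ℝ B y‖ ≤ β')
    (hr : 2 * (f * b⁻¹) ≤ r) (hsmall : b * (b - ℓ)⁻¹ * (c * (2 * β + 2 * r)) ≤ 1 / 4) :
    ∃ W : Y → X, ContDiff ℝ 1 W ∧ (∀ y, ‖W y‖ ≤ r) ∧
      ∀ v, W v = duhamel K E b (nonlin m F B b W) v := by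
  have hb0 : 0 < b := hℓ.trans_lt hb
  have hbℓ : 0 < b - ℓ := sub_pos.mpr hb
  have hf0 : 0 ≤ f := (norm_nonneg _).trans (hf 0)
  have hf'0 : 0 ≤ f' := (norm_nonneg _).trans (hf' 0)
  have hβ0 : 0 ≤ β := (norm_nonneg _).trans (hβ 0)
  have hβ'0 : 0 ≤ β' := (norm_nonneg _).trans (hβ' 0)
  have hr0 : 0 ≤ r := le_trans (by positivity) hr
  set γ : ℝ := b * (b - ℓ)⁻¹ with hγ
  have hγ1 : 1 ≤ γ := by
    rw [hγ, ← div_eq_mul_inv, le_div_iff₀ hbℓ]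
    linarith
  set q : ℝ := c * (2 * β + 2 * r) with hq
  have hq0 : 0 ≤ q := by positivity
  have hq1 : q ≤ 1 / 4 := le_trans (le_mul_of_one_le_left hq0 hγ1) hsmall
  -- The new derivative is bounded by `L/2 + γqL ≤ L/2 + L/4`, so the bound `L` is preserved.
  set L : ℝ := 2 * (f' * (b - ℓ)⁻¹ + γ * (2 * c * r * β')) with hL
  have hL0 : 0 ≤ L := by positivity
  set A : ℝ := γ * (2 * c * β' + 2 * c * L) with hA
  have hA0 : 0 ≤ A := by positivity
  -- `A` measures how strongly a change of `W` alone moves the derivative component. The weight `κ`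
  -- reduces this to `κA ≤ 1/4`; together with `γq ≤ 1/4` the contraction constant is `1/2`.
  set κ : ℝ := (4 * A + 1)⁻¹ with hκ
  have hκ0 : 0 < κ := by positivity
  have hκA : κ * A ≤ 1 / 4 := by
    rw [hκ, inv_mul_le_iff₀ (by positivity)]
    linarith
  let S := c1Pairs X Y r L κ
  have hP : ∀ z ∈ S, ∀ y, ‖κ⁻¹ • z.2 y‖ ≤ L := by
    intro z hz y
    rw [norm_smul, Real.norm_of_nonneg (inv_pos.mpr hκ0).le, inv_mul_le_iff₀ hκ0]
    exact hz.2.1 y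
  have hPc : ∀ z : (Y →ᵇ X) × (Y →ᵇ (Y →L[ℝ] X)), Continuous fun y => κ⁻¹ • z.2 y :=
    fun z => z.2.continuous.const_smul κ⁻¹
  have hN : ∀ z ∈ S, ∀ y, ‖nonlin m F B b z.1 y‖ ≤ f + b * (c * (2 * β + r) * r) :=
    fun z hz y => norm_nonlin_le hc hc0 hb0.le (hf y) (hβ y) (hz.1 y)
  have hN' : ∀ z ∈ S, ∀ y, ‖nonlin' m F B b z.1 (fun y => κ⁻¹ • z.2 y) y‖ ≤
      f' + b * (q * L + 2 * c * r * β') :=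
    fun z hz y => norm_nonlin'_le hc hc0 hb0.le (hf' y) (hβ y) (hβ' y) (hz.1 y) (hP z hz y)
  have hcN : ∀ z ∈ S, Continuous (nonlin m F B b z.1) := fun z _ =>
    continuous_nonlin hF hB z.1.continuous
  have hcN' : ∀ z ∈ S, Continuous (nonlin' m F B b z.1 (fun y => κ⁻¹ • z.2 y)) := fun z _ =>
    continuous_nonlin' hF hB z.1.continuous (hPc z)
  have hder : ∀ z ∈ S, ∀ v, HasFDerivAt (duhamel K E b (nonlin m F B b z.1))
      (duhamel' K E b (nonlin' m F B b z.1 (fun y => κ⁻¹ • z.2 y)) v) v := fun z hz v =>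
    h.hasFDerivAt_duhamel hb0 hb (fun y => hasFDerivAt_nonlin hF hB (hz.2.2 y)) (hcN' z hz)
      (hN z hz) (hN' z hz) v
  have hbd : ∀ z ∈ S, ∀ v, ‖duhamel K E b (nonlin m F B b z.1) v‖ ≤ r := by
    intro z hz v
    refine (h.norm_duhamel_le hb0 (hN z hz) v).trans ?_
    have e : (f + b * (c * (2 * β + r) * r)) * b⁻¹ = f * b⁻¹ + c * (2 * β + r) * r := by
      field_simp
    have e2 : c * (2 * β + r) * r ≤ 1 / 4 * r := by
      refine mul_le_mul_of_nonneg_right (le_trans ?_ hq1) hr0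
      rw [hq]
      gcongr
      linarith
    rw [e]
    linarith
  have hbd' : ∀ z ∈ S, ∀ v,
      ‖duhamel' K E b (nonlin' m F B b z.1 (fun y => κ⁻¹ • z.2 y)) v‖ ≤ L := by
    intro z hz v
    refine (h.norm_duhamel'_le hb (hN' z hz) v).trans ?_
    have e : (f' + b * (q * L + 2 * c * r * β')) * (b - ℓ)⁻¹ =
        f' * (b - ℓ)⁻¹ + γ * (2 * c * r * β') + γ * q * L := by
      rw [hγ]
      ring
    have e2 : γ * q * L ≤ 1 / 4 * L := mul_le_mul_of_nonneg_right hsmall hL0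
    rw [e]
    linarith
  have hex : ∀ z : S, ∃ z' : S,
      (∀ v, z'.1.1 v = duhamel K E b (nonlin m F B b z.1.1) v) ∧
      (∀ v, z'.1.2 v = κ • duhamel' K E b (nonlin' m F B b z.1.1 (fun y => κ⁻¹ • z.1.2 y)) v) := by
    rintro ⟨z, hz⟩
    have c1 : Continuous (duhamel K E b (nonlin m F B b z.1)) :=
      continuous_iff_continuousAt.mpr fun v => (hder z hz v).continuousAt
    have c2 : Continuous fun v =>
        κ • duhamel' K E b (nonlin' m F B b z.1 (fun y => κ⁻¹ • z.2 y)) v :=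
      (h.continuous_duhamel' hb (hcN' z hz) (hN' z hz)).const_smul κ
    have b2 : ∀ v, ‖κ • duhamel' K E b (nonlin' m F B b z.1 (fun y => κ⁻¹ • z.2 y)) v‖ ≤
        κ * L := by
      intro v
      rw [norm_smul, Real.norm_of_nonneg hκ0.le]
      exact mul_le_mul_of_nonneg_left (hbd' z hz v) hκ0.le
    refine ⟨⟨(BoundedContinuousFunction.ofNormedAddCommGroup _ c1 r (hbd z hz),
      BoundedContinuousFunction.ofNormedAddCommGroup _ c2 (κ * L) b2), hbd z hz, b2, fun y => ?_⟩,
      fun v => rfl, fun v => rfl⟩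
    change HasFDerivAt (duhamel K E b (nonlin m F B b z.1))
      (κ⁻¹ • κ • duhamel' K E b (nonlin' m F B b z.1 (fun y => κ⁻¹ • z.2 y)) y) y
    rw [inv_smul_smul₀ hκ0.ne']
    exact hder z hz y
  choose Φ hΦ hΦ' using hex
  have hcontr : ContractingWith (1 / 2 : NNReal) Φ := by
    refine ⟨by norm_num, LipschitzWith.of_dist_le_mul fun z₁ z₂ => ?_⟩
    set d := dist z₁ z₂ with hd
    have hd0 : 0 ≤ d := dist_nonneg
    have d1 : ∀ y, ‖z₁.1.1 y - z₂.1.1 y‖ ≤ d := fun y => by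
      rw [← dist_eq_norm]
      exact (BoundedContinuousFunction.dist_coe_le_dist y).trans (le_max_left _ _)
    have d2 : ∀ y, ‖κ⁻¹ • z₁.1.2 y - κ⁻¹ • z₂.1.2 y‖ ≤ κ⁻¹ * d := fun y => by
      rw [← smul_sub, norm_smul, Real.norm_of_nonneg (inv_pos.mpr hκ0).le, ← dist_eq_norm]
      exact mul_le_mul_of_nonneg_left ((BoundedContinuousFunction.dist_coe_le_dist y).trans
        (le_max_right _ _)) (inv_pos.mpr hκ0).le
    have hhalf : ((1 / 2 : NNReal) : ℝ) = 1 / 2 := by norm_num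
    rw [hhalf]
    refine max_le ?_ ?_
    · refine (BoundedContinuousFunction.dist_le (by positivity)).mpr fun v => ?_
      rw [hΦ, hΦ, dist_eq_norm,
        h.duhamel_sub hb0 (hcN _ z₁.2) (hcN _ z₂.2) (hN _ z₁.2) (hN _ z₂.2)]
      refine (h.norm_duhamel_le hb0 (fun y => norm_nonlin_sub_le hc hc0 hb0.le (hβ y) (z₁.2.1 y)
        (z₂.2.1 y) (d1 y)) v).trans ?_
      have e : b * (q * d) * b⁻¹ = q * d := by field_simp
      rw [e]
      have := mul_le_mul_of_nonneg_right hq1 hd0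
      linarith
    · refine (BoundedContinuousFunction.dist_le (by positivity)).mpr fun v => ?_
      rw [hΦ', hΦ', dist_eq_norm, ← smul_sub,
        h.duhamel'_sub hb (hcN' _ z₁.2) (hcN' _ z₂.2) (hN' _ z₁.2) (hN' _ z₂.2), norm_smul,
        Real.norm_of_nonneg hκ0.le]
      refine (mul_le_mul_of_nonneg_left (h.norm_duhamel'_le hb (fun y =>
        norm_nonlin'_sub_le (P₁ := fun y => κ⁻¹ • z₁.1.2 y) (P₂ := fun y => κ⁻¹ • z₂.1.2 y)
          hc hc0 hb0.le (hβ y) (hβ' y) (z₁.2.1 y) (hP _ z₂.2 y) (d1 y) (d2 y)) v)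
        hκ0.le).trans ?_
      have e : κ * (b * (q * (κ⁻¹ * d) + (2 * c * β' + 2 * c * L) * d) * (b - ℓ)⁻¹) =
          γ * q * d + κ * A * d := by
        rw [hA, hγ]
        field_simp
      rw [e]
      have e1 := mul_le_mul_of_nonneg_right hsmall hd0
      have e2 := mul_le_mul_of_nonneg_right hκA hd0
      linarith
  have : CompleteSpace S := (isClosed_c1Pairs r L κ).completeSpace_coe
  have h0 : (0 : (Y →ᵇ X) × (Y →ᵇ (Y →L[ℝ] X))) ∈ S := by
    refine ⟨fun y => by simpa using hr0, fun y => ?_, fun y => ?_⟩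
    · have : 0 ≤ κ * L := by positivity
      simpa using this
    · change HasFDerivAt (fun _ : Y => (0 : X)) (κ⁻¹ • (0 : Y →L[ℝ] X)) y
      rw [smul_zero]
      exact hasFDerivAt_const 0 y
  obtain ⟨z, hΦz, -⟩ := hcontr.exists_fixedPoint ⟨0, h0⟩ (edist_ne_top _ _)
  have hΦz : Φ z = z := hΦz
  refine ⟨z.1.1, ?_, z.2.1, fun v => ?_⟩
  · refine contDiff_one_iff_hasFDerivAt.mpr ⟨fun y => κ⁻¹ • z.1.2 y, hPc z.1, z.2.2.2⟩
  · have := hΦ z v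
    rwa [hΦz] at this

end FixedPoint

end

end FastReaction

namespace FastReaction

noncomputable section

/-! ### Forward and backward uniqueness -/

section Uniqueness

variable {H : Type*} [NormedAddCommGroup H] [InnerProductSpace ℝ H]

/-- `z' = A + g` on `[a, b]`, where `A = 𝒜 z` for a symmetric nonpositive operator `𝒜` and `g` is
bounded by a multiple of `z`. -/
structure IsPerturbedFlow (z A g : ℝ → H) (a b M : ℝ) : Prop where
  hasDeriv : ∀ t ∈ Icc a b, HasDerivWithinAt z (A t + g t) (Icc a b) t
  continuousOn : ContinuousOn A (Icc a b)
  symm : ∀ s t, inner ℝ (A s) (z t) = inner ℝ (z s) (A t)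
  nonpos : ∀ t, inner ℝ (A t) (z t) ≤ 0
  bound : ∀ t ∈ Icc a b, ‖g t‖ ≤ M * ‖z t‖

namespace IsPerturbedFlow

variable {z A g : ℝ → H} {a b M : ℝ}

lemma continuousOn_left (h : IsPerturbedFlow z A g a b M) : ContinuousOn z (Icc a b) :=
  fun t ht => (h.hasDeriv t ht).continuousWithinAt

lemma hasDerivWithinAt_normSq (h : IsPerturbedFlow z A g a b M) {t : ℝ} (ht : t ∈ Icc a b) :
    HasDerivWithinAt (fun s => ‖z s‖ ^ 2) (2 * inner ℝ (z t) (A t + g t)) (Icc a b) t :=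
  (h.hasDeriv t ht).norm_sq

/-- `A` is only continuous, so the product rule is not available. By symmetry, `⟨A s, z s⟩ - ⟨A t, z
t⟩ = ⟨A s + A t, z s - z t⟩`, and the difference quotient converges using the derivative of `z`
alone. -/
lemma hasDerivWithinAt_energy (h : IsPerturbedFlow z A g a b M) {t : ℝ} (ht : t ∈ Icc a b) :
    HasDerivWithinAt (fun s => -inner ℝ (A s) (z s)) (-(2 * inner ℝ (A t) (A t + g t)))
      (Icc a b) t := by
  rw [hasDerivWithinAt_iff_tendsto_slope]
  have h1 := hasDerivWithinAt_iff_tendsto_slope.mp (h.hasDeriv t ht)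
  have h2 : Filter.Tendsto (fun s => A s + A t) (nhdsWithin t (Icc a b \ {t}))
      (nhds (A t + A t)) :=
    (((h.continuousOn t ht).mono sdiff_subset).tendsto).add_const _
  have h3 := (h2.inner (𝕜 := ℝ) h1).neg
  have e : -(2 * inner ℝ (A t) (A t + g t)) = -inner ℝ (A t + A t) (A t + g t) := by
    rw [inner_add_left (A t) (A t)]
    ring
  rw [e]
  refine h3.congr fun s => ?_
  rw [slope_def_module, slope_def_module, inner_smul_right, smul_eq_mul, inner_sub_right,
    inner_add_left, inner_add_left, h.symm s t, real_inner_comm (A t) (z s)]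
  ring

lemma abs_inner_le (h : IsPerturbedFlow z A g a b M) {t : ℝ} (ht : t ∈ Icc a b) :
    |inner ℝ (z t) (g t)| ≤ M * ‖z t‖ ^ 2 := by
  refine (abs_real_inner_le_norm _ _).trans ?_
  have := mul_le_mul_of_nonneg_left (h.bound t ht) (norm_nonneg (z t))
  linarith

/-- Grönwall for the energy: `exp (-2Mt) ‖z‖²` is nonincreasing. -/
lemma forward (h : IsPerturbedFlow z A g a b M) (h0 : z a = 0) : ∀ t ∈ Icc a b, z t = 0 := by
  have hd : ∀ t ∈ Icc a b, HasDerivWithinAt (fun s => Real.exp (-(2 * M) * s) * ‖z s‖ ^ 2)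
      (Real.exp (-(2 * M) * t) * (-(2 * M)) * ‖z t‖ ^ 2 + Real.exp (-(2 * M) * t) *
        (2 * inner ℝ (z t) (A t + g t))) (Icc a b) t := fun t ht => by
    have h1 : HasDerivAt (fun s => Real.exp (-(2 * M) * s))
        (Real.exp (-(2 * M) * t) * (-(2 * M))) t := by
      simpa using ((hasDerivAt_id t).const_mul (-(2 * M))).exp
    exact h1.hasDerivWithinAt.mul (h.hasDerivWithinAt_normSq ht)
  have hanti : AntitoneOn (fun s => Real.exp (-(2 * M) * s) * ‖z s‖ ^ 2) (Icc a b) := by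
    refine antitoneOn_of_deriv_nonpos (convex_Icc a b)
      (fun t ht => (hd t ht).continuousWithinAt) (fun t ht => ?_) fun t ht => ?_
    · exact (((hd t (interior_subset ht)).hasDerivAt
        (mem_interior_iff_mem_nhds.mp ht)).differentiableAt).differentiableWithinAt
    · have ht' := interior_subset ht
      rw [((hd t ht').hasDerivAt (mem_interior_iff_mem_nhds.mp ht)).deriv, inner_add_right]
      have h1 := h.nonpos t
      rw [real_inner_comm] at h1
      have h2 := (abs_le.mp (h.abs_inner_le ht')).2
      have h3 := mul_nonpos_of_nonneg_of_nonpos (Real.exp_pos (-(2 * M) * t)).le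
        (show 2 * (inner ℝ (z t) (A t) + inner ℝ (z t) (g t)) - 2 * M * ‖z t‖ ^ 2 ≤ 0 by linarith)
      linarith
  intro t ht
  have h1 := hanti (left_mem_Icc.mpr (ht.1.trans ht.2)) ht ht.1
  simp only [h0, norm_zero] at h1
  have h2 : ‖z t‖ ^ 2 ≤ 0 := by
    have h3 := Real.exp_pos (-(2 * M) * t)
    have h4 : Real.exp (-(2 * M) * t) * ‖z t‖ ^ 2 ≤ 0 := by simpa using h1
    exact nonpos_of_mul_nonpos_right h4 h3
  have h3 : ‖z t‖ = 0 := by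
    have := le_antisymm h2 (sq_nonneg _)
    exact pow_eq_zero_iff two_ne_zero |>.mp this
  exact norm_eq_zero.mp h3

/-- The left side is the derivative of the Dirichlet quotient `d/e`. The vector `y = eA + dz` is
orthogonal to `z`; up to the factor `e`, the numerator is `-2‖y‖² - 2e⟨y, g⟩`, and completing the
square bounds it by `e²‖g‖²/2`. -/
lemma quotient_bound (h : IsPerturbedFlow z A g a b M) {t : ℝ} (ht : t ∈ Icc a b) (hz : z t ≠ 0) :
    (-(2 * inner ℝ (A t) (A t + g t)) * ‖z t‖ ^ 2 -
      -inner ℝ (A t) (z t) * (2 * inner ℝ (z t) (A t + g t))) / (‖z t‖ ^ 2) ^ 2 ≤ M ^ 2 / 2 := by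
  set e : ℝ := ‖z t‖ ^ 2 with he
  set d : ℝ := -inner ℝ (A t) (z t) with hd
  have he0 : 0 < e := by positivity
  set y : H := e • A t + d • z t with hy
  have h1 : ‖y‖ ^ 2 = e ^ 2 * ‖A t‖ ^ 2 - d ^ 2 * e := by
    rw [hy, norm_add_sq_real, norm_smul, norm_smul, mul_pow, mul_pow, inner_smul_left,
      inner_smul_right, Real.norm_eq_abs, Real.norm_eq_abs, sq_abs, sq_abs, ← he]
    have : inner ℝ (A t) (z t) = -d := by rw [hd]; ring
    rw [this]
    simp only [conj_trivial]
    ring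
  have h2 : inner ℝ y (g t) = e * inner ℝ (A t) (g t) + d * inner ℝ (z t) (g t) := by
    rw [hy, inner_add_left, inner_smul_left, inner_smul_left]
    simp only [conj_trivial]
  have h3 : e * (-(2 * inner ℝ (A t) (A t + g t)) * e - d * (2 * inner ℝ (z t) (A t + g t))) =
      -2 * ‖y‖ ^ 2 - 2 * e * inner ℝ y (g t) := by
    rw [h1, h2, inner_add_right, inner_add_right, real_inner_self_eq_norm_sq,
      real_inner_comm (A t) (z t)]
    have : inner ℝ (A t) (z t) = -d := by rw [hd]; ring
    rw [this]
    ring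
  have h4 : -(‖y‖ * ‖g t‖) ≤ inner ℝ y (g t) := (abs_le.mp (abs_real_inner_le_norm _ _)).1
  have h5 : ‖g t‖ ^ 2 ≤ M ^ 2 * e := by
    rw [he, ← mul_pow]
    exact pow_le_pow_left₀ (norm_nonneg _) (h.bound t ht) 2
  have h6 : e * (-(2 * inner ℝ (A t) (A t + g t)) * e - d * (2 * inner ℝ (z t) (A t + g t))) ≤
      e * (M ^ 2 / 2 * e ^ 2) := by
    rw [h3]
    have h7 := mul_le_mul_of_nonneg_left h4 he0.le
    have h8 := mul_le_mul_of_nonneg_left h5 (sq_nonneg e)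
    nlinarith [sq_nonneg (2 * ‖y‖ - e * ‖g t‖)]
  rw [div_le_iff₀ (by positivity)]
  exact le_of_mul_le_mul_left h6 he0

/-- If `z a ≠ 0`, the Dirichlet quotient stays bounded up to the first zero of `z`, since its
derivative is at most `M²/2`. Then `‖z‖²` decays at most exponentially there and cannot reach zero.
-/
lemma backward (h : IsPerturbedFlow z A g a b M) (hab : a ≤ b) (hb : z b = 0) : z a = 0 := by
  by_contra ha
  have hclosed : IsCompact (Icc a b ∩ z ⁻¹' {0}) :=
    isCompact_Icc.of_isClosed_subset
      (h.continuousOn_left.preimage_isClosed_of_isClosed isClosed_Icc isClosed_singleton)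
      inter_subset_left
  obtain ⟨c, ⟨hc, hzc⟩, hleast⟩ := hclosed.exists_isLeast ⟨b, right_mem_Icc.mpr hab, hb⟩
  have hzc : z c = 0 := hzc
  have hac : a < c := lt_of_le_of_ne hc.1 fun e => ha (e ▸ hzc)
  have hsub : Icc a c ⊆ Icc a b := Icc_subset_Icc_right hc.2
  have hne : ∀ t ∈ Ico a c, z t ≠ 0 := fun t ht hzt =>
    absurd (hleast ⟨hsub ⟨ht.1, ht.2.le⟩, hzt⟩) (not_le.mpr ht.2)
  have hnhds : ∀ t ∈ Ioo a c, Icc a b ∈ nhds t := fun t ht =>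
    Filter.mem_of_superset (Ioo_mem_nhds ht.1 ht.2) (Ioo_subset_Icc_self.trans hsub)
  have hicc : ∀ t ∈ Ioo a c, t ∈ Icc a b := fun t ht => hsub ⟨ht.1.le, ht.2.le⟩
  set Q : ℝ → ℝ := fun t => -inner ℝ (A t) (z t) / ‖z t‖ ^ 2 - M ^ 2 / 2 * t with hQ
  have hQd : ∀ t ∈ Ico a c, HasDerivWithinAt Q
      ((-(2 * inner ℝ (A t) (A t + g t)) * ‖z t‖ ^ 2 -
        -inner ℝ (A t) (z t) * (2 * inner ℝ (z t) (A t + g t))) / (‖z t‖ ^ 2) ^ 2 - M ^ 2 / 2)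
      (Icc a b) t := fun t ht => by
    have ht' := hsub ⟨ht.1, ht.2.le⟩
    have hz := hne t ht
    refine ((h.hasDerivWithinAt_energy ht').div (h.hasDerivWithinAt_normSq ht')
      (by positivity)).sub ?_
    simpa using ((hasDerivAt_id t).const_mul (M ^ 2 / 2)).hasDerivWithinAt
  have hQanti : AntitoneOn Q (Ico a c) := by
    refine antitoneOn_of_deriv_nonpos (convex_Ico a c)
      (fun t ht => (hQd t ht).continuousWithinAt.mono (Ico_subset_Icc_self.trans hsub)) ?_ ?_
    · rw [interior_Ico]
      exact fun t ht => ((hQd t ⟨ht.1.le, ht.2⟩).hasDerivAt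
        (hnhds t ht)).differentiableAt.differentiableWithinAt
    · rw [interior_Ico]
      intro t ht
      rw [((hQd t ⟨ht.1.le, ht.2⟩).hasDerivAt (hnhds t ht)).deriv]
      exact sub_nonpos.mpr (h.quotient_bound (hicc t ht) (hne t ⟨ht.1.le, ht.2⟩))
  set k : ℝ := Q a + M ^ 2 / 2 * c with hk
  have hD : ∀ t ∈ Ioo a c, -inner ℝ (A t) (z t) ≤ k * ‖z t‖ ^ 2 := fun t ht => by
    have h1 := hQanti (left_mem_Ico.mpr hac) ⟨ht.1.le, ht.2⟩ ht.1.le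
    have h2 : -inner ℝ (A t) (z t) / ‖z t‖ ^ 2 ≤ k := by
      have h3 : Q t = -inner ℝ (A t) (z t) / ‖z t‖ ^ 2 - M ^ 2 / 2 * t := rfl
      have h4 := mul_le_mul_of_nonneg_left ht.2.le (show 0 ≤ M ^ 2 / 2 by positivity)
      rw [hk]
      linarith
    have hz := hne t ⟨ht.1.le, ht.2⟩
    rwa [div_le_iff₀ (by positivity)] at h2
  have hd : ∀ t ∈ Icc a c, HasDerivWithinAt (fun s => Real.exp (2 * (k + M) * s) * ‖z s‖ ^ 2)
      (Real.exp (2 * (k + M) * t) * (2 * (k + M)) * ‖z t‖ ^ 2 + Real.exp (2 * (k + M) * t) *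
        (2 * inner ℝ (z t) (A t + g t))) (Icc a b) t := fun t ht => by
    have h1 : HasDerivAt (fun s => Real.exp (2 * (k + M) * s))
        (Real.exp (2 * (k + M) * t) * (2 * (k + M))) t := by
      simpa using ((hasDerivAt_id t).const_mul (2 * (k + M))).exp
    exact h1.hasDerivWithinAt.mul (h.hasDerivWithinAt_normSq (hsub ht))
  -- The quotient bound `k` controls the dissipation and `M` the perturbation; monotonicity up to
  -- the closed endpoint `c` contradicts `z c = 0`.
  have hmono : MonotoneOn (fun s => Real.exp (2 * (k + M) * s) * ‖z s‖ ^ 2) (Icc a c) := by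
    refine monotoneOn_of_deriv_nonneg (convex_Icc a c)
      (fun t ht => (hd t ht).continuousWithinAt.mono hsub) ?_ ?_
    · rw [interior_Icc]
      exact fun t ht => ((hd t ⟨ht.1.le, ht.2.le⟩).hasDerivAt
        (hnhds t ht)).differentiableAt.differentiableWithinAt
    · rw [interior_Icc]
      intro t ht
      rw [((hd t ⟨ht.1.le, ht.2.le⟩).hasDerivAt (hnhds t ht)).deriv, inner_add_right]
      have h1 := hD t ht
      rw [real_inner_comm] at h1
      have h2 := (abs_le.mp (h.abs_inner_le (hicc t ht))).1
      have h3 := mul_nonneg (Real.exp_pos (2 * (k + M) * t)).le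
        (show 0 ≤ 2 * (k + M) * ‖z t‖ ^ 2 + 2 * (inner ℝ (z t) (A t) + inner ℝ (z t) (g t)) by
          linarith)
      linarith
  have h1 := hmono (left_mem_Icc.mpr hac.le) (right_mem_Icc.mpr hac.le) hac.le
  simp only [hzc, norm_zero] at h1
  have h2 : 0 < Real.exp (2 * (k + M) * a) * ‖z a‖ ^ 2 := by positivity
  have h3 : Real.exp (2 * (k + M) * a) * ‖z a‖ ^ 2 ≤ 0 := by simpa using h1
  linarith

end IsPerturbedFlow

end Uniqueness

/-! ### Uniqueness for the fast equation -/

/-- Polarization: a real isometry into a complex Hilbert space preserves the real part of the inner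
product. -/
lemma inner_L2_eq (f g : L2) :
    inner ℝ f g = (inner ℂ (coeffL2 f) (coeffL2 g) : ℂ).re := by
  have h1 := real_inner_eq_norm_add_mul_self_sub_norm_mul_self_sub_norm_mul_self_div_two f g
  have h2 := re_inner_eq_norm_add_mul_self_sub_norm_mul_self_sub_norm_mul_self_div_two (𝕜 := ℂ)
    (coeffL2 f) (coeffL2 g)
  rw [← map_add, LinearIsometry.norm_map, LinearIsometry.norm_map, LinearIsometry.norm_map] at h2
  rw [h1, ← h2]
  rfl

lemma hasSum_inner_L2 (f g : L2) :
    HasSum (fun k => (inner ℂ (coeffL2 f k) (coeffL2 g k) : ℂ).re) (inner ℝ f g) := by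
  rw [inner_L2_eq]
  exact Complex.reCLM.hasSum (lp.hasSum_inner (𝕜 := ℂ) (coeffL2 f) (coeffL2 g))

lemma inner_lap_symm (u w : H2) : inner ℝ (lap u) (embL2 w) = inner ℝ (embL2 u) (lap w) := by
  refine (hasSum_inner_L2 _ _).unique ?_
  convert hasSum_inner_L2 (embL2 u) (lap w) using 1
  funext k
  rw [coeffL2_lap, coeffL2_embL2, coeffL2_lap, coeffL2_embL2, RCLike.inner_apply,
    RCLike.inner_apply]
  simp only [map_mul, map_neg, map_pow, map_intCast]
  congr 1
  ring

lemma inner_lap_nonpos (u : H2) : inner ℝ (lap u) (embL2 u) ≤ 0 := by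
  refine (hasSum_inner_L2 _ _).nonpos fun k => ?_
  rw [coeffL2_lap, coeffL2_embL2, RCLike.inner_apply]
  have e : coeff (toCont u) k * (starRingEnd ℂ) (-(k : ℂ) ^ 2 * coeff (toCont u) k) =
      ((-(k : ℝ) ^ 2 * Complex.normSq (coeff (toCont u) k) : ℝ) : ℂ) := by
    simp only [map_mul, map_neg, map_pow, map_intCast]
    push_cast
    rw [← Complex.mul_conj]
    ring
  rw [e, Complex.ofReal_re]
  exact mul_nonpos_of_nonpos_of_nonneg (by nlinarith [sq_nonneg (k : ℝ)]) (Complex.normSq_nonneg _)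

lemma norm_toL2_mul_le (p f : C(Torus, ℝ)) : ‖toL2 (p * f)‖ ≤ ‖p‖ * ‖toL2 f‖ := by
  refine Lp.norm_le_mul_norm_of_ae_le_mul ?_
  filter_upwards [ContinuousMap.coeFn_toLp (𝕜 := ℝ) (p := 2) haar f,
    ContinuousMap.coeFn_toLp (𝕜 := ℝ) (p := 2) haar (p * f)] with x h1 h2
  rw [toL2, toL2, h1, h2, ContinuousMap.mul_apply, norm_mul]
  exact mul_le_mul_of_nonneg_right (p.norm_coe_le_norm x) (norm_nonneg _)

/-- `u` solves the fast equation on `[a, b]` for the given `v`. -/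
structure SolvesFast (ε a b : ℝ) (u v : ℝ → H2) : Prop where
  continuousOn : ContinuousOn u (Icc a b)
  eq : ∀ t ∈ Icc a b, HasDerivWithinAt (fun s => embL2 (u s))
    (lap (u t) + ε⁻¹ • toL2 (toCont (v t) ^ 2 - toCont (u t) * (toCont (u t) + 1))) (Icc a b) t

/-- The reaction terms of two solutions with the same `v` differ by multiplication of `u₁ - u₂` by
`-ε⁻¹(1 + u₁ + u₂)`, which is bounded because `H²` embeds in the continuous functions and the time
interval is compact. -/
lemma SolvesFast.exists_isPerturbedFlow {ε a b : ℝ} {u₁ u₂ v : ℝ → H2}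
    (h₁ : SolvesFast ε a b u₁ v) (h₂ : SolvesFast ε a b u₂ v) :
    ∃ g M, IsPerturbedFlow (fun t => embL2 (u₁ t - u₂ t)) (fun t => lap (u₁ t - u₂ t)) g a b M := by
  set p : ℝ → C(Torus, ℝ) := fun t => -(ε⁻¹ • (1 + toCont (u₁ t) + toCont (u₂ t))) with hp
  have hpc : ContinuousOn p (Icc a b) :=
    (((continuousOn_const.add (toContL.continuous.comp_continuousOn h₁.continuousOn)).add
      (toContL.continuous.comp_continuousOn h₂.continuousOn)).const_smul ε⁻¹).neg
  obtain ⟨M, hM⟩ := isCompact_Icc.exists_bound_of_continuousOn hpc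
  refine ⟨fun t => toL2 (p t * toCont (u₁ t - u₂ t)), M, ?_, ?_, ?_, ?_, ?_⟩
  · intro t ht
    have h := (h₁.eq t ht).sub (h₂.eq t ht)
    have e : (fun s => embL2 (u₁ s - u₂ s)) = (fun s => embL2 (u₁ s)) - fun s => embL2 (u₂ s) := by
      funext s
      exact map_sub _ _ _
    rw [e]
    refine h.congr_deriv ?_
    rw [map_sub, ← toL2L_apply, ← toL2L_apply, ← toL2L_apply, ← map_smul, ← map_smul]
    have e2 : p t * toCont (u₁ t - u₂ t) =
        ε⁻¹ • (toCont (v t) ^ 2 - toCont (u₁ t) * (toCont (u₁ t) + 1)) -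
        ε⁻¹ • (toCont (v t) ^ 2 - toCont (u₂ t) * (toCont (u₂ t) + 1)) := by
      rw [hp, map_sub, ← smul_sub]
      simp only
      rw [neg_mul, smul_mul_assoc, ← smul_neg]
      congr 1
      ring
    rw [e2, map_sub]
    abel
  · exact lap.continuous.comp_continuousOn (h₁.continuousOn.sub h₂.continuousOn)
  · exact fun s t => inner_lap_symm _ _
  · exact fun t => inner_lap_nonpos _
  · intro t ht
    exact (norm_toL2_mul_le _ _).trans (mul_le_mul_of_nonneg_right (hM t ht) (norm_nonneg _))

lemma SolvesFast.eq_of_left {ε a b : ℝ} {u₁ u₂ v : ℝ → H2} (h₁ : SolvesFast ε a b u₁ v)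
    (h₂ : SolvesFast ε a b u₂ v) (h0 : u₁ a = u₂ a) : ∀ t ∈ Icc a b, u₁ t = u₂ t := by
  obtain ⟨g, M, h⟩ := h₁.exists_isPerturbedFlow h₂
  intro t ht
  have h1 := h.forward (by simp [h0]) t ht
  rw [map_sub] at h1
  exact embL2_injective (sub_eq_zero.mp h1)

lemma SolvesFast.eq_of_right {ε a b : ℝ} {u₁ u₂ v : ℝ → H2} (h₁ : SolvesFast ε a b u₁ v)
    (h₂ : SolvesFast ε a b u₂ v) (hab : a ≤ b) (h0 : u₁ b = u₂ b) : u₁ a = u₂ a := by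
  obtain ⟨g, M, h⟩ := h₁.exists_isPerturbedFlow h₂
  have h1 := h.backward hab (by simp [h0])
  rw [map_sub] at h1
  exact embL2_injective (sub_eq_zero.mp h1)

end

end FastReaction

namespace FastReaction

noncomputable section

/-! ### The scalar equation on the whole past -/

/-- The substitution `τ = t - s` moves `t` out of `n` into the endpoint of the integral and the
prefactor `exp (-μt)`, so `n` need only be continuous. -/
lemma hasDerivAt_past_integral {μ M : ℝ} (hμ : 0 < μ) {n : ℝ → ℂ} (hn : Continuous n)
    (hM : ∀ t, ‖n t‖ ≤ M) (t : ℝ) :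
    HasDerivAt (fun t => ∫ s in Ioi (0 : ℝ), Real.exp (-μ * s) • n (t - s))
      (-μ • (∫ s in Ioi (0 : ℝ), Real.exp (-μ * s) • n (t - s)) + n t) t := by
  have hc : Continuous fun τ => Real.exp (μ * τ) • n τ := by fun_prop
  have hint : ∀ t, IntegrableOn (fun τ => Real.exp (μ * τ) • n τ) (Iic t) := fun t => by
    refine Integrable.mono' ((integrableOn_exp_mul_Iic hμ t).const_mul M)
      hc.aestronglyMeasurable (Filter.Eventually.of_forall fun τ => ?_)
    rw [norm_smul, Real.norm_of_nonneg (Real.exp_pos _).le, mul_comm]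
    exact mul_le_mul_of_nonneg_right (hM τ) (Real.exp_pos _).le
  have e1 : ∀ t, ∫ s in Ioi (0 : ℝ), Real.exp (-μ * s) • n (t - s) =
      Real.exp (-μ * t) • ∫ τ in Iic t, Real.exp (μ * τ) • n τ := fun t => by
    rw [integral_Iic_eq_integral_Iio, ← integral_indicator measurableSet_Ioi,
      ← integral_sub_left_eq_self _ volume t, ← integral_smul, ← integral_indicator measurableSet_Iio]
    congr 1
    funext τ
    by_cases hτ : τ < t
    · rw [indicator_of_mem (show t - τ ∈ Ioi (0 : ℝ) from sub_pos.mpr hτ),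
        indicator_of_mem (show τ ∈ Iio t from hτ), smul_smul, ← Real.exp_add, sub_sub_cancel]
      congr 2
      ring
    · rw [indicator_of_notMem (show t - τ ∉ Ioi (0 : ℝ) from fun h => hτ (sub_pos.mp h)),
        indicator_of_notMem (show τ ∉ Iio t from hτ)]
  have e2 : ∀ t, ∫ τ in Iic t, Real.exp (μ * τ) • n τ =
      (∫ τ in Iic (0 : ℝ), Real.exp (μ * τ) • n τ) + ∫ τ in (0 : ℝ)..t, Real.exp (μ * τ) • n τ :=
    fun t => by
    rw [← intervalIntegral.integral_Iic_sub_Iic (hint 0) (hint t)]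
    abel
  have d1 : HasDerivAt (fun t => ∫ τ in Iic t, Real.exp (μ * τ) • n τ)
      (Real.exp (μ * t) • n t) t := by
    rw [funext e2]
    exact (intervalIntegral.integral_hasDerivAt_right (hc.intervalIntegrable _ _)
      hc.stronglyMeasurable.stronglyMeasurableAtFilter hc.continuousAt).const_add _
  have d2 : HasDerivAt (fun t => Real.exp (-μ * t)) (Real.exp (-μ * t) * -μ) t := by
    simpa using ((hasDerivAt_id t).const_mul (-μ)).exp
  rw [funext e1]
  refine (d2.smul d1).congr_deriv ?_
  rw [smul_smul, ← Real.exp_add, show -μ * t + μ * t = 0 by ring, Real.exp_zero, one_smul,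
    e1, smul_smul, mul_comm (-μ) (Real.exp (-μ * t)), add_comm]

/-! ### The Duhamel integral along the slow flow -/

variable {k₀ : ℕ}

variable (k₀) in
/-- The slow flow backward in time. -/
def backFlow (s : ℝ) : slowSpace k₀ →L[ℝ] slowSpace k₀ := flow k₀ (-s)

variable (k₀) in
lemma isFlowPair_heat : IsFlowPair heat (backFlow k₀) ((k₀ : ℝ) ^ 2) where
  continuous_left := continuous_heat
  norm_left_le := norm_heat_le
  continuous_right y := (continuous_flow_apply y).comp continuous_neg
  norm_right_le s hs := by
    have := norm_flow_le (k₀ := k₀) (-s)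
    rwa [abs_neg, abs_of_nonneg hs] at this

/-- The Fourier coefficient as a functional on `H²`. -/
def coeffL (k : ℤ) : H2 →L[ℝ] ℂ :=
  (lp.evalCLM ℝ (fun _ : ℤ => ℂ) 2 k).comp
    (coeffL2.toContinuousLinearMap.comp embL2)

lemma coeffL_apply (k : ℤ) (u : H2) : coeffL k u = coeff (toCont u) k := coeffL2_embL2 u k

/-- On each mode the heat factor merges with the kernel into `exp (-(b + k²)s)`, and the group
property turns the backward flow of the point at time `t` into the point at time `t - s`. The scalar
lemma then applies mode by mode. The derivative is taken in `L²`, where `Δ` of an `H²` function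
lies. -/
lemma hasDerivAt_duhamel_flow {G : slowSpace k₀ → H2} (hG : Continuous G) {M b : ℝ} (hb : 0 < b)
    (hM : ∀ y, ‖G y‖ ≤ M) (hc : Continuous (duhamel heat (backFlow k₀) b G)) (v₀ : slowSpace k₀)
    (t : ℝ) :
    HasDerivAt (fun t => embL2 (duhamel heat (backFlow k₀) b G (flow k₀ t v₀)))
      (lap (duhamel heat (backFlow k₀) b G (flow k₀ t v₀)) +
        embL2 (G (flow k₀ t v₀) - b • duhamel heat (backFlow k₀) b G (flow k₀ t v₀))) t := by
  set D := duhamel heat (backFlow k₀) b G with hD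
  have hf : Continuous fun t => flow k₀ t v₀ := continuous_flow_apply v₀
  have hDf : Continuous fun t => D (flow k₀ t v₀) := hc.comp hf
  have hGf : Continuous fun t => G (flow k₀ t v₀) := hG.comp hf
  have e : ∀ k t, coeff (toCont (D (flow k₀ t v₀))) k =
      ∫ s in Ioi (0 : ℝ), Real.exp (-(b + (k : ℝ) ^ 2) * s) • coeffL k (G (flow k₀ (t - s) v₀)) := by
    intro k t
    rw [← coeffL_apply, hD, duhamel,
      ← (coeffL k).integral_comp_comm ((isFlowPair_heat k₀).integrable hb hG hM _)]
    refine setIntegral_congr_fun measurableSet_Ioi fun s hs => ?_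
    have hs : max s 0 = s := max_eq_left (le_of_lt hs)
    simp only [duhamelIntegrand]
    rw [map_smul, coeffL_apply, coeff_heat, hs, backFlow, ← flow_add, coeffL_apply,
      show -s + t = t - s by ring, ← Complex.real_smul, smul_smul, ← Real.exp_add]
    congr 2
    ring
  refine hasDerivAt_of_isometry coeffL2 (hasDerivAt_ell (g := fun t => coeffL2
    (lap (D (flow k₀ t v₀)) + embL2 (G (flow k₀ t v₀) - b • D (flow k₀ t v₀)))) ?_ ?_ t)
  · exact coeffL2.continuous.comp ((lap.continuous.comp hDf).add
      (embL2.continuous.comp (hGf.sub (hDf.const_smul b))))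
  · intro k t
    have hμ : 0 < b + (k : ℝ) ^ 2 := by positivity
    have h1 := hasDerivAt_past_integral hμ
      (n := fun t => coeffL k (G (flow k₀ t v₀))) ((coeffL k).continuous.comp hGf)
      (M := ‖coeffL k‖ * M) (fun t => ((coeffL k).le_opNorm _).trans
        (mul_le_mul_of_nonneg_left (hM _) (norm_nonneg _))) t
    have e2 : (fun s => (coeffL2 (embL2 (D (flow k₀ s v₀))) : ℤ → ℂ) k) = fun t =>
        ∫ s in Ioi (0 : ℝ), Real.exp (-(b + (k : ℝ) ^ 2) * s) • coeffL k (G (flow k₀ (t - s) v₀)) := by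
      funext t
      rw [coeffL2_embL2, e]
    have e3 : (coeffL2 (lap (D (flow k₀ t v₀)) +
        embL2 (G (flow k₀ t v₀) - b • D (flow k₀ t v₀))) : ℤ → ℂ) k =
        -(b + (k : ℝ) ^ 2) • (∫ s in Ioi (0 : ℝ), Real.exp (-(b + (k : ℝ) ^ 2) * s) •
          coeffL k (G (flow k₀ (t - s) v₀))) + coeffL k (G (flow k₀ t v₀)) := by
      rw [← e k t, map_add, lp.coeFn_add, Pi.add_apply, coeffL2_lap, coeffL2_embL2,
        ← coeffL_apply, ← coeffL_apply, map_sub, map_smul, Complex.real_smul, Complex.real_smul]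
      push_cast
      ring
    rw [e2, e3]
    exact h1

/-! ### The heat equation -/

/-- The function `exp (k²t)` times the `k`-th coefficient has zero derivative. No order of `s` and
`t` is assumed, so a solution that is slow at one time is slow at all times. -/
lemma coeff_eq_of_heat {T : ℝ} {v : ℝ → H2}
    (h : ∀ t ∈ Icc 0 T, HasDerivWithinAt (fun s => embL2 (v s)) (lap (v t)) (Icc 0 T) t)
    {s t : ℝ} (hs : s ∈ Icc 0 T) (ht : t ∈ Icc 0 T) (k : ℤ) :
    coeff (toCont (v t)) k =
      ((Real.exp (-(k : ℝ) ^ 2 * (t - s)) : ℝ) : ℂ) * coeff (toCont (v s)) k := by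
  set y : ℝ → ℂ := fun t => ((Real.exp ((k : ℝ) ^ 2 * t) : ℝ) : ℂ) * coeff (toCont (v t)) k with hy
  have hd : ∀ t ∈ Icc 0 T, HasDerivWithinAt y 0 (Icc 0 T) t := fun t ht => by
    have h1 : HasDerivWithinAt (fun s => coeff (toCont (v s)) k)
        (-(k : ℂ) ^ 2 * coeff (toCont (v t)) k) (Icc 0 T) t := by
      have h2 := ((lp.evalCLM ℝ (fun _ : ℤ => ℂ) 2 k).comp
        coeffL2.toContinuousLinearMap).hasFDerivAt.comp_hasDerivWithinAt t (h t ht)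
      have e1 : (fun s => coeff (toCont (v s)) k) = ((lp.evalCLM ℝ (fun _ : ℤ => ℂ) 2 k).comp
          coeffL2.toContinuousLinearMap) ∘ fun s => embL2 (v s) := by
        funext s
        exact (coeffL2_embL2 (v s) k).symm
      rw [e1, ← coeffL2_lap]
      exact h2
    refine ((hasDerivAt_exp_mode ((k : ℝ) ^ 2) t).hasDerivWithinAt.mul h1).congr_deriv ?_
    push_cast
    ring
  have h1 := (convex_Icc 0 T).norm_image_sub_le_of_norm_hasDerivWithin_le (C := 0) hd
    (fun _ _ => by simp) hs ht
  rw [zero_mul, norm_le_zero_iff, sub_eq_zero] at h1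
  have h2 : ((Real.exp ((k : ℝ) ^ 2 * t) : ℝ) : ℂ) * coeff (toCont (v t)) k =
    ((Real.exp ((k : ℝ) ^ 2 * s) : ℝ) : ℂ) * coeff (toCont (v s)) k := h1
  have h3 : Real.exp (-(k : ℝ) ^ 2 * (t - s)) =
      Real.exp (-(k : ℝ) ^ 2 * t) * Real.exp ((k : ℝ) ^ 2 * s) := by
    rw [← Real.exp_add]
    congr 1
    ring
  have h4 : Real.exp (-(k : ℝ) ^ 2 * t) * Real.exp ((k : ℝ) ^ 2 * t) = 1 := by
    rw [← Real.exp_add, show -(k : ℝ) ^ 2 * t + (k : ℝ) ^ 2 * t = 0 by ring, Real.exp_zero]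
  rw [h3, Complex.ofReal_mul, mul_assoc, ← h2, ← mul_assoc, ← Complex.ofReal_mul, h4,
    Complex.ofReal_one, one_mul]

lemma exists_flow_of_heat {T : ℝ} {v : ℝ → H2}
    (h : ∀ t ∈ Icc 0 T, HasDerivWithinAt (fun s => embL2 (v s)) (lap (v t)) (Icc 0 T) t)
    {s : ℝ} (hs : s ∈ Icc 0 T) (hv : v s ∈ slowSpace k₀) :
    ∃ v₀ : slowSpace k₀, ∀ t ∈ Icc 0 T, v t = flow k₀ t v₀ := by
  refine ⟨flow k₀ (-s) ⟨v s, hv⟩, fun t ht => coeff_injective fun k => ?_⟩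
  rw [← flow_add, coeff_flow, coeff_eq_of_heat h hs ht, ← sub_eq_add_neg]

lemma hasDerivAt_embL2_flow (v₀ : slowSpace k₀) (t : ℝ) :
    HasDerivAt (fun s => embL2 (flow k₀ s v₀ : H2)) (lap (flow k₀ t v₀ : H2)) t := by
  rw [← embL2_slowLap]
  exact embL2.hasFDerivAt.comp_hasDerivAt t (hasDerivAt_flow_coe v₀ t)

lemma IsSolution.heat {ε T : ℝ} {u v : ℝ → H2} (h : IsSolution ε T u v) :
    ∀ t ∈ Icc 0 T, HasDerivWithinAt (fun s => embL2 (v s)) (lap (v t)) (Icc 0 T) t := by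
  intro t ht
  obtain ⟨w, hw, hd⟩ := h.eq_v t ht
  rw [isLaplacian_iff.mp hw] at hd
  exact hd

lemma IsReducedSolution.heat {T : ℝ} {u v : ℝ → H2} (h : IsReducedSolution k₀ T u v) :
    ∀ t ∈ Icc 0 T, HasDerivWithinAt (fun s => embL2 (v s)) (lap (v t)) (Icc 0 T) t := by
  intro t ht
  obtain ⟨w, hw, hd⟩ := h.eq_v t ht
  rw [isLaplacian_iff.mp hw] at hd
  exact hd

lemma IsSolution.solvesFast {ε T a b : ℝ} {u v v' : ℝ → H2} (h : IsSolution ε T u v)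
    (hsub : Icc a b ⊆ Icc 0 T) (hv : ∀ t ∈ Icc a b, v t = v' t) : SolvesFast ε a b u v' where
  continuousOn := h.continuousOn_u.mono hsub
  eq t ht := by
    obtain ⟨w, hw, hd⟩ := h.eq_u t (hsub ht)
    rw [isLaplacian_iff.mp hw, hv t ht] at hd
    exact hd.mono hsub

lemma SolvesFast.isSolution {ε T : ℝ} {u : ℝ → H2} {v₀ : slowSpace k₀}
    (h : SolvesFast ε 0 T u fun t => flow k₀ t v₀) :
    IsSolution ε T u fun t => flow k₀ t v₀ where
  continuousOn_u := h.continuousOn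
  continuousOn_v := (continuous_subtype_val.comp (continuous_flow_apply v₀)).continuousOn
  eq_u t ht := ⟨_, isLaplacian_iff.mpr rfl, h.eq t ht⟩
  eq_v t _ := ⟨_, isLaplacian_iff.mpr rfl, (hasDerivAt_embL2_flow v₀ t).hasDerivWithinAt⟩

lemma norm_flow_antitone (v₀ : slowSpace k₀) {s t : ℝ} (hst : s ≤ t) :
    ‖flow k₀ t v₀‖ ≤ ‖flow k₀ s v₀‖ := by
  have h := norm_flow_apply_le (sub_nonneg.mpr hst) (flow k₀ s v₀)
  rwa [← flow_add, sub_add_cancel] at h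

end

end FastReaction

namespace FastReaction

noncomputable section

/-! ### The slow manifold -/

variable {k₀ : ℕ}

/-- `U` is the graph of a slow manifold over the ball of radius `σ`, at distance at most `R` from
the graph `φ` of the critical manifold. -/
structure IsSlowGraph (ε σ R : ℝ) (φ : H2 → H2) (U : slowSpace k₀ → H2) : Prop where
  contDiff : ContDiff ℝ 1 U
  mem_critical : ∀ v : H2, ‖v‖ ≤ σ → (φ v, v) ∈ criticalManifold
  eq_of_mem_critical : ∀ u v : H2, ‖v‖ ≤ σ → (u, v) ∈ criticalManifold → u = φ v
  norm_sub_le : ∀ v : slowSpace k₀, ‖v‖ ≤ σ → ‖U v - φ v‖ ≤ R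
  solvesFast : ∀ (v₀ : slowSpace k₀) (a b : ℝ), (∀ t ∈ Icc a b, ‖flow k₀ t v₀‖ ≤ σ) →
    SolvesFast ε a b (fun t => U (flow k₀ t v₀)) fun t => flow k₀ t v₀

/-- The graph map with values in `H² × Y_F`. -/
def graphMap (U : slowSpace k₀ → H2) (v : slowSpace k₀) : H2 × fastSpace k₀ := (U v, 0)

lemma graphPoint_graphMap (U : slowSpace k₀ → H2) (v : slowSpace k₀) :
    graphPoint (graphMap U) v = (U v, (v : H2)) := by
  rw [graphPoint, graphMap]
  simp

namespace IsSlowGraph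

variable {ε σ R : ℝ} {φ : H2 → H2} {U : slowSpace k₀ → H2}

/-- In both directions `v` is a slow trajectory of nonincreasing norm. Leaving is excluded by
forward uniqueness; for entering, backward uniqueness keeps `u` on the graph for as long as `v` has
norm at most `σ`. -/
lemma isLocallyInvariant (h : IsSlowGraph ε σ R φ U) :
    IsLocallyInvariant ε (graphManifold (graphMap U) σ) (graphBoundary (graphMap U) σ) := by
  intro T u v hsol s t hs hst htT
  have hs' : s ∈ Icc 0 T := ⟨hs, hst.le.trans htT⟩
  have ht' : t ∈ Icc 0 T := ⟨hs.trans hst.le, htT⟩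
  constructor
  · rintro ⟨v₀, hv₀, hp⟩ hnot
    exfalso
    rw [graphPoint_graphMap, Prod.mk.injEq] at hp
    have hv₀' : ‖v₀‖ ≤ σ := by simpa using hv₀
    obtain ⟨w, hw⟩ := exists_flow_of_heat (k₀ := k₀) hsol.heat hs' (hp.2 ▸ v₀.2)
    have hws : flow k₀ s w = v₀ := Subtype.ext (by rw [← hw s hs', hp.2])
    have hsub : Icc s t ⊆ Icc 0 T := Icc_subset_Icc hs htT
    have h1 := h.solvesFast w s t fun r hr => (norm_flow_antitone w hr.1).trans (hws ▸ hv₀')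
    have h2 := hsol.solvesFast hsub fun r hr => hw r (hsub hr)
    have h3 := h2.eq_of_left h1 (by rw [hws, hp.1]) t (right_mem_Icc.mpr hst.le)
    refine hnot ⟨flow k₀ t w, ?_, ?_⟩
    · simpa using (norm_flow_antitone w hst.le).trans (hws ▸ hv₀')
    · rw [graphPoint_graphMap, h3, hw t ht']
  · rintro hnot ⟨v₀, hv₀, hp⟩
    rw [graphPoint_graphMap, Prod.mk.injEq] at hp
    have hv₀' : ‖v₀‖ ≤ σ := by simpa using hv₀
    obtain ⟨w, hw⟩ := exists_flow_of_heat (k₀ := k₀) hsol.heat ht' (hp.2 ▸ v₀.2)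
    have hwt : flow k₀ t w = v₀ := Subtype.ext (by rw [← hw t ht', hp.2])
    have key : ∀ r ∈ Icc s t, ‖flow k₀ r w‖ ≤ σ → u r = U (flow k₀ r w) := by
      intro r hr hle
      have hsub : Icc r t ⊆ Icc 0 T := Icc_subset_Icc (hs.trans hr.1) htT
      have h1 := h.solvesFast w r t fun q hq => (norm_flow_antitone w hq.1).trans hle
      have h2 := hsol.solvesFast hsub fun q hq => hw q (hsub hq)
      exact h2.eq_of_right h1 hr.2 (by rw [hwt, hp.1])
    by_cases hle : ‖flow k₀ s w‖ ≤ σ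
    · exfalso
      refine hnot ⟨flow k₀ s w, by simpa using hle, ?_⟩
      rw [graphPoint_graphMap, key s (left_mem_Icc.mpr hst.le) hle, hw s hs']
    -- The norm exceeds `σ` at time `s` and not at time `t`, so it equals `σ` at some `r > s`, and
    -- at that time the solution lies on the boundary.
    · have hc : ContinuousOn (fun r => ‖flow k₀ r w‖) (Icc s t) :=
        (continuous_flow_apply w).norm.continuousOn
      obtain ⟨r, hr, hrσ⟩ := intermediate_value_Icc' hst.le hc
        ⟨(by rw [hwt]; exact hv₀'), (not_le.mp hle).le⟩
      have hrσ : ‖flow k₀ r w‖ = σ := hrσ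
      refine ⟨r, ⟨lt_of_le_of_ne hr.1 ?_, hr.2⟩, flow k₀ r w, by simpa using hrσ, ?_⟩
      · rintro rfl
        exact hle hrσ.le
      · rw [graphPoint_graphMap, key r hr hrσ.le, hw r ⟨hs.trans hr.1, hr.2.trans htT⟩]

lemma hausdorffEDist_le (h : IsSlowGraph ε σ R φ U) :
    Metric.hausdorffEDist (graphManifold (graphMap U) σ) (reducedCritical k₀ σ) ≤
      ENNReal.ofReal R := by
  have hd : ∀ v : slowSpace k₀, ‖v‖ ≤ σ →
      edist ((U v, (v : H2)) : H2 × H2) (φ v, (v : H2)) ≤ ENNReal.ofReal R := by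
    intro v hv
    rw [edist_dist]
    refine ENNReal.ofReal_le_ofReal ?_
    rw [Prod.dist_eq, dist_self, dist_eq_norm]
    exact max_le (h.norm_sub_le v hv) ((norm_nonneg _).trans (h.norm_sub_le v hv))
  refine Metric.hausdorffEDist_le_of_mem_edist ?_ ?_
  · rintro _ ⟨v, hv, rfl⟩
    have hv' : ‖v‖ ≤ σ := by simpa using hv
    refine ⟨(φ v, (v : H2)), ⟨h.mem_critical v hv', v.2, hv'⟩, ?_⟩
    rw [graphPoint_graphMap]
    exact hd v hv'
  · rintro ⟨u, v⟩ ⟨hc, hs, hn⟩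
    have hn' : ‖v‖ ≤ σ := hn
    refine ⟨(U ⟨v, hs⟩, v), ⟨⟨v, hs⟩, by simpa using hn', graphPoint_graphMap U _⟩, ?_⟩
    rw [h.eq_of_mem_critical u v hn' hc, edist_comm]
    exact hd ⟨v, hs⟩ hn'

lemma norm_flow_le_of_nonneg {v₀ : slowSpace k₀} (hv₀ : ‖v₀‖ ≤ σ) {t : ℝ} (ht : 0 ≤ t) :
    ‖flow k₀ t v₀‖ ≤ σ := (norm_flow_apply_le ht v₀).trans hv₀

lemma exists_solution (h : IsSlowGraph ε σ R φ U) {v₀ : slowSpace k₀} (hv₀ : ‖v₀‖ ≤ σ) (T : ℝ) :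
    ∃ u v : ℝ → H2, IsSolution ε T u v ∧ (u 0, v 0) = graphPoint (graphMap U) v₀ := by
  refine ⟨_, _, (h.solvesFast v₀ 0 T fun t ht => norm_flow_le_of_nonneg hv₀ ht.1).isSolution, ?_⟩
  rw [graphPoint_graphMap, flow_zero]

lemma exists_reducedSolution (h : IsSlowGraph ε σ R φ U) {v₀ : slowSpace k₀} (hv₀ : ‖v₀‖ ≤ σ)
    (T : ℝ) : ∃ u v : ℝ → H2, IsReducedSolution k₀ T u v ∧ v 0 = v₀ := by
  refine ⟨fun t => φ (flow k₀ t v₀), fun t => flow k₀ t v₀, ?_,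
    congrArg Subtype.val (flow_zero v₀)⟩
  exact
    { continuousOn_v := (continuous_subtype_val.comp (continuous_flow_apply v₀)).continuousOn
      mem_critical := fun t ht => h.mem_critical _ (norm_flow_le_of_nonneg hv₀ ht.1)
      mem_slow := fun t _ => (flow k₀ t v₀).2
      eq_v := fun t _ =>
        ⟨_, isLaplacian_iff.mpr rfl, (hasDerivAt_embL2_flow v₀ t).hasDerivWithinAt⟩ }

lemma eq_flow_of_heat {T : ℝ} {v : ℝ → H2} {v₀ : slowSpace k₀}
    (h : ∀ t ∈ Icc 0 T, HasDerivWithinAt (fun s => embL2 (v s)) (lap (v t)) (Icc 0 T) t)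
    (h0 : v 0 = v₀) : ∀ t ∈ Icc 0 T, v t = flow k₀ t v₀ := by
  intro t ht
  have hmem : (0 : ℝ) ∈ Icc 0 T := ⟨le_rfl, ht.1.trans ht.2⟩
  refine coeff_injective fun k => ?_
  rw [coeff_flow, coeff_eq_of_heat h hmem ht, h0, sub_zero]

/-- Both `v` components are the same heat trajectory. By uniqueness the `u` components are `U` and
`φ` evaluated on it, so the error is the distance of the two graphs, whatever `T` is. -/
lemma norm_solution_sub_le (h : IsSlowGraph ε σ R φ U) {v₀ : slowSpace k₀} (hv₀ : ‖v₀‖ ≤ σ)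
    {T : ℝ} {u v uζ vζ : ℝ → H2} (hsol : IsSolution ε T u v)
    (h0 : (u 0, v 0) = graphPoint (graphMap U) v₀) (hred : IsReducedSolution k₀ T uζ vζ)
    (h0' : vζ 0 = v₀) (t : ℝ) (ht : t ∈ Icc 0 T) : ‖u t - uζ t‖ + ‖v t - vζ t‖ ≤ R := by
  rw [graphPoint_graphMap, Prod.mk.injEq] at h0
  have hv := eq_flow_of_heat hsol.heat h0.2
  have hvζ := eq_flow_of_heat hred.heat h0'
  have hle := norm_flow_le_of_nonneg hv₀ ht.1
  have h1 := h.solvesFast v₀ 0 T fun t ht => norm_flow_le_of_nonneg hv₀ ht.1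
  have h2 := (hsol.solvesFast subset_rfl hv).eq_of_left h1 (by rw [flow_zero, h0.1]) t ht
  have h3 := hred.mem_critical t ht
  rw [hvζ t ht] at h3
  have h4 := h.eq_of_mem_critical _ _ hle h3
  rw [h2, h4, hv t ht, hvζ t ht, sub_self, norm_zero, add_zero]
  exact h.norm_sub_le _ hle

lemma contDiff_graphMap (h : IsSlowGraph ε σ R φ U) : ContDiff ℝ 1 (graphMap U) :=
  h.contDiff.prodMk contDiff_const

end IsSlowGraph

/-! ### Construction -/

/-- Outside the ball of radius `ρ` nothing is known about `G`, but the product vanishes near every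
such point. -/
lemma contDiff_bump_smul {ρ : ℝ} (χ : ContDiffBump (0 : slowSpace k₀)) (hχ : χ.rOut < ρ)
    {G : slowSpace k₀ → H2} (hG : ∀ v, ‖v‖ < ρ → ContDiffAt ℝ 1 G v) :
    ContDiff ℝ 1 (fun v => χ v • G v) := by
  refine contDiff_iff_contDiffAt.mpr fun v => ?_
  by_cases hv : ‖v‖ < ρ
  · exact χ.contDiff.contDiffAt.smul (hG v hv)
  · have hnot : v ∉ tsupport χ := by
      rw [χ.tsupport_eq]
      intro hmem
      have : ‖v‖ ≤ χ.rOut := by simpa using hmem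
      linarith
    have h0 : (fun v => χ v • G v) =ᶠ[nhds v] fun _ => 0 := by
      filter_upwards [notMem_tsupport_iff_eventuallyEq.mp hnot] with w hw
      rw [hw]
      simp
    exact contDiffAt_const.congr_of_eventuallyEq h0

lemma exists_bound_fderiv {E F : Type*} [NormedAddCommGroup E] [NormedSpace ℝ E]
    [NormedAddCommGroup F] [NormedSpace ℝ F] {f : E → F} (hs : HasCompactSupport f)
    (h : ContDiff ℝ 1 f) : ∃ M, ∀ v, ‖fderiv ℝ f v‖ ≤ M :=
  (h.continuous_fderiv one_ne_zero).bounded_above_of_compact_support (hs.fderiv ℝ)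

lemma norm_bump_smul_le (χ : ContDiffBump (0 : slowSpace k₀)) {G : slowSpace k₀ → H2} {M : ℝ}
    (hM0 : 0 ≤ M) (hM : ∀ v, ‖v‖ < χ.rOut → ‖G v‖ ≤ M) (v : slowSpace k₀) : ‖χ v • G v‖ ≤ M := by
  rw [norm_smul, Real.norm_of_nonneg χ.nonneg]
  by_cases hv : ‖v‖ < χ.rOut
  · exact (mul_le_of_le_one_left (norm_nonneg _) χ.le_one).trans (hM v hv)
  · rw [χ.zero_of_le_dist (by simpa using hv), zero_mul]
    exact hM0

variable (k₀) in
-- The abstract fixed point with `b = ε⁻¹`, `ℓ = k₀²`, the cut-off forcing `F` and the cut-off `B`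
-- of `φ`. The Duhamel integral sees the whole past, where slow trajectories may leave every ball;
-- this is why the data are made global. In the ball of radius `σ` the cut-off is invisible and `φ +
-- W` solves the original equation.
theorem exists_isSlowGraph {φ : H2 → H2} {T : H2 → H2 →L[ℝ] H2} {ρ δ σ ε θ : ℝ}
    (hcrit : IsCriticalMap φ T ρ δ) (hδ0 : 0 ≤ δ) (hσ : 0 < σ) (hσρ : 4 * σ ≤ ρ) (hε : 0 < ε)
    (hθ : 0 < θ) (hk : ε * (k₀ : ℝ) ^ 2 ≤ 1 - θ) (hδ : algConst * δ ≤ θ / 16)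
    (hr : 2 * (576 * derivConst * σ ^ 2) * (ε * k₀) ≤ δ) :
    ∃ U : slowSpace k₀ → H2,
      IsSlowGraph ε σ (2 * (576 * derivConst * σ ^ 2) * (ε * k₀)) φ U := by
  -- `576 = 64 · 3²`: the bound of the remainder on the support of the cut-off, of radius `3σ`.
  set f : ℝ := 576 * derivConst * σ ^ 2 * k₀ with hf
  set r : ℝ := 2 * (576 * derivConst * σ ^ 2) * (ε * k₀) with hrdef
  have hdc := derivConst_nonneg
  have hf0 : 0 ≤ f := by positivity
  let χ : ContDiffBump (0 : slowSpace k₀) := ⟨2 * σ, 3 * σ, by linarith, by linarith⟩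
  have hχ : χ.rOut < ρ := by
    change 3 * σ < ρ
    linarith
  set F : slowSpace k₀ → H2 := fun v => χ v • remainder T v with hFdef
  set B : slowSpace k₀ → H2 := fun v => χ v • φ v with hBdef
  have hF : ContDiff ℝ 1 F := contDiff_bump_smul χ hχ fun v hv => contDiffAt_remainder hcrit v hv
  have hB : ContDiff ℝ 1 B := contDiff_bump_smul χ hχ fun v hv =>
    (hcrit.contDiffAt v hv).comp v (slowSpace k₀).subtypeL.contDiff.contDiffAt
  -- These derivative bounds may depend on `k₀` and `σ` in any way; they do not enter the distance
  -- `r`.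
  obtain ⟨f', hf'⟩ := exists_bound_fderiv χ.hasCompactSupport.smul_right hF
  obtain ⟨β', hβ'⟩ := exists_bound_fderiv χ.hasCompactSupport.smul_right hB
  have hFb : ∀ v, ‖F v‖ ≤ f := norm_bump_smul_le χ hf0 fun v hv => by
    refine (norm_remainder_le hcrit v (hv.trans hχ)).trans ?_
    have hv' : ‖v‖ ≤ 3 * σ := le_of_lt hv
    have h1 := pow_le_pow_left₀ (norm_nonneg v) hv' 2
    have h2 := mul_le_mul_of_nonneg_left h1 (show 0 ≤ 64 * derivConst * k₀ by positivity)
    rw [hf]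
    linarith
  have hBb : ∀ v, ‖B v‖ ≤ δ := norm_bump_smul_le χ hδ0 fun v hv =>
    hcrit.norm_le v (lt_trans hv hχ)
  have hbℓ : (k₀ : ℝ) ^ 2 < ε⁻¹ := by
    rw [← mul_lt_mul_iff_right₀ hε, mul_inv_cancel₀ hε.ne']
    linarith
  -- The gap factor is `1/(1 - εk₀²) ≤ 1/θ`; since `r ≤ δ`, the remaining factor is at most `4
  -- algConst δ ≤ θ/4`.
  have hsmall : ε⁻¹ * (ε⁻¹ - (k₀ : ℝ) ^ 2)⁻¹ * (algConst * (2 * δ + 2 * r)) ≤ 1 / 4 := by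
    have e : ε⁻¹ * (ε⁻¹ - (k₀ : ℝ) ^ 2)⁻¹ = (1 - ε * (k₀ : ℝ) ^ 2)⁻¹ := by
      rw [← mul_inv, mul_sub, mul_inv_cancel₀ hε.ne']
    have h1 : θ ≤ 1 - ε * (k₀ : ℝ) ^ 2 := by linarith
    rw [e, inv_mul_le_iff₀ (hθ.trans_le h1)]
    have h2 := mul_le_mul_of_nonneg_left hr algConst_nonneg
    linarith
  obtain ⟨W, hW, hWr, hWfix⟩ := exists_invariant_graph (isFlowPair_heat k₀) (sq_nonneg _) hbℓ
    norm_mul_apply_le algConst_nonneg hF hB hFb hBb hf' hβ' (r := r)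
    (le_of_eq (by rw [inv_inv, hf, hrdef]; ring)) hsmall
  have hb0 : 0 < ε⁻¹ := inv_pos.mpr hε
  have hNc := continuous_nonlin (m := mul) (b := ε⁻¹) hF hB hW.continuous
  have hNb : ∀ y, ‖nonlin mul F B ε⁻¹ W y‖ ≤ f + ε⁻¹ * (algConst * (2 * δ + r) * r) := fun y =>
    norm_nonlin_le norm_mul_apply_le algConst_nonneg hb0.le (hFb y) (hBb y) (hWr y)
  have hWeq : W = duhamel heat (backFlow k₀) ε⁻¹ (nonlin mul F B ε⁻¹ W) := funext hWfix
  have hχ1 : ∀ v : slowSpace k₀, ‖v‖ ≤ 2 * σ → χ v = 1 := fun v hv =>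
    χ.one_of_mem_closedBall (by simpa using hv)
  have hσρ' : ∀ v : slowSpace k₀, ‖v‖ ≤ σ → ‖v‖ < ρ := fun v hv => by linarith
  have hB1 : ∀ v : slowSpace k₀, ‖v‖ ≤ σ → B v = φ v := fun v hv => by
    rw [hBdef]
    simp only
    rw [hχ1 v (by linarith), one_smul]
  have hF1 : ∀ v : slowSpace k₀, ‖v‖ ≤ σ → F v = remainder T v := fun v hv => by
    rw [hFdef]
    simp only
    rw [hχ1 v (by linarith), one_smul]
  refine ⟨fun v => B v + W v, hB.add hW, fun v hv => hcrit.mem_criticalManifold (by linarith),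
    fun u v hv => hcrit.eq_of_mem_criticalManifold (by linarith), fun v hv => ?_,
    fun v₀ a b hle => ⟨?_, fun t ht => ?_⟩⟩
  · rw [hB1 v hv, add_sub_cancel_left]
    exact hWr v
  · exact ((hB.continuous.add hW.continuous).comp (continuous_flow_apply v₀)).continuousOn
  · have hvt := hle t ht
    set vt := flow k₀ t v₀ with hvtdef
    have d1 := hasDerivAt_duhamel_flow hNc hb0 hNb (hWeq ▸ hW.continuous) v₀ t
    rw [← hWeq, ← hvtdef] at d1
    have d2 : HasDerivAt (fun t => embL2 (B (flow k₀ t v₀)))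
        (embL2 (((2 : ℝ) • (T vt).comp (mul vt)) (slowLap k₀ vt : H2))) t := by
      have h1 := (hcrit.hasFDerivAt (v := (vt : H2)) (hσρ' vt hvt)).comp_hasDerivAt t
        (hasDerivAt_flow_coe v₀ t)
      have h2 := embL2.hasFDerivAt.comp_hasDerivAt t h1
      refine h2.congr_of_eventuallyEq ?_
      -- The cut-off equals one up to radius `2σ`, hence along the trajectory near `t` even if its
      -- norm at `t` is exactly `σ`.
      have hnear : ∀ᶠ s in nhds t, ‖flow k₀ s v₀‖ < 2 * σ :=
        (continuous_flow_apply v₀).norm.continuousAt.tendsto.eventually_lt_const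
          (lt_of_le_of_lt hvt (by linarith))
      filter_upwards [hnear] with s hs
      change embL2 (χ _ • φ _) = embL2 (φ _)
      rw [hχ1 _ hs.le, one_smul]
    have d3 := d2.add d1
    have e0 : (fun s => embL2 (B (flow k₀ s v₀) + W (flow k₀ s v₀))) =
        (fun s => embL2 (B (flow k₀ s v₀))) + fun s => embL2 (W (flow k₀ s v₀)) := by
      funext s
      exact map_add _ _ _
    rw [e0]
    refine (d3.congr_deriv ?_).hasDerivWithinAt
    -- The relation `φ² + φ = v²` cancels the terms of order zero in `W`.
    have hreact : toCont (vt : H2) ^ 2 - toCont (B vt + W vt) * (toCont (B vt + W vt) + 1) =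
        toCont (-((2 : ℝ) • mul (B vt) (W vt) + mul (W vt) (W vt)) - W vt) := by
      have h1 := congrArg toCont (hcrit.eq (vt : H2) (hσρ' vt hvt))
      rw [map_add, toCont_mul, toCont_mul] at h1
      rw [hB1 vt hvt, map_sub, map_neg, map_add, map_add, map_smul, toCont_mul, toCont_mul,
        two_smul, sq, ← h1]
      ring
    rw [hreact, ← embL2_apply, ← map_smul, map_add lap, hB1 vt hvt, lap_criticalMap hcrit vt
      (hσρ' vt hvt), nonlin, hF1 vt hvt, hB1 vt hvt, map_add embL2, smul_sub, smul_neg,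
      sub_eq_add_neg (remainder T vt), map_sub, map_add embL2, map_sub]
    abel

end

end FastReaction

/-! ### Choice of the constants -/

theorem mainTheorem10 (lam₀ : ℝ) (hlam_lower : -1 < lam₀) (hlam_upper : lam₀ < 0) :
    ∃ σ₀ > (0 : ℝ), ∀ σ : ℝ, 0 < σ → σ ≤ σ₀ →
    ∃ ε₀ > (0 : ℝ), ∃ ζ₀ > (0 : ℝ), ∃ C > (0 : ℝ),
    ∀ ε ζ : ℝ, 0 < ε → ε ≤ ε₀ → 0 < ζ → ζ ≤ ζ₀ → ε * ζ⁻¹ < 1 →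
    ∀ k₀ : ℕ, -((k₀ : ℝ) + 1) ^ 2 < ζ⁻¹ * lam₀ → ζ⁻¹ * lam₀ ≤ -(k₀ : ℝ) ^ 2 →
    ∃ h : slowSpace k₀ → H2 × fastSpace k₀,
      ContDiff ℝ 1 h ∧
      IsLocallyInvariant ε (graphManifold h σ) (graphBoundary h σ) ∧
      Metric.hausdorffEDist (graphManifold h σ) (reducedCritical k₀ σ) ≤
        ENNReal.ofReal (C * (ε + ζ ^ (1 / 2 : ℝ))) ∧
      ∀ v₀ : slowSpace k₀, ‖v₀‖ ≤ σ → ∀ T : ℝ, 0 < T →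
        (∃ u v : ℝ → H2, IsSolution ε T u v ∧ (u 0, v 0) = graphPoint h v₀) ∧
        (∃ uζ vζ : ℝ → H2, IsReducedSolution k₀ T uζ vζ ∧ vζ 0 = v₀) ∧
        ∀ u v uζ vζ : ℝ → H2,
          IsSolution ε T u v → (u 0, v 0) = graphPoint h v₀ →
          IsReducedSolution k₀ T uζ vζ → vζ 0 = v₀ →
          ∀ t ∈ Set.Icc 0 T, ‖u t - uζ t‖ + ‖v t - vζ t‖ ≤ C * (ε + ζ ^ (1 / 2 : ℝ)) := by
  have hc := algConst_nonneg
  have hdc := derivConst_nonneg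
  -- `θ` is the lower bound for the gap `1 - εk₀²`. The size `δ` of `φ` is adapted to it and fixes
  -- `ρ`, hence `σ₀ = ρ/4`, before `σ` is given.
  set θ : ℝ := 1 + lam₀ with hθdef
  have hθ : 0 < θ := by linarith
  set δ : ℝ := θ / (16 * (algConst + 1)) with hδdef
  have hδ : 0 < δ := by positivity
  have hδ' : algConst * δ ≤ θ / 16 := by
    rw [hδdef, mul_div_assoc', div_le_div_iff₀ (by positivity) (by norm_num)]
    nlinarith
  obtain ⟨φ, S, ρ, hρ, hcrit⟩ := exists_criticalMap hδ
  refine ⟨ρ / 4, by positivity, fun σ hσ hσρ => ?_⟩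
  set A : ℝ := 2 * (576 * derivConst * σ ^ 2) with hA
  have hA0 : 0 ≤ A := by positivity
  -- The smallness of `ε` comes from `ε < ζ`, so `ε₀ = 1` suffices. The choice of `ζ₀` makes the
  -- distance `Aεk₀ ≤ A√ζ` at most `δ`.
  refine ⟨1, one_pos, (δ / (A + 1)) ^ 2, by positivity, A + 1, by positivity, ?_⟩
  intro ε ζ hε _ hζ hζ₀ hεζ k₀ _ hk
  have hζ12 : ζ ^ (1 / 2 : ℝ) = Real.sqrt ζ := (Real.sqrt_eq_rpow ζ).symm
  have hs0 : 0 < Real.sqrt ζ := Real.sqrt_pos.mpr hζ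
  have hss : Real.sqrt ζ ^ 2 = ζ := Real.sq_sqrt hζ.le
  have hsδ : Real.sqrt ζ ≤ δ / (A + 1) := by
    rw [Real.sqrt_le_left (by positivity)]
    exact hζ₀
  have hεζ' : ε ≤ ζ := by
    rw [← div_eq_mul_inv, div_lt_one hζ] at hεζ
    exact hεζ.le
  have hkζ : ζ * (k₀ : ℝ) ^ 2 ≤ -lam₀ := by
    have h1 := mul_le_mul_of_nonneg_left hk hζ.le
    rw [mul_inv_cancel_left₀ hζ.ne'] at h1
    linarith
  have hεk2 : ε * (k₀ : ℝ) ^ 2 ≤ 1 - θ := by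
    have := mul_le_mul_of_nonneg_right hεζ' (sq_nonneg (k₀ : ℝ))
    linarith
  have hεk : ε * k₀ ≤ Real.sqrt ζ := by
    -- This is `ζk₀² ≤ -λ₀ < 1`. With `ε ≤ ζ` it yields `εk₀ ≤ √ζ`, the origin of the rate
    -- `ζ^{1/2}`.
    have h1 : Real.sqrt ζ * k₀ ≤ 1 := by
      rw [← sq_le_one_iff₀ (by positivity), mul_pow, hss]
      linarith
    calc ε * k₀ ≤ ζ * k₀ := by gcongr
      _ = Real.sqrt ζ * (Real.sqrt ζ * k₀) := by rw [← mul_assoc, ← sq, hss]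
      _ ≤ Real.sqrt ζ * 1 := by gcongr
      _ = Real.sqrt ζ := mul_one _
  have hAk : A * (ε * k₀) ≤ A * Real.sqrt ζ := mul_le_mul_of_nonneg_left hεk hA0
  have hr : A * (ε * k₀) ≤ δ := by
    have h1 := mul_le_mul_of_nonneg_left hsδ (show 0 ≤ A + 1 by positivity)
    rw [mul_div_cancel₀ _ (by positivity)] at h1
    linarith
  have hR : A * (ε * k₀) ≤ (A + 1) * (ε + ζ ^ (1 / 2 : ℝ)) := by
    rw [hζ12]
    nlinarith
  obtain ⟨U, hU⟩ := exists_isSlowGraph k₀ hcrit hδ.le hσ (by linarith) hε hθ hεk2 hδ' hr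
  refine ⟨graphMap U, hU.contDiff_graphMap, hU.isLocallyInvariant,
    hU.hausdorffEDist_le.trans (ENNReal.ofReal_le_ofReal hR), fun v₀ hv₀ T _ =>
    ⟨hU.exists_solution hv₀ T, hU.exists_reducedSolution hv₀ T, ?_⟩⟩
  intro u v uζ vζ h1 h2 h3 h4 t ht
  exact (hU.norm_solution_sub_le hv₀ h1 h2 h3 h4 t ht).trans hR
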